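/- An instance of the Workflow Satisfiability Problem (WSP) consists of a finite partially ordered set $(S,\leqslant)$ of $k$ steps, a set $U$ of $n$ users, an authorization relation $A \subseteq S \times U$ such that for every $s \in S$ there is a user $u$ with $(s,u) \in A$, and a finite collection $C$ of $c$ constraints. A plan is a function $\pi : S \to U$; it is valid if $(s,\pi(s)) \in A$ for all $s \in S$ and $\pi$ satisfies all constraints in $C$. To solve WSP is to output a valid plan, or to report correctly that there is none. In $\mathrm{WSP}(=)$ all constraints have the form $(=,S_1,S_2)$ with arbitrary $S_1,S_2 \subseteq S$ (Type 3 constraints); a plan $\pi$ satisfies $(=,S_1,S_2)$ if $\pi(s_1)=\pi(s_2)$ for some $s_1 \in S_1$ and $s_2 \in S_2$. In $\mathrm{WSP}_2(=)$, moreover, at least one of $S_1,S_2$ is a singleton in every constraint. Time is measured on a random access machine with logarithmic cost, and $\widetilde{O}(T)$ means $O(T\log^d T)$ for some constant $d$. Theorem. (1) $\mathrm{WSP}_2(=)$ can be solved in time $\widetilde{O}(2^k(c+n^2))$. (2) $\mathrm{WSP}(=)$ can be solved in time $\widetilde{O}(2^{k+c}(c+n^2))$. (3) From every instance of $\mathrm{WSP}(=)$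 one can delete constraints so that at most $3^k$ constraints remain and the set of valid plans is unchanged. (4) $\mathrm{WSP}(=)$ is fixed-parameter tractable with parameter $k$: it can be solved in time $O(f(k)N^d)$, where $N$ is the size of the input, $f$ is a computable function of $k$ alone and $d$ is a constant. -/

import Mathlib

namespace WSP

/-! ### Workflows, constraints and plans -/

/-- An entailment constraint `(ρ, S', S'')` on steps `S` and users `U`. -/
structure EntailmentConstraint (S U : Type) where
  rel : U → U → Prop
  left : Finset S
  right : Finset S

/-- A plan satisfies `(ρ, S', S'')` iff `(π s', π s'') ∈ ρ` for some `s' ∈ S'`, `s'' ∈ S''`. -/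
def EntailmentConstraint.Satisfied {S U : Type} (γ : EntailmentConstraint S U) (π : S → U) : Prop :=
  ∃ s ∈ γ.left, ∃ t ∈ γ.right, γ.rel (π s) (π t)

/-- Type 2: at least one of the two sets is a singleton (so Type 1 is a special case).
Type 3 constraints are arbitrary. -/
def EntailmentConstraint.IsType2 {S U : Type} (γ : EntailmentConstraint S U) : Prop :=
  γ.left.card = 1 ∨ γ.right.card = 1

/-- A constrained workflow authorization schema `(S, U, ≤, A, C)` with entailment constraints.
Every step has an authorized user. The constraints are given as a list; repetitions are allowed. -/
structure Schema (S U : Type) where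
  order : PartialOrder S
  auth : S → U → Prop
  exists_auth : ∀ s, ∃ u, auth s u
  constraints : List (EntailmentConstraint S U)

/-- A plan is valid if it is authorized and satisfies all constraints. -/
def Schema.Valid {S U : Type} (W : Schema S U) (π : S → U) : Prop :=
  (∀ s, W.auth s (π s)) ∧ ∀ γ ∈ W.constraints, γ.Satisfied π

/-- The same schema with the constraints replaced by `C`. -/
def Schema.withConstraints {S U : Type} (W : Schema S U) (C : List (EntailmentConstraint S U)) :
    Schema S U where
  order := W.order
  auth := W.auth
  exists_auth := W.exists_auth
  constraints := C

/-- An instance of the workflow satisfiability problem: `k` steps, `n` users and a schema. -/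
structure Instance where
  k : ℕ
  n : ℕ
  schema : Schema (Fin k) (Fin n)

/-- The number of constraints. -/
def Instance.c (I : Instance) : ℕ := I.schema.constraints.length

/-- `WSP(=)`: all constraints have the form `(=, S', S'')`. -/
def WSPEq (I : Instance) : Prop :=
  ∀ γ ∈ I.schema.constraints, γ.rel = Eq

/-- `WSP₂(=)`: moreover all constraints are of Type 2 (or 1). -/
def WSP2Eq (I : Instance) : Prop :=
  WSPEq I ∧ ∀ γ ∈ I.schema.constraints, γ.IsType2

/-! ### Random access machine with logarithmic cost

A program uses finitely many arrays (memory segments) of natural numbers, each named by a constant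
of the program and indexed by natural numbers that may be computed at run time. Every elementary
operation costs one plus the binary lengths of all the numbers (operands, addresses, contents)
that it handles. -/

/-- Contents of the memory: array name, index, value. -/
abbrev Memory := ℕ → ℕ → ℕ

inductive Expr where
  | lit (v : ℕ)
  | load (arr : ℕ) (idx : Expr)
  | add (a b : Expr)
  | sub (a b : Expr)
  | mul (a b : Expr)
  | div (a b : Expr)

/-- Subtraction is truncated at `0`, and division rounds down, with `x / 0 = 0`. -/
def Expr.eval (m : Memory) : Expr → ℕ
  | lit v => v
  | load arr idx => m arr (idx.eval m)
  | add a b => a.eval m + b.eval m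
  | sub a b => a.eval m - b.eval m
  | mul a b => a.eval m * b.eval m
  | div a b => a.eval m / b.eval m

/-- Logarithmic cost; `Nat.size` is the binary length. -/
def Expr.cost (m : Memory) : Expr → ℕ
  | lit v => 1 + v.size
  | load arr idx => idx.cost m + (1 + (idx.eval m).size + (m arr (idx.eval m)).size)
  | add a b => a.cost m + b.cost m + (1 + (a.eval m).size + (b.eval m).size)
  | sub a b => a.cost m + b.cost m + (1 + (a.eval m).size + (b.eval m).size)
  | mul a b => a.cost m + b.cost m + (1 + (a.eval m).size + (b.eval m).size)
  | div a b => a.cost m + b.cost m + (1 + (a.eval m).size + (b.eval m).size)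

inductive Program where
  | skip
  | store (arr : ℕ) (idx val : Expr)
  | seq (p q : Program)
  | branch (test : Expr) (p q : Program)
  | loop (test : Expr) (p : Program)

def Memory.write (m : Memory) (arr idx val : ℕ) : Memory :=
  fun a i => if a = arr ∧ i = idx then val else m a i

/-- `Exec p m m' t`: started with memory `m`, the program `p` halts with memory `m'` at cost `t`. -/
inductive Exec : Program → Memory → Memory → ℕ → Prop where
  | skip (m : Memory) : Exec .skip m m 1
  | store (m : Memory) (arr : ℕ) (idx val : Expr) :
      Exec (.store arr idx val) m (m.write arr (idx.eval m) (val.eval m))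
        (idx.cost m + val.cost m + (1 + (idx.eval m).size + (val.eval m).size))
  | seq {p q : Program} {m₁ m₂ m₃ : Memory} {t₁ t₂ : ℕ} :
      Exec p m₁ m₂ t₁ → Exec q m₂ m₃ t₂ → Exec (.seq p q) m₁ m₃ (t₁ + t₂)
  | branch_true {e : Expr} {p q : Program} {m m' : Memory} {t : ℕ} :
      e.eval m ≠ 0 → Exec p m m' t →
      Exec (.branch e p q) m m' (e.cost m + (1 + (e.eval m).size) + t)
  | branch_false {e : Expr} {p q : Program} {m m' : Memory} {t : ℕ} :
      e.eval m = 0 → Exec q m m' t →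
      Exec (.branch e p q) m m' (e.cost m + (1 + (e.eval m).size) + t)
  | loop_true {e : Expr} {p : Program} {m₁ m₂ m₃ : Memory} {t₁ t₂ : ℕ} :
      e.eval m₁ ≠ 0 → Exec p m₁ m₂ t₁ → Exec (.loop e p) m₂ m₃ t₂ →
      Exec (.loop e p) m₁ m₃ (e.cost m₁ + (1 + (e.eval m₁).size) + t₁ + t₂)
  | loop_false {e : Expr} {p : Program} {m : Memory} :
      e.eval m = 0 → Exec (.loop e p) m m (e.cost m + (1 + (e.eval m).size))

/-- The machine is deterministic: result and cost are determined by program and input. -/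
theorem Exec.unique {p : Program} {m m₁ m₂ : Memory} {t₁ t₂ : ℕ}
    (h₁ : Exec p m m₁ t₁) (h₂ : Exec p m m₂ t₂) : m₁ = m₂ ∧ t₁ = t₂ := by
  induction h₁ generalizing m₂ t₂ with
  | skip m => cases h₂; exact ⟨rfl, rfl⟩
  | store m arr idx val => cases h₂; exact ⟨rfl, rfl⟩
  | seq _ _ ih₁ ih₂ =>
    cases h₂ with
    | seq a b =>
      obtain ⟨rfl, rfl⟩ := ih₁ a
      obtain ⟨rfl, rfl⟩ := ih₂ b
      exact ⟨rfl, rfl⟩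
  | branch_true he _ ih =>
    cases h₂ with
    | branch_true _ a => obtain ⟨rfl, rfl⟩ := ih a; exact ⟨rfl, rfl⟩
    | branch_false hf _ => exact absurd hf he
  | branch_false he _ ih =>
    cases h₂ with
    | branch_true hf _ => exact absurd he hf
    | branch_false _ a => obtain ⟨rfl, rfl⟩ := ih a; exact ⟨rfl, rfl⟩
  | loop_true he _ _ ih₁ ih₂ =>
    cases h₂ with
    | loop_true _ a b =>
      obtain ⟨rfl, rfl⟩ := ih₁ a
      obtain ⟨rfl, rfl⟩ := ih₂ b
      exact ⟨rfl, rfl⟩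
    | loop_false hf => exact absurd hf he
  | loop_false he =>
    cases h₂ with
    | loop_true hf _ _ => exact absurd he hf
    | loop_false _ => exact ⟨rfl, rfl⟩

/-! ### Input, output and running times -/

open Classical in
/-- The bit that stands for the truth value of `p`. -/
noncomputable def bit (p : Prop) : ℕ := if p then 1 else 0

/-- The input as a sequence of numbers: `k`, `n`, `c`, the `k × k` table of the order, the `k × n`
table of the authorization relation, and for each constraint the characteristic vectors of its two
sets of steps. (In `WSP(=)` the relation of every constraint is known to be `=`.) -/
noncomputable def Instance.encode (I : Instance) : List ℕ :=
  [I.k, I.n, I.c]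
    ++ (List.finRange I.k).flatMap
        (fun s => (List.finRange I.k).map fun t => bit (I.schema.order.le s t))
    ++ (List.finRange I.k).flatMap
        (fun s => (List.finRange I.n).map fun u => bit (I.schema.auth s u))
    ++ I.schema.constraints.flatMap
        (fun γ => (List.finRange I.k).map (fun s => bit (s ∈ γ.left))
          ++ (List.finRange I.k).map (fun s => bit (s ∈ γ.right)))

/-- The size of the input, in bits, counting one separator for each number. -/
noncomputable def Instance.inputSize (I : Instance) : ℕ :=
  (I.encode.map fun v => v.size + 1).sum

/-- Initially array `0` holds the input, and all other cells are `0`. -/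
noncomputable def Instance.initial (I : Instance) : Memory :=
  fun arr i => if arr = 0 then I.encode.getD i 0 else 0

/-- The output is in array `1`: either the number `1` followed by the values of a valid plan,
or the number `0`, if there is no valid plan. -/
def Instance.CorrectOutput (I : Instance) (m : Memory) : Prop :=
  (∃ π : Fin I.k → Fin I.n, I.schema.Valid π ∧ m 1 0 = 1 ∧
    ∀ s : Fin I.k, m 1 ((s : ℕ) + 1) = (π s : ℕ)) ∨
  ((¬ ∃ π : Fin I.k → Fin I.n, I.schema.Valid π) ∧ m 1 0 = 0)

/-- Some program solves all the instances `I` in the class `Q`, each at cost at most `T I`. -/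
def SolvableInTime (Q : Instance → Prop) (T : Instance → ℕ) : Prop :=
  ∃ p : Program, ∀ I : Instance, Q I →
    ∃ (m : Memory) (t : ℕ), Exec p I.initial m t ∧ I.CorrectOutput m ∧ t ≤ T I

/-- Solvable in time `Õ(T)`, that is, `O(T log^d T)` for some constant `d`. The shifts of `T` by a
constant matter only for `T = 0` and `T = 1`. -/
def SolvableInSoftO (Q : Instance → Prop) (T : Instance → ℕ) : Prop :=
  ∃ K d : ℕ, SolvableInTime Q fun I => K * (T I + 1) * (Nat.log 2 (T I + 2)) ^ d

/-- Fixed-parameter tractable in the number `k` of steps: solvable in time `f(k) N^d`, where `N` is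
the size of the input, `f` is a computable function and `d` is a constant. -/
def IsFPT (Q : Instance → Prop) : Prop :=
  ∃ f : ℕ → ℕ, Computable f ∧ ∃ d : ℕ, SolvableInTime Q fun I => f I.k * I.inputSize ^ d

end WSP

namespace WSP

/-! ### Total correctness with step counts -/

/-! Parts (1) and (2) rest on one counting algorithm. Let `σ` be a ground set of `K` elements, and
call a map from `σ` to the users admissible if all its fibers are eligible and authorized. Take the
sum over `X ⊆ σ` of `(-1)^|X|` times the product over the users `u` of the sums of `b^|V|` over the
`V ⊆ X` that are admissible for `u`. Expanding the products and summing over `X` first kills every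
family `(V_u)` that does not cover `σ`. A cover has total size at least `K`, with equality only for
partitions; so if `b^(K+1) = 0`, the sum is `± b^K` times the number of admissible maps
(`sum_neg_one_pow_mul_prod`). Modulo `B^(K+1)`, with `b = B = n^K + 1` larger than that number, the
sum is nonzero exactly if an admissible map exists.

All inner sums are read from a single table of subset sums, built in `K` rounds over `2^K` codes
(`subsetSums_spec`): for the user `u` it is read at `X` restricted to what `u` may perform. A
decision takes about `2^K n K` steps. Fixing the workflow steps one after the other needs at most `k
n` further decisions (`fixSteps_spec`), whence the factor `n^2`.

For (1), a constraint with a singleton side `{s}` says that the fiber containing `s` meets the other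
side. This is a condition on single fibers, so `K = k` works (`forall_blockEligible_iff`). For (2),
each constraint contributes an extra element, to be mapped to a user who performs a step on both
sides; a fiber containing it must meet both sides, and `K = k + c` (`solvable_wspEq`).

For (3), a constraint whose sides share a step always holds, and any other is determined by telling
for each step whether it lies left, right or nowhere. For (4), all `k^k` labelings of the steps by
blocks are tried. A labeling is good if every constraint has a left and a right step with equal
labels and every block has a common authorized user; blocks may share a user, because equality
constraints survive merging.

As for cost, cells of at most `L` bits make every elementary step cost at most a constant times `L +
1`, so `Runs` only counts steps. In (1) and (2) `L` is cubic in the logarithm `l` of the time bound,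
and the step count brings in `l^2` more. -/

/-- A constant `w` such that the value of the expression has at most `w * (L + 1)` bits
in a memory whose cells have at most `L` bits. -/
def Expr.sizeWeight : Expr → ℕ
  | lit v => v.size
  | load _ _ => 1
  | add a b => a.sizeWeight + b.sizeWeight + 1
  | sub a _ => a.sizeWeight
  | mul a b => a.sizeWeight + b.sizeWeight
  | div a _ => a.sizeWeight

/-- A constant `w` such that evaluating the expression costs at most `w * (L + 1)`
in a memory whose cells have at most `L` bits. -/
def Expr.weight : Expr → ℕ
  | lit v => 1 + v.size
  | load _ idx => idx.weight + (2 + idx.sizeWeight)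
  | add a b => a.weight + b.weight + (1 + a.sizeWeight + b.sizeWeight)
  | sub a b => a.weight + b.weight + (1 + a.sizeWeight + b.sizeWeight)
  | mul a b => a.weight + b.weight + (1 + a.sizeWeight + b.sizeWeight)
  | div a b => a.weight + b.weight + (1 + a.sizeWeight + b.sizeWeight)

/-- All cells are less than `2 ^ L`. -/
def Memory.Bounded (L : ℕ) (m : Memory) : Prop := ∀ a i, m a i < 2 ^ L

theorem size_add_le (a b : ℕ) : (a + b).size ≤ a.size + b.size + 1 := by
  rw [Nat.size_le]
  have ha := Nat.lt_size_self a
  have hb := Nat.lt_size_self b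
  have h1 : 2 ^ a.size ≤ 2 ^ (a.size + b.size) := Nat.pow_le_pow_right (by norm_num) (by omega)
  have h2 : 2 ^ b.size ≤ 2 ^ (a.size + b.size) := Nat.pow_le_pow_right (by norm_num) (by omega)
  rw [pow_succ]
  omega

theorem size_mul_le (a b : ℕ) : (a * b).size ≤ a.size + b.size := by
  rw [Nat.size_le, pow_add]
  exact Nat.mul_lt_mul'' (Nat.lt_size_self a) (Nat.lt_size_self b)

/-- Sums and products of values lengthen additively and a load returns a cell, whatever its address,
so the length is controlled by the syntax of the expression alone. -/
theorem Expr.size_eval_le {L : ℕ} {m : Memory} (hm : m.Bounded L) (e : Expr) :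
    (e.eval m).size ≤ e.sizeWeight * (L + 1) := by
  induction e with
  | lit v => simp only [eval, sizeWeight]; nlinarith [Nat.zero_le (v.size * L)]
  | load arr idx _ =>
    simp only [eval, sizeWeight]
    have := Nat.size_le.2 (hm arr (idx.eval m))
    omega
  | add a b iha ihb =>
    simp only [eval, sizeWeight]
    have := size_add_le (a.eval m) (b.eval m)
    nlinarith
  | sub a b iha ihb =>
    simp only [eval, sizeWeight]
    exact (Nat.size_le_size (Nat.sub_le _ _)).trans iha
  | mul a b iha ihb =>
    simp only [eval, sizeWeight]
    have := size_mul_le (a.eval m) (b.eval m)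
    nlinarith
  | div a b iha ihb =>
    simp only [eval, sizeWeight]
    exact (Nat.size_le_size (Nat.div_le_self _ _)).trans iha

theorem Expr.cost_le {L : ℕ} {m : Memory} (hm : m.Bounded L) (e : Expr) :
    e.cost m ≤ e.weight * (L + 1) := by
  induction e with
  | lit v => simp only [cost, weight]; nlinarith [Nat.zero_le (v.size * L)]
  | load arr idx ih =>
    simp only [cost, weight]
    have h1 := Nat.size_le.2 (hm arr (idx.eval m))
    have h2 := idx.size_eval_le hm
    nlinarith
  | add a b iha ihb | sub a b iha ihb | mul a b iha ihb | div a b iha ihb =>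
    simp only [cost, weight]
    have h1 := a.size_eval_le hm
    have h2 := b.size_eval_le hm
    nlinarith

/-- The arrays that a program may write to. -/
def Program.writes : Program → List ℕ
  | skip => []
  | store arr _ _ => [arr]
  | seq p q => p.writes ++ q.writes
  | branch _ p q => p.writes ++ q.writes
  | loop _ p => p.writes

/-- A constant `w` such that every elementary step of the program costs at most `w * (L + 1)`
as long as the cells have at most `L` bits. -/
def Program.weight : Program → ℕ
  | skip => 1
  | store _ idx val => idx.weight + val.weight + (1 + idx.sizeWeight + val.sizeWeight)
  | seq p q => p.weight + q.weight
  | branch e p q => e.weight + (1 + e.sizeWeight) + p.weight + q.weight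
  | loop e p => e.weight + (1 + e.sizeWeight) + p.weight

/-- This is what lets the specifications below mention only the arrays they change: everything
outside `writes` is carried over by a syntactic check. -/
theorem Exec.frame {p : Program} {m m' : Memory} {t : ℕ} (h : Exec p m m' t) :
    ∀ a, a ∉ p.writes → m' a = m a := by
  induction h with
  | skip m => intros; rfl
  | store m arr idx val =>
    intro a ha
    funext i
    simp only [Program.writes, List.mem_singleton] at ha
    simp [Memory.write, ha]
  | seq _ _ ih₁ ih₂ =>
    intro a ha
    simp only [Program.writes, List.mem_append, not_or] at ha
    rw [ih₂ a ha.2, ih₁ a ha.1]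
  | branch_true _ _ ih =>
    intro a ha
    simp only [Program.writes, List.mem_append, not_or] at ha
    exact ih a ha.1
  | branch_false _ _ ih =>
    intro a ha
    simp only [Program.writes, List.mem_append, not_or] at ha
    exact ih a ha.2
  | loop_true _ _ _ ih₁ ih₂ =>
    intro a ha
    rw [ih₂ a ha, ih₁ a ha]
  | loop_false _ => intros; rfl

/-- Memories that agree on all arrays outside a list. -/
def AgreeOff (w : List ℕ) (m m' : Memory) : Prop := ∀ a, a ∉ w → m' a = m a

/-- Started with cells below `2 ^ L`, the program halts after at most `τ` elementary steps, all
cells stay below `2 ^ L`, and the final memory satisfies `Q`. -/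
def Runs (L : ℕ) (p : Program) (m : Memory) (τ : ℕ) (Q : Memory → Prop) : Prop :=
  m.Bounded L → ∃ m' t, Exec p m m' t ∧ t ≤ p.weight * (L + 1) * τ ∧ m'.Bounded L ∧ Q m'

namespace Runs

variable {L τ τ₁ τ₂ : ℕ} {p q : Program} {m : Memory} {Q R : Memory → Prop}

theorem conseq (h : Runs L p m τ₁ R) (hτ : τ₁ ≤ τ)
    (hQ : ∀ m', AgreeOff p.writes m m' → m'.Bounded L → R m' → Q m') : Runs L p m τ Q := by
  intro hm
  obtain ⟨m', t, he, ht, hb, hr⟩ := h hm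
  exact ⟨m', t, he, ht.trans (Nat.mul_le_mul_left _ hτ), hb, hQ m' he.frame hb hr⟩

theorem mono (h : Runs L p m τ₁ Q) (hτ : τ₁ ≤ τ) : Runs L p m τ Q :=
  h.conseq hτ fun _ _ _ h => h

theorem skip (hQ : Q m) : Runs L .skip m 1 Q := fun hm =>
  ⟨m, 1, .skip m, by simp [Program.weight], hm, hQ⟩

theorem store {arr : ℕ} {idx val : Expr} (hv : val.eval m < 2 ^ L)
    (hQ : Q (m.write arr (idx.eval m) (val.eval m))) : Runs L (.store arr idx val) m 1 Q := by
  intro hm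
  refine ⟨_, _, .store m arr idx val, ?_, ?_, hQ⟩
  · have h1 := idx.cost_le hm
    have h2 := val.cost_le hm
    have h3 := idx.size_eval_le hm
    have h4 := val.size_eval_le hm
    simp only [Program.weight]
    nlinarith
  · intro a i
    simp only [Memory.write]
    split_ifs
    exacts [hv, hm a i]

/-- The price per step, `weight * (L + 1)`, of a composite program dominates the prices of its
parts, so step counts simply add. -/
theorem seq (hp : Runs L p m τ₁ R)
    (hq : ∀ m', AgreeOff p.writes m m' → m'.Bounded L → R m' → Runs L q m' τ₂ Q) :
    Runs L (.seq p q) m (τ₁ + τ₂) Q := by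
  intro hm
  obtain ⟨m', t, he, ht, hb, hr⟩ := hp hm
  obtain ⟨m'', t', he', ht', hb', hr'⟩ := hq m' he.frame hb hr hb
  refine ⟨m'', t + t', he.seq he', ?_, hb', hr'⟩
  simp only [Program.weight]
  calc t + t' ≤ p.weight * (L + 1) * τ₁ + q.weight * (L + 1) * τ₂ := add_le_add ht ht'
    _ ≤ (p.weight + q.weight) * (L + 1) * τ₁ + (p.weight + q.weight) * (L + 1) * τ₂ := by
      gcongr <;> omega
    _ = _ := by ring

theorem branch {e : Expr} (hp : e.eval m ≠ 0 → Runs L p m τ Q) (hq : e.eval m = 0 → Runs L q m τ Q) :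
    Runs L (.branch e p q) m (1 + τ) Q := by
  intro hm
  have hs : e.cost m + (1 + (e.eval m).size) ≤ (e.weight + (1 + e.sizeWeight)) * (L + 1) := by
    have h1 := e.cost_le hm
    have h2 := e.size_eval_le hm
    nlinarith
  by_cases h : e.eval m = 0
  · obtain ⟨m', t, he, ht, hb, hr⟩ := hq h hm
    refine ⟨m', _, .branch_false h he, ?_, hb, hr⟩
    simp only [Program.weight]
    calc _ ≤ (e.weight + (1 + e.sizeWeight)) * (L + 1) + q.weight * (L + 1) * τ := add_le_add hs ht
      _ ≤ (e.weight + (1 + e.sizeWeight) + p.weight + q.weight) * (L + 1) +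
          (e.weight + (1 + e.sizeWeight) + p.weight + q.weight) * (L + 1) * τ := by
        exact add_le_add (Nat.mul_le_mul_right _ (by omega))
          (Nat.mul_le_mul_right _ (Nat.mul_le_mul_right _ (by omega)))
      _ = _ := by ring
  · obtain ⟨m', t, he, ht, hb, hr⟩ := hp h hm
    refine ⟨m', _, .branch_true h he, ?_, hb, hr⟩
    simp only [Program.weight]
    calc _ ≤ (e.weight + (1 + e.sizeWeight)) * (L + 1) + p.weight * (L + 1) * τ := add_le_add hs ht
      _ ≤ (e.weight + (1 + e.sizeWeight) + p.weight + q.weight) * (L + 1) +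
          (e.weight + (1 + e.sizeWeight) + p.weight + q.weight) * (L + 1) * τ := by
        exact add_le_add (Nat.mul_le_mul_right _ (by omega))
          (Nat.mul_le_mul_right _ (Nat.mul_le_mul_right _ (by omega)))
      _ = _ := by ring

/-- A loop that runs for `N` more rounds. -/
theorem loop {e : Expr} (Inv : ℕ → Memory → Prop) (N : ℕ)
    (htest : ∀ j m', Inv j m' → (e.eval m' = 0 ↔ N ≤ j))
    (hstep : ∀ j m', j < N → m'.Bounded L → Inv j m' → Runs L p m' τ (Inv (j + 1)))
    (j : ℕ) (hj : j ≤ N) (hI : Inv j m) :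
    Runs L (.loop e p) m ((N - j) * (τ + 1) + 1) (Inv N) := by
  obtain ⟨d, rfl⟩ := Nat.exists_eq_add_of_le hj
  rw [Nat.add_sub_cancel_left]
  clear hj
  induction d generalizing j m with
  | zero =>
    intro hm
    refine ⟨m, _, .loop_false ((htest j m hI).2 le_rfl), ?_, hm, hI⟩
    have h1 := e.cost_le hm
    have h2 := e.size_eval_le hm
    simp only [Program.weight]
    nlinarith [Nat.zero_le (p.weight * (L + 1))]
  | succ d ih =>
    intro hm
    have hne : e.eval m ≠ 0 := fun h => by have := (htest j m hI).1 h; omega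
    obtain ⟨m', t, he, ht, hb, hr⟩ := hstep j m (by omega) hm hI hm
    have e1 : j + 1 + d = j + (d + 1) := by ring
    obtain ⟨m'', t', he', ht', hb', hr'⟩ := ih (m := m') (j + 1) hr (by simpa only [e1] using htest)
      (by simpa only [e1] using hstep) hb
    refine ⟨m'', _, .loop_true hne he he', ?_, hb', by simpa only [e1] using hr'⟩
    have h1 := e.cost_le hm
    have h2 := e.size_eval_le hm
    simp only [Program.weight] at ht' ⊢
    set w := e.weight + (1 + e.sizeWeight) + p.weight with hw
    have hs : e.cost m + (1 + (e.eval m).size) ≤ (e.weight + (1 + e.sizeWeight)) * (L + 1) := by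
      nlinarith
    have h3 : (e.weight + (1 + e.sizeWeight)) * (L + 1) ≤ w * (L + 1) :=
      Nat.mul_le_mul_right _ (by omega)
    have h4 : p.weight * (L + 1) * τ ≤ w * (L + 1) * τ := by gcongr; omega
    calc _ ≤ w * (L + 1) + w * (L + 1) * τ + w * (L + 1) * (d * (τ + 1) + 1) := by omega
      _ = _ := by ring

end Runs

/-- The scalar held at index `0` of an array. -/
def Expr.var (a : ℕ) : Expr := .load a (.lit 0)

/-- `for i = 0, …, e - 1 do p`. -/
def Program.forLoop (i : ℕ) (e : Expr) (p : Program) : Program :=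
  .seq (.store i (.lit 0) (.lit 0))
    (.loop (.sub e (.var i)) (.seq p (.store i (.lit 0) (.add (.var i) (.lit 1)))))

/-- The bound `e` is evaluated anew in every round, hence `hN` asks that it be unaffected by the
loop. The counter is incremented after the body, so the body has to establish the invariant for the
memory in which the counter is already updated. Each round has two extra steps (test and increment),
and there are two more for the initialization and the last test. -/
theorem Runs.forLoop {L τ i N : ℕ} {e : Expr} {p : Program} {m : Memory} {Q : Memory → Prop}
    (Inv : ℕ → Memory → Prop) (hi : i ∉ p.writes)
    (hN : ∀ m', AgreeOff (p.writes ++ [i]) m m' → e.eval m' = N) (hNL : N < 2 ^ L)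
    (h0 : Inv 0 (m.write i 0 0))
    (hstep : ∀ j m', j < N → AgreeOff (p.writes ++ [i]) m m' → m'.Bounded L → m' i 0 = j →
      Inv j m' → Runs L p m' τ fun m'' => Inv (j + 1) (m''.write i 0 (j + 1)))
    (hQ : ∀ m', AgreeOff (p.writes ++ [i]) m m' → m'.Bounded L → Inv N m' → Q m') :
    Runs L (.forLoop i e p) m (N * (τ + 2) + 2) Q := by
  have key : Runs L (.forLoop i e p) m (1 + ((N - 0) * (τ + 1 + 1) + 1)) Q := by
    refine Runs.seq (R := fun m' => m' = m.write i 0 0) (Runs.store (by simp [Expr.eval]) rfl) ?_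
    rintro _ - - rfl
    refine (Runs.loop (p := .seq p (.store i (.lit 0) (.add (.var i) (.lit 1))))
      (fun j m' => AgreeOff (p.writes ++ [i]) m m' ∧ m' i 0 = j ∧ Inv j m') N ?_ ?_ 0 (Nat.zero_le _)
      ?_).conseq le_rfl fun m' _ hb h => hQ m' h.1 hb h.2.2
    · rintro j m' ⟨h1, h2, -⟩
      simp only [Expr.eval, Expr.var, hN m' h1, h2]
      omega
    · rintro j m' hj hb ⟨h1, h2, h3⟩
      refine Runs.seq (hstep j m' hj h1 hb h2 h3) fun m'' hf hb' hI => ?_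
      have e1 : m'' i 0 = j := by rw [hf i hi, h2]
      have e2 : (Expr.add (.var i) (.lit 1)).eval m'' = j + 1 := by
        simp [Expr.eval, Expr.var, e1]
      refine Runs.store (by rw [e2]; omega) ?_
      rw [e2]
      refine ⟨fun a ha => ?_, by simp [Memory.write, Expr.eval], hI⟩
      have ha' : a ∉ p.writes ∧ a ≠ i := by simpa using ha
      rw [← h1 a ha, ← hf a ha'.1]
      funext x
      simp [Memory.write, ha'.2]
    · refine ⟨fun a ha => ?_, by simp [Memory.write], h0⟩
      have ha' : a ∉ p.writes ∧ a ≠ i := by simpa using ha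
      funext x
      simp [Memory.write, ha'.2]
  exact key.mono (by simp only [Nat.sub_zero]; ring_nf; omega)

/-! ### Counting exact partitions by inclusion–exclusion -/

-- Passing to complements turns this into the alternating sum over all subsets of `Tᶜ`, which
-- vanishes unless `Tᶜ` is empty.
open Finset in
theorem sum_superset_neg_one_pow_card {σ R : Type*} [Fintype σ] [DecidableEq σ] [CommRing R]
    (T : Finset σ) :
    ∑ X : Finset σ with T ⊆ X, (-1 : R) ^ X.card
      = if T = univ then (-1) ^ Fintype.card σ else 0 := by
  have h1 : ∑ X : Finset σ with T ⊆ X, (-1 : R) ^ X.card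
      = (-1) ^ Fintype.card σ * ∑ Y ∈ (Tᶜ).powerset, (-1 : R) ^ Y.card := by
    rw [mul_sum]
    refine sum_bij' (fun X _ => Xᶜ) (fun Y _ => Yᶜ) ?_ ?_ ?_ ?_ ?_
    · intro X hX
      simpa using hX
    · intro Y hY
      simp only [mem_powerset] at hY
      simpa using subset_compl_comm.1 hY
    · simp
    · simp
    · intro X _
      have : (-1 : R) ^ Fintype.card σ = (-1) ^ X.card * (-1) ^ (Xᶜ).card := by
        rw [← pow_add, card_add_card_compl]
      rw [this, mul_assoc, ← mul_pow]
      simp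
  have h2 := congrArg (Int.cast : ℤ → R) (sum_powerset_neg_one_pow_card (x := Tᶜ))
  push_cast at h2
  rw [h1, h2]
  simp [compl_eq_empty_iff]

-- Choosing for each `s` some `V i` that contains it gives a map with fibers inside the `V i`. The
-- fibers have total size `|σ|`, so there is no room for a proper inclusion.
open Finset in
theorem exists_fiber_eq_of_cover {σ ι : Type*} [Fintype σ] [DecidableEq σ] [Fintype ι]
    [DecidableEq ι] (V : ι → Finset σ) (hV : ∀ s, ∃ i, s ∈ V i)
    (hc : ∑ i, (V i).card ≤ Fintype.card σ) :
    ∃ π : σ → ι, ∀ i, univ.filter (fun s => π s = i) = V i := by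
  choose π hπ using hV
  have hsub : ∀ i, univ.filter (fun s => π s = i) ⊆ V i := by
    intro i s hs
    simp only [mem_filter, mem_univ, true_and] at hs
    exact hs ▸ hπ s
  have hsum : ∑ i, (univ.filter (fun s => π s = i)).card = Fintype.card σ := by
    rw [← card_eq_sum_card_fiberwise (fun _ _ => mem_univ _), card_univ]
  have heq : ∑ i, (univ.filter (fun s => π s = i)).card = ∑ i, (V i).card :=
    le_antisymm (sum_le_sum fun i _ => card_le_card (hsub i)) (hsum ▸ hc)
  have := (sum_eq_sum_iff_of_le fun i _ => card_le_card (hsub i)).1 heq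
  exact ⟨π, fun i => eq_of_subset_of_card_le (hsub i) (this i (mem_univ i)).ge⟩

open Finset in
open Classical in
/-- The alternating sum counts the maps all of whose fibers are admissible. -/
theorem sum_neg_one_pow_mul_prod {σ ι R : Type*} [Fintype σ] [Fintype ι] [CommRing R]
    (F : ι → Finset σ → Prop) (b : R) (hb : b ^ (Fintype.card σ + 1) = 0) :
    ∑ X : Finset σ, (-1) ^ X.card * ∏ i, ∑ V ∈ X.powerset with F i V, b ^ V.card
      = (-1) ^ Fintype.card σ * b ^ Fintype.card σ *
        (univ.filter fun π : σ → ι => ∀ i, F i (univ.filter fun s => π s = i)).card := by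
  -- The product of sums becomes a sum over families `V`, and the condition that all members lie in
  -- `X` becomes one on their union.
  have step1 : ∀ X : Finset σ, (-1 : R) ^ X.card * ∏ i, ∑ V ∈ X.powerset with F i V, b ^ V.card
      = ∑ V : ι → Finset σ with ∀ i, F i (V i),
        if univ.biUnion V ⊆ X then (-1) ^ X.card * b ^ ∑ i, (V i).card else 0 := by
    intro X
    rw [prod_univ_sum, mul_sum, ← sum_filter, filter_filter]
    refine sum_congr ?_ fun V _ => by rw [prod_pow_eq_pow_sum]
    ext V
    simp only [Fintype.mem_piFinset, mem_filter, mem_powerset, mem_univ, true_and,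
      biUnion_subset, forall_true_left]
    exact ⟨fun h => ⟨fun i => (h i).2, fun i => (h i).1⟩, fun h i => ⟨h.2 i, h.1 i⟩⟩
  rw [sum_congr rfl fun X _ => step1 X, sum_comm]
  have step2 : ∀ V : ι → Finset σ,
      (∑ X : Finset σ, if univ.biUnion V ⊆ X then (-1 : R) ^ X.card * b ^ ∑ i, (V i).card else 0)
        = if ∃ π : σ → ι, ∀ i, univ.filter (fun s => π s = i) = V i then
          (-1) ^ Fintype.card σ * b ^ Fintype.card σ else 0 := by
    intro V
    rw [← sum_filter, ← sum_mul, sum_superset_neg_one_pow_card]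
    split_ifs with h1 h2 h2
    · obtain ⟨π, hπ⟩ := h2
      have : ∑ i, (V i).card = Fintype.card σ := by
        simp_rw [← hπ]
        rw [← card_univ (α := σ), card_eq_sum_card_fiberwise (f := π) (t := univ)
          (fun _ _ => mem_univ _)]
      rw [this]
    · have hcov : ∀ s, ∃ i, s ∈ V i := fun s => by
        have : s ∈ univ.biUnion V := h1 ▸ mem_univ s
        simpa using this
      -- A cover that is not a partition has larger total size, and its power of `b` vanishes by
      -- `hb`.
      have : Fintype.card σ + 1 ≤ ∑ i, (V i).card := by
        by_contra hlt
        exact h2 (exists_fiber_eq_of_cover V hcov (by omega))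
      rw [pow_eq_zero_of_le this hb, mul_zero]
    · obtain ⟨π, hπ⟩ := h2
      refine absurd (eq_univ_of_forall fun s => ?_) h1
      rw [mem_biUnion]
      exact ⟨π s, mem_univ _, by simp [← hπ]⟩
    · rw [zero_mul]
  rw [sum_congr rfl fun V _ => step2 V, ← sum_filter, sum_const, nsmul_eq_mul, mul_comm]
  congr 2
  symm
  -- A map is the same thing as its family of fibers.
  refine card_bij (fun π _ i => univ.filter fun s => π s = i) ?_ ?_ ?_
  · intro π hπ
    simp only [mem_filter, mem_univ, true_and] at hπ ⊢
    exact ⟨hπ, π, fun i => rfl⟩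
  · intro π _ π' _ h
    funext s
    have := congrFun h (π s)
    have hs : s ∈ univ.filter fun t => π' t = π s := this ▸ by simp
    exact (mem_filter.1 hs).2.symm
  · intro V hV
    simp only [mem_filter, mem_univ, true_and] at hV
    obtain ⟨h1, π, hπ⟩ := hV
    refine ⟨π, ?_, funext hπ⟩
    simp only [mem_filter, mem_univ, true_and]
    exact fun i => (hπ i).symm ▸ h1 i

open Finset in
open Classical in
/-- Modulo a power of a number that exceeds the number of all maps, the alternating sum
vanishes only if there is no map all of whose fibers are admissible. -/
theorem sum_neg_one_pow_mul_prod_ne_zero_iff {σ ι : Type*} [Fintype σ] [Fintype ι]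
    (F : ι → Finset σ → Prop) (B : ℕ) (hB : B = Fintype.card ι ^ Fintype.card σ + 1) :
    (∑ X : Finset σ, (-1) ^ X.card * ∏ i, ∑ V ∈ X.powerset with F i V,
        (B : ZMod (B ^ (Fintype.card σ + 1))) ^ V.card) ≠ 0
      ↔ ∃ π : σ → ι, ∀ i, F i (univ.filter fun s => π s = i) := by
  rw [sum_neg_one_pow_mul_prod F (B : ZMod (B ^ (Fintype.card σ + 1)))
    (by rw [← Nat.cast_pow, ZMod.natCast_self])]
  set P := univ.filter fun π : σ → ι => ∀ i, F i (univ.filter fun s => π s = i) with hP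
  have hlt : P.card < B := by
    calc P.card ≤ Fintype.card (σ → ι) := card_le_univ _
      _ < B := by rw [Fintype.card_fun, hB]; omega
  have hu : IsUnit ((-1 : ZMod (B ^ (Fintype.card σ + 1))) ^ Fintype.card σ) :=
    (isUnit_one.neg).pow _
  -- The sign is a unit. After cancelling `B ^ K`, the sum vanishes modulo `B ^ (K + 1)` iff `B`
  -- divides the number of maps, which is less than `B`.
  rw [mul_assoc, Ne, hu.mul_right_eq_zero, ← Nat.cast_pow, ← Nat.cast_mul,
    ZMod.natCast_eq_zero_iff, pow_succ, Nat.mul_dvd_mul_iff_left (by subst hB; positivity)]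
  constructor
  · intro h
    have hne : P.card ≠ 0 := fun h0 => h (h0 ▸ dvd_zero _)
    obtain ⟨π, hπ⟩ := card_ne_zero.1 hne
    exact ⟨π, by simpa [hP] using hπ⟩
  · rintro ⟨π, hπ⟩ h
    have hpos : 0 < P.card := card_pos.2 ⟨π, by simpa [hP] using hπ⟩
    exact absurd (Nat.le_of_dvd hpos h) (by omega)

/-! ### Sets of natural numbers coded as bit masks -/

/-- The subset of `Fin K` coded by the binary digits of a number. -/
def maskSet (K x : ℕ) : Finset (Fin K) := Finset.univ.filter fun s => x.testBit s

theorem mem_maskSet {K x : ℕ} {s : Fin K} : s ∈ maskSet K x ↔ x.testBit s = true := by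
  simp [maskSet]

theorem maskSet_injOn (K : ℕ) : Set.InjOn (maskSet K) {x | x < 2 ^ K} := by
  intro x hx y hy h
  refine Nat.eq_of_testBit_eq fun i => ?_
  by_cases hi : i < K
  · have : (⟨i, hi⟩ : Fin K) ∈ maskSet K x ↔ (⟨i, hi⟩ : Fin K) ∈ maskSet K y := by rw [h]
    simp only [mem_maskSet] at this
    exact Bool.eq_iff_iff.2 this
  · have h1 : 2 ^ K ≤ 2 ^ i := Nat.pow_le_pow_right (by norm_num) (by omega)
    rw [Nat.testBit_lt_two_pow (lt_of_lt_of_le hx h1), Nat.testBit_lt_two_pow (lt_of_lt_of_le hy h1)]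

theorem exists_maskSet_eq {K : ℕ} (V : Finset (Fin K)) : ∃ x < 2 ^ K, maskSet K x = V := by
  refine ⟨Nat.ofBits fun s : Fin K => decide (s ∈ V), Nat.ofBits_lt_two_pow _, ?_⟩
  ext s
  simp [mem_maskSet]

theorem sum_range_maskSet {K : ℕ} {R : Type*} [AddCommMonoid R] (f : Finset (Fin K) → R) :
    ∑ x ∈ Finset.range (2 ^ K), f (maskSet K x) = ∑ V, f V := by
  refine Finset.sum_bij (fun x _ => maskSet K x) (by simp) ?_ ?_ (fun _ _ => rfl)
  · intro x hx y hy h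
    exact maskSet_injOn K (by simpa using hx) (by simpa using hy) h
  · intro V _
    obtain ⟨x, hx, rfl⟩ := exists_maskSet_eq V
    exact ⟨x, by simpa using hx, rfl⟩

open Classical in
/-- The number whose binary digits below `j` are given by the predicate `p`. -/
noncomputable def maskOf (p : ℕ → Prop) (j : ℕ) : ℕ := ∑ s ∈ Finset.range j, if p s then 2 ^ s else 0

open Classical in
theorem maskOf_succ (p : ℕ → Prop) (j : ℕ) :
    maskOf p (j + 1) = maskOf p j + if p j then 2 ^ j else 0 := by
  simp [maskOf, Finset.sum_range_succ]

theorem maskOf_lt (p : ℕ → Prop) (j : ℕ) : maskOf p j < 2 ^ j := by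
  induction j with
  | zero => simp [maskOf]
  | succ j ih =>
    rw [maskOf_succ, pow_succ]
    split_ifs <;> omega

theorem testBit_maskOf (p : ℕ → Prop) (j s : ℕ) : (maskOf p j).testBit s = true ↔ s < j ∧ p s := by
  induction j with
  | zero => simp [maskOf]
  | succ j ih =>
    rw [maskOf_succ]
    split_ifs with hp
    · rw [add_comm]
      rcases lt_trichotomy s j with h | rfl | h
      · rw [Nat.testBit_two_pow_add_gt h, ih]
        simp [h, Nat.lt_succ_of_lt h]
      · rw [Nat.testBit_two_pow_add_eq, Nat.testBit_lt_two_pow (maskOf_lt p s)]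
        simp [hp]
      · rw [Nat.testBit_lt_two_pow]
        · simp; omega
        · have h1 : 2 ^ (j + 1) ≤ 2 ^ s := Nat.pow_le_pow_right (by norm_num) h
          have := maskOf_lt p j
          rw [pow_succ] at h1
          omega
    · rw [add_zero, ih]
      constructor
      · exact fun h => ⟨by omega, h.2⟩
      · rintro ⟨h1, h2⟩
        refine ⟨?_, h2⟩
        rcases Nat.lt_succ_iff_lt_or_eq.1 h1 with h | rfl
        · exact h
        · exact absurd h2 hp

theorem eq_maskOf {K x : ℕ} (hx : x < 2 ^ K) : x = maskOf (fun s => x.testBit s = true) K := by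
  refine Nat.eq_of_testBit_eq fun i => ?_
  rw [Bool.eq_iff_iff, testBit_maskOf]
  refine ⟨fun h => ⟨?_, h⟩, And.right⟩
  by_contra hi
  rw [Nat.testBit_lt_two_pow (hx.trans_le (Nat.pow_le_pow_right (by norm_num) (by omega)))] at h
  exact absurd h (by simp)

theorem lt_of_testBit {K x i : ℕ} (hx : x < 2 ^ K) (hi : x.testBit i = true) : i < K := by
  by_contra h
  rw [Nat.testBit_lt_two_pow (hx.trans_le (Nat.pow_le_pow_right (by norm_num) (by omega)))] at hi
  exact absurd hi (by simp)

/-- The digit `i` contributes `2 ^ i` to the code, so the truncated subtraction loses nothing and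
clears just this digit. -/
theorem maskOf_erase {p q : ℕ → Prop} {i K : ℕ} (hiK : i < K) (hi : p i)
    (hpq : ∀ s, q s ↔ p s ∧ s ≠ i) : maskOf p K - 2 ^ i = maskOf q K := by
  classical
  have h1 : ∀ s ∈ (Finset.range K).erase i, q s ↔ p s := by
    intro s hs
    simp [(Finset.mem_erase.1 hs).1, hpq]
  have hm : i ∈ Finset.range K := Finset.mem_range.2 hiK
  have h2 : ¬ q i := by simp [hpq]
  simp only [maskOf]
  rw [← Finset.add_sum_erase _ _ hm, ← Finset.add_sum_erase _ _ hm,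
    Finset.sum_congr rfl fun s hs => if_congr (h1 s hs) rfl rfl]
  simp [hi, h2]

theorem sub_two_pow_eq_maskOf {K x i : ℕ} (hx : x < 2 ^ K) (hi : x.testBit i = true) :
    x - 2 ^ i = maskOf (fun s => x.testBit s = true ∧ s ≠ i) K := by
  conv_lhs => rw [eq_maskOf hx]
  exact maskOf_erase (lt_of_testBit hx hi) hi fun _ => Iff.rfl

/-! ### Sums over all subsets, one element at a time -/

/-- The sums of `f` over the codes that differ from `x` only by missing digits below `i`. -/
def subsetSum {R : Type*} [AddCommMonoid R] (f : ℕ → R) : ℕ → ℕ → R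
  | 0, x => f x
  | i + 1, x => subsetSum f i x + if x.testBit i = true then subsetSum f i (x - 2 ^ i) else 0

/-- The codes that differ from `x` only by missing digits below `i`. -/
def IsLowPart (i x V : ℕ) : Prop := ∀ s,
  (V.testBit s = true → x.testBit s = true) ∧ (i ≤ s → x.testBit s = true → V.testBit s = true)

-- The codes counted at level `i + 1` split according to the digit `i`: those that keep it are
-- counted at level `i` for `x`, those that drop it at level `i` for `x - 2 ^ i`.
open Classical in
theorem subsetSum_eq_filter {R : Type*} [AddCommMonoid R] (f : ℕ → R) (K i x : ℕ) (hx : x < 2 ^ K) :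
    subsetSum f i x = ∑ V ∈ Finset.range (2 ^ K) with IsLowPart i x V, f V := by
  induction i generalizing x with
  | zero =>
    have : (Finset.range (2 ^ K)).filter (IsLowPart 0 x) = {x} := by
      ext V
      simp only [Finset.mem_filter, Finset.mem_range, Finset.mem_singleton, zero_le,
        forall_true_left, IsLowPart]
      constructor
      · rintro ⟨-, h⟩
        exact Nat.eq_of_testBit_eq fun s => Bool.eq_iff_iff.2 ⟨(h s).1, (h s).2⟩
      · rintro rfl
        exact ⟨hx, fun s => ⟨id, id⟩⟩
    rw [this, Finset.sum_singleton, subsetSum]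
  | succ i ih =>
    rw [subsetSum, ih x hx, ← Finset.sum_filter_add_sum_filter_not
      ((Finset.range (2 ^ K)).filter (IsLowPart (i + 1) x))
      (fun V => x.testBit i = true → V.testBit i = true)]
    congr 1
    · refine Finset.sum_congr ?_ fun _ _ => rfl
      ext V
      simp only [Finset.mem_filter, and_assoc]
      refine and_congr_right fun _ => ?_
      unfold IsLowPart
      refine ⟨fun h => ⟨fun s => ⟨(h s).1, fun hs => (h s).2 (by omega)⟩,
        (h i).2 le_rfl⟩, fun h s => ⟨(h.1 s).1, fun hs => ?_⟩⟩
      rcases hs.eq_or_lt with rfl | hs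
      · exact h.2
      · exact (h.1 s).2 hs
    · split_ifs with hb
      · rw [ih (x - 2 ^ i) (lt_of_le_of_lt (Nat.sub_le _ _) hx)]
        refine Finset.sum_congr ?_ fun _ _ => rfl
        ext V
        simp only [Finset.mem_filter, and_assoc]
        refine and_congr_right fun _ => ?_
        unfold IsLowPart
        have key : ∀ s, (x - 2 ^ i).testBit s = true ↔ x.testBit s = true ∧ s ≠ i := by
          intro s
          rw [sub_two_pow_eq_maskOf hx hb, testBit_maskOf]
          exact ⟨And.right, fun h => ⟨lt_of_testBit hx h.1, h⟩⟩
        simp only [key, hb, forall_true_left]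
        constructor
        · intro h
          refine ⟨fun s => ⟨fun hs => ((h s).1 hs).1, fun h1 h2 => (h s).2 (by omega) ⟨h2, by omega⟩⟩,
            fun hi => ((h i).1 hi).2 rfl⟩
        · rintro ⟨h1, h2⟩ s
          refine ⟨fun hs => ⟨(h1 s).1 hs, fun e => h2 (e ▸ hs)⟩, fun h3 h4 => (h1 s).2 (by omega) h4.1⟩
      · symm
        refine Finset.sum_eq_zero fun V hV => ?_
        simp only [Finset.mem_filter] at hV
        exact absurd (fun h => absurd h hb) hV.2

/-- After `K` rounds any of the digits of `x` may be missing, so the sum runs over all subsets. -/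
theorem subsetSum_eq {R : Type*} [AddCommMonoid R] {K x : ℕ} (hx : x < 2 ^ K)
    (f : ℕ → R) (g : Finset (Fin K) → R) (hfg : ∀ y < 2 ^ K, f y = g (maskSet K y)) :
    subsetSum f K x = ∑ V ∈ (maskSet K x).powerset, g V := by
  classical
  have h : (maskSet K x).powerset = Finset.univ.filter fun V => V ⊆ maskSet K x := by ext; simp
  rw [subsetSum_eq_filter f K K x hx, h, Finset.sum_filter, Finset.sum_filter,
    ← sum_range_maskSet (fun V => if V ⊆ maskSet K x then g V else 0)]
  refine Finset.sum_congr rfl fun y hy => ?_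
  have hy' : y < 2 ^ K := Finset.mem_range.1 hy
  rw [hfg y hy']
  refine if_congr ⟨fun h s hs => mem_maskSet.2 ((h s).1 (mem_maskSet.1 hs)), fun h s => ⟨fun hs => ?_,
    fun h1 h2 => absurd (lt_of_testBit hx h2) (by omega)⟩⟩ rfl rfl
  exact mem_maskSet.1 (h (mem_maskSet.2 hs : (⟨s, lt_of_testBit hy' hs⟩ : Fin K) ∈ maskSet K y))

theorem card_maskSet (K x : ℕ) :
    (maskSet K x).card = ∑ s ∈ Finset.range K, x / 2 ^ s % 2 := by
  rw [Finset.sum_range, maskSet, Finset.card_filter]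
  refine Finset.sum_congr rfl fun s _ => ?_
  rw [Nat.testBit_eq_decide_div_mod_eq]
  have := Nat.mod_lt (x / 2 ^ (s : ℕ)) (show 0 < 2 by norm_num)
  split_ifs with h <;> simp at h <;> omega

/-- The alternating sum over codes, as it is computed, decides whether there is a map all of
whose fibers are eligible and authorized. -/
theorem signed_sum_ne_zero_iff {K n : ℕ} (E : Finset (Fin K) → Prop) (A : ℕ → ℕ → Prop)
    (B : ℕ) (hB : B = n ^ K + 1) (f : ℕ → ZMod (B ^ (K + 1)))
    (hf : ∀ x < 2 ^ K, (E (maskSet K x) → f x = (B : ZMod (B ^ (K + 1))) ^ (maskSet K x).card) ∧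
      (¬ E (maskSet K x) → f x = 0)) :
    (∑ x ∈ Finset.range (2 ^ K), (-1) ^ (maskSet K x).card *
        ∏ v ∈ Finset.range n, subsetSum f K (maskOf (fun s => x.testBit s = true ∧ A s v) K)) ≠ 0
      ↔ ∃ π : Fin K → Fin n, (∀ s : Fin K, A s (π s)) ∧
        ∀ u, E (Finset.univ.filter fun s => π s = u) := by
  classical
  have h1 := sum_neg_one_pow_mul_prod_ne_zero_iff
    (fun (u : Fin n) (V : Finset (Fin K)) => (∀ s : Fin K, s ∈ V → A s u) ∧ E V) B (by simpa using hB)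
  rw [Fintype.card_fin] at h1
  rw [← sum_range_maskSet] at h1
  have h2 : ∀ x ∈ Finset.range (2 ^ K), (-1 : ZMod (B ^ (K + 1))) ^ (maskSet K x).card *
        ∏ v ∈ Finset.range n, subsetSum f K (maskOf (fun s => x.testBit s = true ∧ A s v) K)
      = (-1) ^ (maskSet K x).card * ∏ i : Fin n,
        ∑ V ∈ (maskSet K x).powerset with (∀ s : Fin K, s ∈ V → A s i) ∧ E V,
          (B : ZMod (B ^ (K + 1))) ^ V.card := by
    intro x _
    rw [Finset.prod_range]
    congr 1
    refine Finset.prod_congr rfl fun u _ => ?_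
    -- The subsets of `x` that a user may perform are the subsets of the allowed part of `x`. So
    -- authorization enters only through the place where the table is read, and one table serves all
    -- users.
    rw [subsetSum_eq (maskOf_lt _ _) f
      (fun V => if E V then (B : ZMod (B ^ (K + 1))) ^ V.card else 0), ← Finset.sum_filter]
    · refine Finset.sum_congr ?_ fun _ _ => rfl
      ext V
      simp only [Finset.mem_filter, Finset.mem_powerset, Finset.subset_iff, mem_maskSet,
        testBit_maskOf]
      constructor
      · rintro ⟨h, hE⟩
        exact ⟨fun s hs => (h hs).2.1, fun s hs => (h hs).2.2, hE⟩
      · rintro ⟨h, h', hE⟩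
        exact ⟨fun s hs => ⟨s.2, h hs, h' s hs⟩, hE⟩
    · intro y hy
      split_ifs with hE
      · exact (hf y hy).1 hE
      · exact (hf y hy).2 hE
  rw [Finset.sum_congr rfl h2]
  refine Iff.trans (by convert h1) ?_
  constructor
  · rintro ⟨π, hπ⟩
    exact ⟨π, fun s => (hπ (π s)).1 s (by simp), fun u => by convert (hπ u).2⟩
  · rintro ⟨π, hA, hE⟩
    refine ⟨π, fun u => ⟨fun s hs => ?_, by convert hE u⟩⟩
    simp only [Finset.mem_filter] at hs
    exact hs.2 ▸ hA s

/-! ### Symbolic execution -/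

infixr:60 " ;; " => Program.seq

attribute [simp] Expr.eval Program.writes

@[simp] theorem Expr.eval_var (m : Memory) (a : ℕ) : (Expr.var a).eval m = m a 0 := rfl

@[simp] theorem Program.writes_forLoop (i : ℕ) (e : Expr) (p : Program) :
    (Program.forLoop i e p).writes = i :: (p.writes ++ [i]) := rfl

@[simp] theorem Memory.write_same (m : Memory) (a i v : ℕ) :
    m.write a i v a = Function.update (m a) i v := by
  funext j
  simp [write, Function.update_apply]

@[simp] theorem Memory.write_of_ne (m : Memory) {a b : ℕ} (i v : ℕ) (h : b ≠ a) :
    m.write a i v b = m b := by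
  funext j
  simp [write, h]

/-- A store determines the next memory exactly, so the continuation can be verified for an explicit
term. -/
theorem Runs.store_seq {L τ arr : ℕ} {idx val : Expr} {q : Program} {m : Memory}
    {Q : Memory → Prop} (hv : val.eval m < 2 ^ L)
    (hq : Runs L q (m.write arr (idx.eval m) (val.eval m)) τ Q) :
    Runs L (.store arr idx val ;; q) m (1 + τ) Q :=
  Runs.seq (Runs.store (Q := fun m' => m' = m.write arr (idx.eval m) (val.eval m)) hv rfl)
    fun m' _ _ h => by subst h; exact hq

theorem AgreeOff.trans {w w₁ w₂ : List ℕ} {m m₁ m₂ : Memory} (h₁ : AgreeOff w₁ m m₁)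
    (h₂ : AgreeOff w₂ m₁ m₂) (hw₁ : w₁ ⊆ w) (hw₂ : w₂ ⊆ w) : AgreeOff w m m₂ := fun a ha => by
  rw [h₂ a fun h => ha (hw₂ h), h₁ a fun h => ha (hw₁ h)]

/-- `a % b`. -/
def Expr.mod (a b : Expr) : Expr := .sub a (.mul b (.div a b))

@[simp] theorem Expr.eval_mod (m : Memory) (a b : Expr) :
    (Expr.mod a b).eval m = a.eval m % b.eval m := by
  simp [Expr.mod, Nat.mod_eq_sub]

/-- `1` if `a = b`, and `0` otherwise. -/
def Expr.eq (a b : Expr) : Expr := .sub (.lit 1) (.add (.sub a b) (.sub b a))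

@[simp] theorem Expr.eval_eq (m : Memory) (a b : Expr) :
    (Expr.eq a b).eval m = if a.eval m = b.eval m then 1 else 0 := by
  simp only [Expr.eq, Expr.eval]
  split_ifs <;> omega

/-- The table of the powers of `base` with exponents up to `exp`. -/
def Program.powers (i arr : ℕ) (base exp : Expr) : Program :=
  .store arr (.lit 0) (.lit 1) ;;
    .forLoop i exp (.store arr (.add (.var i) (.lit 1)) (.mul base (.load arr (.var i))))

theorem powers_spec {L i arr b N : ℕ} {base exp : Expr} {m : Memory} (hi : i ≠ arr)
    (hb : ∀ m', AgreeOff [i, arr] m m' → base.eval m' = b)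
    (hN : ∀ m', AgreeOff [i, arr] m m' → exp.eval m' = N)
    (hpow : ∀ j ≤ N, b ^ j < 2 ^ L) (hNL : N < 2 ^ L) :
    Runs L (.powers i arr base exp) m (N * 3 + 3) fun m' => ∀ j ≤ N, m' arr j = b ^ j := by
  refine (Runs.store_seq (by simpa using hpow 0 (Nat.zero_le _))
    (Runs.forLoop (τ := 1) (N := N) (fun j m' => ∀ x ≤ j, m' arr x = b ^ x)
      (by simpa using hi) ?_ hNL ?_ ?_ fun m' _ _ h => h)).mono (by ring_nf; omega)
  · intro m' hf
    refine hN m' (AgreeOff.trans (w₁ := [arr]) (fun a ha => ?_) hf (by simp) (by simp))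
    exact Memory.write_of_ne _ _ _ (by simpa using ha)
  · intro x hx
    obtain rfl : x = 0 := by omega
    simp [hi.symm]
  · intro j m' hj hf _ hmi hI
    have hb' : base.eval m' = b := by
      refine hb m' (AgreeOff.trans (w₁ := [arr]) (fun a ha => ?_) hf (by simp) (by simp))
      exact Memory.write_of_ne _ _ _ (by simpa using ha)
    have hval : (Expr.mul base (.load arr (.var i))).eval m' = b ^ (j + 1) := by
      simp [hb', hmi, hI j le_rfl, pow_succ, mul_comm]
    refine Runs.store (by rw [hval]; exact hpow _ hj) ?_
    rw [hval]
    intro x hx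
    rcases Nat.lt_succ_iff_lt_or_eq.1 (Nat.lt_succ_of_le hx) with h | rfl
    · have hne : x ≠ j + 1 := by omega
      simp [hi.symm, hmi, hne, hI x (by omega)]
    · simp [hi.symm, hmi]

/-! ### The arrays of the programs -/

notation "aIn" => (0 : ℕ)
notation "aOut" => (1 : ℕ)
notation "aSize" => (2 : ℕ)
notation "aPow" => (3 : ℕ)
notation "aUserPow" => (4 : ℕ)
notation "aBasePow" => (5 : ℕ)
notation "aModulus" => (6 : ℕ)
notation "aFlag" => (7 : ℕ)
notation "aTable" => (8 : ℕ)
notation "aSign" => (9 : ℕ)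
notation "aFixed" => (10 : ℕ)
notation "aSum" => (12 : ℕ)
notation "aProd" => (13 : ℕ)
notation "aMask" => (14 : ℕ)
notation "aLeft" => (15 : ℕ)
notation "aRight" => (16 : ℕ)
notation "aLeftSize" => (17 : ℕ)
notation "aCount" => (18 : ℕ)
notation "iStep" => (20 : ℕ)
notation "iCode" => (21 : ℕ)
notation "iUser" => (22 : ℕ)
notation "iConstraint" => (23 : ℕ)
notation "iFixStep" => (24 : ℕ)
notation "iFixUser" => (25 : ℕ)
notation "iRound" => (26 : ℕ)
notation "aAssign" => (27 : ℕ)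
notation "aBlockUser" => (28 : ℕ)
notation "aMeets" => (29 : ℕ)
notation "aFound" => (30 : ℕ)
notation "aCommon" => (31 : ℕ)
notation "iPlan" => (32 : ℕ)
notation "iOther" => (33 : ℕ)
notation "iBlock" => (34 : ℕ)

/-- The entry of the authorization table in the input `d`. -/
def inputAuth (d : ℕ → ℕ) (s u : ℕ) : ℕ := d (3 + d 0 * d 0 + (s * d 1 + u))

/-- The entry of the characteristic vector of the left set of a constraint in the input `d`. -/
def inputLeft (d : ℕ → ℕ) (g s : ℕ) : ℕ := d (3 + d 0 * d 0 + d 0 * d 1 + (g * (2 * d 0) + s))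

/-- The entry of the characteristic vector of the right set of a constraint in the input `d`. -/
def inputRight (d : ℕ → ℕ) (g s : ℕ) : ℕ :=
  d (3 + d 0 * d 0 + d 0 * d 1 + (g * (2 * d 0) + d 0 + s))

namespace Expr

def steps : Expr := .load aIn (.lit 0)

def users : Expr := .load aIn (.lit 1)

def constraints : Expr := .load aIn (.lit 2)

def auth (s u : Expr) : Expr :=
  .load aIn (.add (.add (.lit 3) (.mul steps steps)) (.add (.mul s users) u))

def leftSet (g s : Expr) : Expr :=
  .load aIn (.add (.add (.add (.lit 3) (.mul steps steps)) (.mul steps users))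
    (.add (.mul g (.mul (.lit 2) steps)) s))

def rightSet (g s : Expr) : Expr :=
  .load aIn (.add (.add (.add (.lit 3) (.mul steps steps)) (.mul steps users))
    (.add (.add (.mul g (.mul (.lit 2) steps)) steps) s))

/-- The binary digit of `x` at position `i`. -/
def digit (x i : Expr) : Expr := .mod (.div x (.load aPow i)) (.lit 2)

section Input

variable {d : ℕ → ℕ} {m : Memory}

theorem eval_steps (h : m aIn = d) : steps.eval m = d 0 := by simp [steps, h]

theorem eval_users (h : m aIn = d) : users.eval m = d 1 := by simp [users, h]

theorem eval_constraints (h : m aIn = d) : constraints.eval m = d 2 := by simp [constraints, h]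

theorem eval_auth (h : m aIn = d) (s u : Expr) :
    (auth s u).eval m = inputAuth d (s.eval m) (u.eval m) := by
  simp [auth, inputAuth, h, users, steps]

theorem eval_leftSet (h : m aIn = d) (g s : Expr) :
    (leftSet g s).eval m = inputLeft d (g.eval m) (s.eval m) := by
  simp [leftSet, inputLeft, h, users, steps]

theorem eval_rightSet (h : m aIn = d) (g s : Expr) :
    (rightSet g s).eval m = inputRight d (g.eval m) (s.eval m) := by
  simp [rightSet, inputRight, h, users, steps]

end Input

end Expr

/-- The input, the size of the ground set and the table of powers of two are in place. -/
structure Ready (d : ℕ → ℕ) (K : ℕ) (m : Memory) : Prop where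
  input : m aIn = d
  size : m aSize 0 = K
  pow : ∀ i ≤ K, m aPow i = 2 ^ i

namespace Ready

variable {d : ℕ → ℕ} {K : ℕ} {m m' : Memory}

theorem of_agree {w : List ℕ} (h : Ready d K m) (hf : AgreeOff w m m')
    (hw : aIn ∉ w ∧ aSize ∉ w ∧ aPow ∉ w) : Ready d K m' where
  input := by rw [hf _ hw.1, h.input]
  size := by rw [hf _ hw.2.1, h.size]
  pow := by rw [hf _ hw.2.2]; exact h.pow

theorem eval_steps (h : Ready d K m) : Expr.steps.eval m = d 0 := Expr.eval_steps h.input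

theorem eval_auth (h : Ready d K m) (s u : Expr) :
    (Expr.auth s u).eval m = inputAuth d (s.eval m) (u.eval m) := Expr.eval_auth h.input s u

theorem eval_leftSet (h : Ready d K m) (g s : Expr) :
    (Expr.leftSet g s).eval m = inputLeft d (g.eval m) (s.eval m) := Expr.eval_leftSet h.input g s

theorem eval_rightSet (h : Ready d K m) (g s : Expr) :
    (Expr.rightSet g s).eval m = inputRight d (g.eval m) (s.eval m) :=
  Expr.eval_rightSet h.input g s

theorem eval_digit (h : Ready d K m) (x i : Expr) (hi : i.eval m ≤ K) :
    (Expr.digit x i).eval m = x.eval m / 2 ^ i.eval m % 2 := by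
  simp [Expr.digit, h.pow _ hi]

end Ready

/-! ### Eligible sets of steps -/

/-- The number of elements of the left set of constraint `g` in the set coded by `x`. -/
def leftCount (d : ℕ → ℕ) (x g : ℕ) : ℕ :=
  ∑ s ∈ Finset.range (d 0), x / 2 ^ s % 2 * inputLeft d g s

/-- The number of elements of the right set of constraint `g` in the set coded by `x`. -/
def rightCount (d : ℕ → ℕ) (x g : ℕ) : ℕ :=
  ∑ s ∈ Finset.range (d 0), x / 2 ^ s % 2 * inputRight d g s

/-- The number of elements of the left set of constraint `g`. -/
def leftSize (d : ℕ → ℕ) (g : ℕ) : ℕ := ∑ s ∈ Finset.range (d 0), inputLeft d g s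

/-- The three counts for the current set and the current constraint. -/
def Program.counts : Program :=
  .store aLeft (.lit 0) (.lit 0) ;;
  .store aRight (.lit 0) (.lit 0) ;;
  .store aLeftSize (.lit 0) (.lit 0) ;;
  .forLoop iStep .steps (
    .store aLeft (.lit 0) (.add (.var aLeft)
      (.mul (.digit (.var iCode) (.var iStep)) (.leftSet (.var iConstraint) (.var iStep)))) ;;
    .store aRight (.lit 0) (.add (.var aRight)
      (.mul (.digit (.var iCode) (.var iStep)) (.rightSet (.var iConstraint) (.var iStep)))) ;;
    .store aLeftSize (.lit 0) (.add (.var aLeftSize) (.leftSet (.var iConstraint) (.var iStep))))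

/-- The flag tells whether the current set passes the test for all constraints. -/
def Program.eligible (test : Expr) : Program :=
  .store aFlag (.lit 0) (.lit 1) ;;
  .forLoop iConstraint .constraints
    (.counts ;; .branch test (.store aFlag (.lit 0) (.lit 0)) .skip)

theorem sum_range_le_of_le_one {f : ℕ → ℕ} {j k : ℕ} (hj : j ≤ k) (hf : ∀ s < k, f s ≤ 1) :
    ∑ s ∈ Finset.range j, f s ≤ k :=
  calc ∑ s ∈ Finset.range j, f s ≤ ∑ _s ∈ Finset.range j, 1 :=
        Finset.sum_le_sum fun s hs => hf s (by have := Finset.mem_range.1 hs; omega)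
    _ ≤ k := by simpa using hj

theorem counts_spec {L K : ℕ} {d : ℕ → ℕ} {m : Memory} (hm : Ready d K m) (hk : d 0 ≤ K)
    (hkL : d 0 < 2 ^ L)
    (hl : ∀ s < d 0, inputLeft d (m iConstraint 0) s ≤ 1)
    (hr : ∀ s < d 0, inputRight d (m iConstraint 0) s ≤ 1) :
    Runs L .counts m (d 0 * 5 + 5) fun m' =>
      m' aLeft 0 = leftCount d (m iCode 0) (m iConstraint 0) ∧
      m' aRight 0 = rightCount d (m iCode 0) (m iConstraint 0) ∧
      m' aLeftSize 0 = leftSize d (m iConstraint 0) := by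
  have hd : ∀ x s, x / 2 ^ s % 2 ≤ 1 := fun x s => by
    have := Nat.mod_lt (x / 2 ^ s) (show 0 < 2 by norm_num)
    omega
  have hl' : ∀ s < d 0, m iCode 0 / 2 ^ s % 2 * inputLeft d (m iConstraint 0) s ≤ 1 :=
    fun s hs => (Nat.mul_le_mul (hd _ s) (hl s hs)).trans (by norm_num)
  have hr' : ∀ s < d 0, m iCode 0 / 2 ^ s % 2 * inputRight d (m iConstraint 0) s ≤ 1 :=
    fun s hs => (Nat.mul_le_mul (hd _ s) (hr s hs)).trans (by norm_num)
  have h2 : 0 < 2 ^ L := by positivity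
  refine (Runs.store_seq (by simp) (Runs.store_seq (by simp) (Runs.store_seq (by simp)
    (Runs.forLoop (τ := 1 + (1 + 1)) (N := d 0) (fun j m' =>
      m' aLeft 0 = ∑ s ∈ Finset.range j, m iCode 0 / 2 ^ s % 2 * inputLeft d (m iConstraint 0) s ∧
      m' aRight 0 = ∑ s ∈ Finset.range j, m iCode 0 / 2 ^ s % 2 * inputRight d (m iConstraint 0) s ∧
      m' aLeftSize 0 = ∑ s ∈ Finset.range j, inputLeft d (m iConstraint 0) s)
      (by simp) ?_ hkL ?_ ?_ fun m' _ _ h => h)))).mono (by ring_nf; omega)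
  · intro m' hf
    simp [Expr.steps, hf 0, hm.input]
  · simp
  · intro j m' hj hf _ hmi ⟨h1, h2, h3⟩
    have hc : m' iConstraint 0 = m iConstraint 0 := by simp [hf 23]
    have hx : m' iCode 0 = m iCode 0 := by simp [hf 21]
    have hm' : Ready d K m' := ⟨by simp [hf 0, hm.input], by simp [hf 2, hm.size],
      by simpa [hf 3] using hm.pow⟩
    have b1 := sum_range_le_of_le_one (Nat.succ_le_of_lt hj) hl'
    have b2 := sum_range_le_of_le_one (Nat.succ_le_of_lt hj) hr'
    have b3 := sum_range_le_of_le_one (Nat.succ_le_of_lt hj) hl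
    rw [Finset.sum_range_succ] at b1 b2 b3
    have v1 : (Expr.add (.var aLeft) (.mul (.digit (.var iCode) (.var iStep))
        (.leftSet (.var iConstraint) (.var iStep)))).eval m' =
        ∑ s ∈ Finset.range (j + 1), m iCode 0 / 2 ^ s % 2 * inputLeft d (m iConstraint 0) s := by
      rw [Finset.sum_range_succ]
      simp only [Expr.eval, hm'.eval_leftSet, Expr.eval_var]
      rw [hm'.eval_digit _ _ (by simp [hmi]; omega)]
      simp [hmi, h1, hc, hx]
    refine Runs.store_seq (by rw [v1, Finset.sum_range_succ]; omega) ?_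
    rw [v1]
    set m₁ := m'.write aLeft (Expr.eval m' (.lit 0))
      (∑ s ∈ Finset.range (j + 1), m iCode 0 / 2 ^ s % 2 * inputLeft d (m iConstraint 0) s) with hm₁
    have hm₁' : Ready d K m₁ := ⟨by simp [hm₁, hm'.input], by simp [hm₁, hm'.size],
      by simpa [hm₁] using hm'.pow⟩
    have v2 : (Expr.add (.var aRight) (.mul (.digit (.var iCode) (.var iStep))
        (.rightSet (.var iConstraint) (.var iStep)))).eval m₁ =
        ∑ s ∈ Finset.range (j + 1), m iCode 0 / 2 ^ s % 2 * inputRight d (m iConstraint 0) s := by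
      rw [Finset.sum_range_succ]
      simp only [Expr.eval, hm₁'.eval_rightSet, Expr.eval_var]
      rw [hm₁'.eval_digit _ _ (by simp [hm₁, hmi]; omega)]
      simp [hm₁, hmi, h2, hc, hx]
    refine Runs.store_seq (by rw [v2, Finset.sum_range_succ]; omega) ?_
    rw [v2]
    set m₂ := m₁.write aRight (Expr.eval m₁ (.lit 0))
      (∑ s ∈ Finset.range (j + 1), m iCode 0 / 2 ^ s % 2 * inputRight d (m iConstraint 0) s) with hm₂
    have hm₂' : Ready d K m₂ := ⟨by simp [hm₂, hm₁'.input], by simp [hm₂, hm₁'.size],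
      by simpa [hm₂] using hm₁'.pow⟩
    have v3 : (Expr.add (.var aLeftSize) (.leftSet (.var iConstraint) (.var iStep))).eval m₂ =
        ∑ s ∈ Finset.range (j + 1), inputLeft d (m iConstraint 0) s := by
      rw [Finset.sum_range_succ]
      simp only [Expr.eval, hm₂'.eval_leftSet, Expr.eval_var]
      simp [hm₂, hm₁, hmi, h3, hc]
    refine Runs.store (by rw [v3, Finset.sum_range_succ]; omega) ?_
    rw [v3]
    simp [hm₂, hm₁]

/-- The predicate `T` says when a constraint is violated, in terms of the code, the index and the
three counts. Keeping it abstract lets the same program serve both notions of eligibility. -/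
theorem eligible_spec {L K : ℕ} {d : ℕ → ℕ} {m : Memory} {test : Expr}
    {T : ℕ → ℕ → ℕ → ℕ → ℕ → Prop}
    (htest : ∀ m, Ready d K m → m iConstraint 0 < d 2 → (test.eval m ≠ 0 ↔
      T (m iCode 0) (m iConstraint 0) (m aLeft 0) (m aRight 0) (m aLeftSize 0)))
    (hm : Ready d K m) (hk : d 0 ≤ K) (hkL : d 0 < 2 ^ L) (hcL : d 2 < 2 ^ L) (hL : 1 < 2 ^ L)
    (hl : ∀ g < d 2, ∀ s < d 0, inputLeft d g s ≤ 1)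
    (hr : ∀ g < d 2, ∀ s < d 0, inputRight d g s ≤ 1) :
    Runs L (.eligible test) m (d 2 * (d 0 * 5 + 9) + 3) fun m' =>
      m' aFlag 0 ≤ 1 ∧ (m' aFlag 0 = 1 ↔ ∀ g < d 2, ¬ T (m iCode 0) g
        (leftCount d (m iCode 0) g) (rightCount d (m iCode 0) g) (leftSize d g)) := by
  refine (Runs.store_seq (by simpa using hL)
    (Runs.forLoop (τ := d 0 * 5 + 5 + (1 + 1)) (N := d 2) (fun j m' =>
      m' aFlag 0 ≤ 1 ∧ (m' aFlag 0 = 1 ↔ ∀ g < j, ¬ T (m iCode 0) g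
        (leftCount d (m iCode 0) g) (rightCount d (m iCode 0) g) (leftSize d g)))
      (by simp [Program.counts]) ?_ hcL ?_ ?_ fun m' _ _ h => h)).mono (by ring_nf; omega)
  · intro m' hf
    simp [Expr.constraints, hf 0, Program.counts, hm.input]
  · simp
  · intro j m' hj hf _ hmi ⟨h1, h2⟩
    have hm' : Ready d K m' := ⟨by simp [hf 0, hm.input, Program.counts],
      by simp [hf 2, hm.size, Program.counts], by simpa [hf 3, Program.counts] using hm.pow⟩
    have hx : m' iCode 0 = m iCode 0 := by simp [hf 21, Program.counts]
    refine Runs.seq (counts_spec hm' hk hkL (by rw [hmi]; exact hl j hj) (by rw [hmi]; exact hr j hj))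
      fun m₁ hf₁ _ hI => ?_
    have hm₁ : Ready d K m₁ := hm'.of_agree hf₁ (by simp [Program.counts])
    have hg : m₁ iConstraint 0 = j := by rw [hf₁ 23 (by simp [Program.counts]), hmi]
    have hx₁ : m₁ iCode 0 = m iCode 0 := by rw [hf₁ 21 (by simp [Program.counts]), hx]
    have hF : m₁ aFlag 0 = m' aFlag 0 := by rw [hf₁ 7 (by simp [Program.counts])]
    have ht := htest m₁ hm₁ (by omega)
    rw [hI.1, hI.2.1, hI.2.2, hg, hx₁, hmi, hx] at ht
    refine Runs.branch (fun h => Runs.store (by simp) ?_) fun h => Runs.skip ?_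
    · have e : ((m₁.write aFlag 0 0).write iConstraint 0 (j + 1)) aFlag 0 = 0 := by simp
      simp only [Expr.eval]
      rw [e]
      exact ⟨by omega, by omega, fun h' => absurd (ht.1 h) (h' j (by omega))⟩
    · have hT := (not_congr ht).1 (by simpa using h)
      have e : (m₁.write iConstraint 0 (j + 1)) aFlag 0 = m' aFlag 0 := by simp [hF]
      rw [e]
      refine ⟨h1, h2.trans ⟨fun h' g hg => ?_, fun h' g hg => h' g (by omega)⟩⟩
      rcases Nat.lt_succ_iff_lt_or_eq.1 hg with h3 | rfl
      · exact h' g h3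
      · exact hT

/-! ### The table of sums over all subsets -/

/-- The number of elements of the current set. -/
def Program.cardinality : Program :=
  .store aCount (.lit 0) (.lit 0) ;;
  .forLoop iStep (.var aSize)
    (.store aCount (.lit 0) (.add (.var aCount) (.digit (.var iCode) (.var iStep))))

theorem cardinality_spec {L K : ℕ} {d : ℕ → ℕ} {m : Memory} (hm : Ready d K m) (hK : K < 2 ^ L) :
    Runs L .cardinality m (K * 3 + 3) fun m' => m' aCount 0 = (maskSet K (m iCode 0)).card := by
  rw [card_maskSet]
  have hd : ∀ s < K, m iCode 0 / 2 ^ s % 2 ≤ 1 := fun s _ => by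
    have := Nat.mod_lt (m iCode 0 / 2 ^ s) (show 0 < 2 by norm_num)
    omega
  refine (Runs.store_seq (by simp) (Runs.forLoop (τ := 1) (N := K) (fun j m' =>
    m' aCount 0 = ∑ s ∈ Finset.range j, m iCode 0 / 2 ^ s % 2)
    (by simp) ?_ hK (by simp) ?_ fun m' _ _ h => h)).mono (by ring_nf; omega)
  · intro m' hf
    simp [hf 2, hm.size]
  · intro j m' hj hf _ hmi hI
    have hm' : Ready d K m' := ⟨by simp [hf 0, hm.input], by simp [hf 2, hm.size],
      by simpa [hf 3] using hm.pow⟩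
    have b := sum_range_le_of_le_one (Nat.succ_le_of_lt hj) hd
    have v : (Expr.add (.var aCount) (.digit (.var iCode) (.var iStep))).eval m' =
        ∑ s ∈ Finset.range (j + 1), m iCode 0 / 2 ^ s % 2 := by
      rw [Finset.sum_range_succ, Expr.eval, hm'.eval_digit _ _ (by simp [hmi]; omega)]
      simp [hmi, hI, hf 21]
    refine Runs.store (by rw [v]; exact lt_of_le_of_lt b hK) ?_
    rw [v]
    simp

/-- In addition to `Ready`, the modulus and the powers of the base are in place. -/
structure Based (d : ℕ → ℕ) (K B : ℕ) (m : Memory) : Prop extends Ready d K m where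
  basePow : ∀ i ≤ K, m aBasePow i = B ^ i
  modulus : m aModulus 0 = B ^ (K + 1)

theorem Based.of_agree {d : ℕ → ℕ} {K B : ℕ} {m m' : Memory} {w : List ℕ} (h : Based d K B m)
    (hf : AgreeOff w m m')
    (hw : aIn ∉ w ∧ aSize ∉ w ∧ aPow ∉ w ∧ aBasePow ∉ w ∧ aModulus ∉ w) : Based d K B m' where
  toReady := h.toReady.of_agree hf ⟨hw.1, hw.2.1, hw.2.2.1⟩
  basePow := by rw [hf _ hw.2.2.2.1]; exact h.basePow
  modulus := by rw [hf _ hw.2.2.2.2]; exact h.modulus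

/-- The weights and the signs of all sets. -/
def Program.weights (test : Expr) : Program :=
  .forLoop iCode (.load aPow (.var aSize))
    (.eligible test ;; .cardinality ;;
      .store aTable (.var iCode) (.mul (.var aFlag) (.load aBasePow (.var aCount))) ;;
      .store aSign (.var iCode) (.add (.sub (.lit 1) (.mod (.var aCount) (.lit 2)))
        (.mul (.mod (.var aCount) (.lit 2)) (.sub (.var aModulus) (.lit 1)))))

/-- The machine has no negative numbers, so `-1` is represented by `M - 1`. -/
theorem cast_sign {M c : ℕ} (hM : 0 < M) :
    ((1 - c % 2 + c % 2 * (M - 1) : ℕ) : ZMod M) = (-1) ^ c := by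
  rcases Nat.even_or_odd c with h | h
  · rw [Nat.even_iff.1 h, h.neg_one_pow]
    simp
  · rw [Nat.odd_iff.1 h, h.neg_one_pow]
    simp only [tsub_self, one_mul, zero_add]
    rw [Nat.cast_sub hM]
    simp

theorem weights_spec {L K B : ℕ} {d : ℕ → ℕ} {m : Memory} {test : Expr}
    {T : ℕ → ℕ → ℕ → ℕ → ℕ → Prop} {E : Finset (Fin K) → Prop}
    (htest : ∀ m, Ready d K m → m iConstraint 0 < d 2 → (test.eval m ≠ 0 ↔
      T (m iCode 0) (m iConstraint 0) (m aLeft 0) (m aRight 0) (m aLeftSize 0)))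
    (hE : ∀ x < 2 ^ K, E (maskSet K x) ↔ ∀ g < d 2, ¬ T x g
      (leftCount d x g) (rightCount d x g) (leftSize d g))
    (hm : Based d K B m) (hB : 0 < B) (hk : d 0 ≤ K) (hKL : 2 ^ K < 2 ^ L) (hcL : d 2 < 2 ^ L)
    (hML : B ^ (K + 1) < 2 ^ L)
    (hl : ∀ g < d 2, ∀ s < d 0, inputLeft d g s ≤ 1)
    (hr : ∀ g < d 2, ∀ s < d 0, inputRight d g s ≤ 1) :
    Runs L (.weights test) m (2 ^ K * (d 2 * (d 0 * 5 + 9) + K * 3 + 10) + 2) fun m' =>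
      ∀ x < 2 ^ K, (E (maskSet K x) → m' aTable x = B ^ (maskSet K x).card) ∧
        (¬ E (maskSet K x) → m' aTable x = 0) ∧
        (m' aSign x : ZMod (B ^ (K + 1))) = (-1) ^ (maskSet K x).card := by
  have hKL' : K < 2 ^ L := Nat.lt_two_pow_self.trans hKL
  have h1L : 1 < 2 ^ L := lt_of_le_of_lt (Nat.one_le_two_pow (n := K)) hKL
  have hMpos : 0 < B ^ (K + 1) := by positivity
  refine (Runs.forLoop (τ := (d 2 * (d 0 * 5 + 9) + 3) + ((K * 3 + 3) + (1 + 1))) (N := 2 ^ K)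
    (fun j m' => ∀ x < j, (E (maskSet K x) → m' aTable x = B ^ (maskSet K x).card) ∧
        (¬ E (maskSet K x) → m' aTable x = 0) ∧
        (m' aSign x : ZMod (B ^ (K + 1))) = (-1) ^ (maskSet K x).card)
    (by simp [Program.eligible, Program.cardinality, Program.counts]) ?_ hKL (by simp) ?_
    fun m' _ _ h => h).mono (by ring_nf; omega)
  · intro m' hf
    simp [hf 2, hf 3, Program.eligible, Program.cardinality, Program.counts, hm.size, hm.pow]
  · intro j m' hj hf _ hmi hI
    have hm' : Based d K B m' := hm.of_agree hf
      (by simp [Program.eligible, Program.cardinality, Program.counts])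
    refine Runs.seq (eligible_spec htest hm'.toReady hk (by omega) hcL h1L hl hr)
      fun m₁ hf₁ _ hI₁ => ?_
    have hm₁ : Based d K B m₁ := hm'.of_agree hf₁ (by simp [Program.eligible, Program.counts])
    have hx₁ : m₁ iCode 0 = j := by rw [hf₁ 21 (by simp [Program.eligible, Program.counts]), hmi]
    refine Runs.seq (cardinality_spec hm₁.toReady hKL') fun m₂ hf₂ _ hI₂ => ?_
    have hm₂ : Based d K B m₂ := hm₁.of_agree hf₂ (by simp [Program.cardinality])
    have hx₂ : m₂ iCode 0 = j := by rw [hf₂ 21 (by simp [Program.cardinality]), hx₁]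
    have hF : m₂ aFlag 0 = m₁ aFlag 0 := by rw [hf₂ 7 (by simp [Program.cardinality])]
    have hT : m₂ aTable = m' aTable := by
      rw [hf₂ 8 (by simp [Program.cardinality]), hf₁ 8 (by simp [Program.eligible, Program.counts])]
    have hS : m₂ aSign = m' aSign := by
      rw [hf₂ 9 (by simp [Program.cardinality]), hf₁ 9 (by simp [Program.eligible, Program.counts])]
    rw [hx₁] at hI₂
    rw [hmi, ← hF, ← hE j hj] at hI₁
    set c := (maskSet K j).card with hc
    have hcK : c ≤ K := by simpa using Finset.card_le_univ (maskSet K j)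
    have v : (Expr.mul (.var aFlag) (.load aBasePow (.var aCount))).eval m₂ = m₂ aFlag 0 * B ^ c := by
      simp [hI₂, hm₂.basePow c hcK]
    have hBc : B ^ c ≤ B ^ (K + 1) := Nat.pow_le_pow_right hB (by omega)
    -- The flag is at most `1`, so the product acts as a case distinction and stays below the
    -- modulus.
    refine Runs.store_seq (by rw [v]; nlinarith [hI₁.1]) ?_
    rw [v]
    simp only [Expr.eval_var, hx₂]
    set m₃ := m₂.write aTable j (m₂ aFlag 0 * B ^ c) with hm₃
    have v' : (Expr.add (.sub (.lit 1) (.mod (.var aCount) (.lit 2)))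
        (.mul (.mod (.var aCount) (.lit 2)) (.sub (.var aModulus) (.lit 1)))).eval m₃ =
          1 - c % 2 + c % 2 * (B ^ (K + 1) - 1) := by
      simp [hm₃, hI₂, hm₂.modulus]
    have hx₃ : (Expr.var iCode).eval m₃ = j := by simp [hm₃, hx₂]
    refine Runs.store ?_ ?_
    · rw [v']
      rcases Nat.mod_two_eq_zero_or_one c with h | h <;> rw [h] <;> omega
    · rw [v', hx₃]
      intro x hx
      rcases Nat.lt_succ_iff_lt_or_eq.1 hx with h | rfl
      · have hne : x ≠ j := by omega
        simpa [hm₃, Function.update_apply, hne, hT, hS] using hI x h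
      · refine ⟨fun h => ?_, fun h => ?_, ?_⟩
        · simp [hm₃, hI₁.2.2 h, hc]
        · have : m₂ aFlag 0 = 0 := by
            have := hI₁.1
            have := mt hI₁.2.1 h
            omega
          simp [hm₃, this]
        · rw [← cast_sign hMpos]
          simp [hm₃, ← hc]

/-- Replaces the weights by their sums over all subsets, one element of the ground set per round.
Round `r` writes row `r + 1` of the table. -/
def Program.subsetSums : Program :=
  .forLoop iRound (.var aSize) (.forLoop iCode (.load aPow (.var aSize))
    (.store aTable
      (.add (.mul (.add (.var iRound) (.lit 1)) (.load aPow (.var aSize))) (.var iCode))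
      (.mod (.add
        (.load aTable (.add (.mul (.var iRound) (.load aPow (.var aSize))) (.var iCode)))
        (.mul (.digit (.var iCode) (.var iRound))
          (.load aTable (.add (.mul (.var iRound) (.load aPow (.var aSize)))
            (.sub (.var iCode) (.load aPow (.var iRound)))))))
        (.var aModulus))))

theorem subsetSums_spec {L K B : ℕ} {d : ℕ → ℕ} {m : Memory} (hm : Based d K B m) (hB : 0 < B)
    (hKL : 2 ^ K < 2 ^ L) (hML : B ^ (K + 1) < 2 ^ L) :
    Runs L .subsetSums m (K * (2 ^ K * 3 + 4) + 2) fun m' =>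
      ∀ x < 2 ^ K, (m' aTable (K * 2 ^ K + x) : ZMod (B ^ (K + 1))) =
        subsetSum (fun y => (m aTable y : ZMod (B ^ (K + 1)))) K x := by
  have hKL' : K < 2 ^ L := Nat.lt_two_pow_self.trans hKL
  have hMpos : 0 < B ^ (K + 1) := by positivity
  set f := fun y => (m aTable y : ZMod (B ^ (K + 1))) with hfdef
  refine (Runs.forLoop (τ := 2 ^ K * (1 + 2) + 2) (N := K)
    (fun r m' => ∀ x < 2 ^ K, (m' aTable (r * 2 ^ K + x) : ZMod (B ^ (K + 1))) = subsetSum f r x)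
    (by simp) ?_ hKL' (by simp [subsetSum, f]) ?_ fun m' _ _ h => h).mono le_rfl
  · intro m' hf
    simp [hf 2, hm.size]
  · intro r m' hr hf _ hmr hI
    have hm' : Based d K B m' := hm.of_agree hf (by simp)
    refine (Runs.forLoop (τ := 1) (N := 2 ^ K)
      (fun j m'' => (∀ x < 2 ^ K,
          (m'' aTable (r * 2 ^ K + x) : ZMod (B ^ (K + 1))) = subsetSum f r x) ∧
        ∀ x < j, (m'' aTable ((r + 1) * 2 ^ K + x) : ZMod (B ^ (K + 1))) = subsetSum f (r + 1) x)
      (by simp) ?_ hKL ?_ ?_ fun m'' _ _ h => ?_)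
    · intro m'' hf'
      simp [hf' 2, hf' 3, hm'.size, hm'.pow]
    · simpa using hI
    · intro j m'' hj hf' _ hmj ⟨hI₁, hI₂⟩
      have hm'' : Based d K B m'' := hm'.of_agree hf' (by simp)
      have hmr' : m'' iRound 0 = r := by simp [hf' 26, hmr]
      have hP : m'' aPow K = 2 ^ K := hm''.pow K le_rfl
      have hidx : (Expr.add (.mul (.add (.var iRound) (.lit 1)) (.load aPow (.var aSize)))
          (.var iCode)).eval m'' = (r + 1) * 2 ^ K + j := by
        simp [hmr', hm''.size, hP, hmj]
      have hdig := hm''.eval_digit (.var iCode) (.var iRound) (by simp [hmr']; omega)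
      simp only [Expr.eval_var, hmj, hmr'] at hdig
      refine Runs.store ?_ ?_
      · rw [Expr.eval_mod]
        refine lt_trans (Nat.mod_lt _ ?_) ?_ <;> simp only [Expr.eval_var, hm''.modulus]
        exacts [hMpos, hML]
      · rw [hidx]
        have hval : (((Expr.mod (.add
            (.load aTable (.add (.mul (.var iRound) (.load aPow (.var aSize))) (.var iCode)))
            (.mul (.digit (.var iCode) (.var iRound))
              (.load aTable (.add (.mul (.var iRound) (.load aPow (.var aSize)))
                (.sub (.var iCode) (.load aPow (.var iRound)))))))
            (.var aModulus)).eval m'' : ℕ) : ZMod (B ^ (K + 1))) = subsetSum f (r + 1) j := by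
          rw [Expr.eval_mod]
          simp only [Expr.eval, Expr.eval_var, hm''.modulus, ZMod.natCast_mod, hdig, hmr', hmj,
            hm''.size, hP, hm''.pow r hr.le]
          -- If the digit `r` of `j` is `0`, then `j - 2 ^ r` does not code the intended set, but it
          -- still addresses the same row and the value read is multiplied by `0`.
          rw [Nat.cast_add, Nat.cast_mul, hI₁ j hj, hI₁ _ (lt_of_le_of_lt (Nat.sub_le _ _) hj),
            subsetSum]
          congr 1
          split_ifs with h <;> rw [Nat.testBit_eq_decide_div_mod_eq, decide_eq_true_eq] at h
          · simp [h]
          · have : j / 2 ^ r % 2 = 0 := by omega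
            simp [this]
        rw [add_one_mul] at hI₂ ⊢
        constructor
        · intro x hx
          -- Rows do not overlap, so the row being read stays intact while the next one is written.
          have hne : r * 2 ^ K + x ≠ r * 2 ^ K + 2 ^ K + j := by omega
          simpa [Function.update_apply, hne] using hI₁ x hx
        · intro x hx
          rcases Nat.lt_succ_iff_lt_or_eq.1 hx with h | rfl
          · have hne : x ≠ j := by omega
            simpa [Function.update_apply, hne] using hI₂ x h
          · simpa using hval
    · intro x hx
      simpa using h.2 x hx

/-! ### Deciding whether a partial plan extends to a valid plan -/

/-- The user `u` may perform the step `s`, given that `p s = v + 1` means that `s` is assigned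
to `v`. Everyone may perform the elements of the ground set that are not steps. -/
def Allowed (d p : ℕ → ℕ) (s u : ℕ) : Prop :=
  (s < d 0 → inputAuth d s u ≠ 0) ∧ (p s = 0 ∨ p s = u + 1)

/-- The partial plan `p` extends to a map with eligible fibers. -/
def Extends (d p : ℕ → ℕ) {K : ℕ} (E : Finset (Fin K) → Prop) (π : Fin K → Fin (d 1)) : Prop :=
  (∀ s : Fin K, Allowed d p s (π s)) ∧ ∀ u, E (Finset.univ.filter fun s => π s = u)

def Expr.allowed (s u : Expr) : Expr :=
  .mul (.add (.auth s u) (.sub (.lit 1) (.sub .steps s)))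
    (.sub (.lit 1) (.mul (.load aFixed s)
      (.sub (.lit 1) (.eq (.load aFixed s) (.add u (.lit 1))))))

/-- Truncated subtraction serves as logic: `1 - (k - s)` is nonzero exactly if `s` is not a step.
The sum is then positive whatever the load beyond the authorization table returns. -/
theorem Ready.eval_allowed {d : ℕ → ℕ} {K : ℕ} {m : Memory} (h : Ready d K m) (s u : Expr) :
    (Expr.allowed s u).eval m ≠ 0 ↔ Allowed d (m aFixed) (s.eval m) (u.eval m) := by
  simp only [Expr.allowed, Expr.eq, Expr.eval, h.eval_auth, h.eval_steps, Allowed,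
    mul_ne_zero_iff]
  refine and_congr (by omega) ?_
  by_cases h1 : m aFixed (s.eval m) = u.eval m + 1
  · simp [h1]
  · have h2 : 1 - (1 - (m aFixed (s.eval m) - (u.eval m + 1) +
        (u.eval m + 1 - m aFixed (s.eval m)))) = 1 := by omega
    rw [h2]
    omega

/-- The code of the members of the current set that the current user may perform. -/
def Program.mask : Program :=
  .store aMask (.lit 0) (.lit 0) ;;
  .forLoop iStep (.var aSize)
    (.branch (.mul (.digit (.var iCode) (.var iStep)) (.allowed (.var iStep) (.var iUser)))
      (.store aMask (.lit 0) (.add (.var aMask) (.load aPow (.var iStep)))) .skip)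

theorem mask_spec {L K : ℕ} {d : ℕ → ℕ} {m : Memory} (hm : Ready d K m) (hKL : 2 ^ K < 2 ^ L) :
    Runs L .mask m (K * 4 + 3) fun m' => m' aMask 0 =
      maskOf (fun s => (m iCode 0).testBit s = true ∧ Allowed d (m aFixed) s (m iUser 0)) K := by
  set p := fun s => (m iCode 0).testBit s = true ∧ Allowed d (m aFixed) s (m iUser 0) with hp
  refine (Runs.store_seq (by simp) (Runs.forLoop (τ := 1 + 1) (N := K) (fun j m' =>
    m' aMask 0 = maskOf p j)
    (by simp) ?_ (Nat.lt_two_pow_self.trans hKL) (by simp [maskOf]) ?_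
    fun m' _ _ h => h)).mono (by ring_nf; omega)
  · intro m' hf
    simp [hf 2, hm.size]
  · intro j m' hj hf _ hmi hI
    have hm' : Ready d K m' := ⟨by simp [hf 0, hm.input], by simp [hf 2, hm.size],
      by simpa [hf 3] using hm.pow⟩
    have ht : (Expr.mul (.digit (.var iCode) (.var iStep))
        (.allowed (.var iStep) (.var iUser))).eval m' ≠ 0 ↔ p j := by
      rw [Expr.eval, mul_ne_zero_iff, hm'.eval_allowed, hm'.eval_digit _ _ (by simp [hmi]; omega)]
      simp only [Expr.eval_var, hmi]
      simp only [hp, hf 21 (by simp), hf 22 (by simp), hf 10 (by simp)]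
      simp [Nat.testBit_eq_decide_div_mod_eq]
    refine Runs.branch (fun h => ?_) fun h => Runs.skip ?_
    · have hv : (Expr.add (.var aMask) (.load aPow (.var iStep))).eval m' = maskOf p (j + 1) := by
        simp [hI, hmi, hm'.pow j hj.le, maskOf_succ, ht.1 h]
      refine Runs.store ?_ ?_
      · rw [hv]
        exact (maskOf_lt _ _).trans_le ((Nat.pow_le_pow_right (by norm_num) hj).trans hKL.le)
      · rw [hv]
        simp
    · have : ¬ p j := fun h' => (ht.2 h') h
      simp [maskOf_succ, this, hI]

/-- The product over all users, multiplied by the sign, for the current set. -/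
def Program.product : Program :=
  .store aProd (.lit 0) (.load aSign (.var iCode)) ;;
  .forLoop iUser .users (.mask ;;
    .store aProd (.lit 0) (.mod (.mul (.var aProd)
      (.load aTable (.add (.mul (.var aSize) (.load aPow (.var aSize))) (.var aMask))))
      (.var aModulus)))

theorem product_spec {L K B : ℕ} {d : ℕ → ℕ} {m : Memory} (hm : Based d K B m) (hB : 0 < B)
    (hb : m.Bounded L) (hKL : 2 ^ K < 2 ^ L) (hML : B ^ (K + 1) < 2 ^ L) (hnL : d 1 < 2 ^ L)
    {F : ℕ → ZMod (B ^ (K + 1))}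
    (hF : ∀ x < 2 ^ K, (m aTable (K * 2 ^ K + x) : ZMod (B ^ (K + 1))) = F x) :
    Runs L .product m (d 1 * (K * 4 + 6) + 3) fun m' =>
      (m' aProd 0 : ZMod (B ^ (K + 1))) = (m aSign (m iCode 0) : ZMod (B ^ (K + 1))) *
        ∏ v ∈ Finset.range (d 1),
          F (maskOf (fun s => (m iCode 0).testBit s = true ∧ Allowed d (m aFixed) s v) K) := by
  have hMpos : 0 < B ^ (K + 1) := by positivity
  refine (Runs.store_seq (by simpa using hb _ _)
    (Runs.forLoop (τ := (K * 4 + 3) + 1) (N := d 1)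
    (fun j m' => (m' aProd 0 : ZMod (B ^ (K + 1))) = (m aSign (m iCode 0) : ZMod (B ^ (K + 1))) *
        ∏ v ∈ Finset.range j,
          F (maskOf (fun s => (m iCode 0).testBit s = true ∧ Allowed d (m aFixed) s v) K))
    (by simp [Program.mask]) ?_ hnL (by simp) ?_ fun m' _ _ h => h)).mono (by ring_nf; omega)
  · intro m' hf
    simp [Expr.users, hf 0, Program.mask, hm.input]
  · intro j m' hj hf _ hmj hI
    have hm' : Based d K B m' := by
      refine hm.of_agree (w := [aProd, iUser, aMask, iStep]) ?_ (by simp)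
      intro a ha
      simp only [List.mem_cons, List.not_mem_nil, or_false, not_or] at ha
      rw [hf a (by simp [Program.mask, ha])]
      exact Memory.write_of_ne _ _ _ ha.1
    have e₁ : m' iCode 0 = m iCode 0 := by simp [hf 21, Program.mask]
    have e₂ : m' aFixed = m aFixed := by simp [hf 10, Program.mask]
    have e₃ : m' aTable = m aTable := by simp [hf 8, Program.mask]
    refine Runs.seq (mask_spec hm'.toReady hKL) fun m₁ hf₁ _ hI₁ => ?_
    have hm₁ : Based d K B m₁ := hm'.of_agree hf₁ (by simp [Program.mask])
    rw [hmj, e₁, e₂] at hI₁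
    have hP₁ : m₁ aProd 0 = m' aProd 0 := by rw [hf₁ 13 (by simp [Program.mask])]
    have hT₁ : m₁ aTable = m aTable := by rw [hf₁ 8 (by simp [Program.mask]), e₃]
    refine Runs.store ?_ ?_
    · rw [Expr.eval_mod]
      refine lt_trans (Nat.mod_lt _ ?_) ?_ <;> simp only [Expr.eval_var, hm₁.modulus]
      exacts [hMpos, hML]
    · rw [Expr.eval_mod]
      simp only [Expr.eval, Expr.eval_var, hm₁.modulus, hm₁.size, hI₁, hP₁, hT₁, hm₁.pow K le_rfl]
      rw [Memory.write_of_ne _ _ _ (by norm_num), Memory.write_same, Function.update_self,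
        ZMod.natCast_mod, Nat.cast_mul, hI, hF _ (maskOf_lt _ _), Finset.prod_range_succ, mul_assoc]

/-- In addition to `Based`, the signs and the table of sums over subsets are in place. -/
structure Tabulated (d : ℕ → ℕ) (K B : ℕ) (E : Finset (Fin K) → Prop) (m : Memory) : Prop
    extends Based d K B m where
  sign : ∀ x < 2 ^ K, (m aSign x : ZMod (B ^ (K + 1))) = (-1) ^ (maskSet K x).card
  table : ∃ f : ℕ → ZMod (B ^ (K + 1)),
    (∀ x < 2 ^ K, (E (maskSet K x) → f x = (B : ZMod (B ^ (K + 1))) ^ (maskSet K x).card) ∧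
      (¬ E (maskSet K x) → f x = 0)) ∧
    ∀ x < 2 ^ K, (m aTable (K * 2 ^ K + x) : ZMod (B ^ (K + 1))) = subsetSum f K x

theorem Tabulated.of_agree {d : ℕ → ℕ} {K B : ℕ} {E : Finset (Fin K) → Prop} {m m' : Memory}
    {w : List ℕ} (h : Tabulated d K B E m) (hf : AgreeOff w m m')
    (hw : (aIn ∉ w ∧ aSize ∉ w ∧ aPow ∉ w ∧ aBasePow ∉ w ∧ aModulus ∉ w) ∧ aSign ∉ w ∧ aTable ∉ w) :
    Tabulated d K B E m' where
  toBased := h.toBased.of_agree hf hw.1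
  sign := by rw [hf _ hw.2.1]; exact h.sign
  table := by rw [hf _ hw.2.2]; exact h.table

/-- The alternating sum is nonzero if and only if the partial plan can be extended. -/
def Program.decide : Program :=
  .store aSum (.lit 0) (.lit 0) ;;
  .forLoop iCode (.load aPow (.var aSize))
    (.product ;; .store aSum (.lit 0) (.mod (.add (.var aSum) (.var aProd)) (.var aModulus)))

theorem decide_spec {L K B : ℕ} {d : ℕ → ℕ} {E : Finset (Fin K) → Prop} {m : Memory}
    (hm : Tabulated d K B E m) (hB : B = d 1 ^ K + 1)
    (hKL : 2 ^ K < 2 ^ L) (hML : B ^ (K + 1) < 2 ^ L) (hnL : d 1 < 2 ^ L) :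
    Runs L .decide m (2 ^ K * (d 1 * (K * 4 + 6) + 6) + 3) fun m' =>
      m' aSum 0 ≠ 0 ↔ ∃ π, Extends d (m aFixed) E π := by
  have hBpos : 0 < B := by omega
  have hMpos : 0 < B ^ (K + 1) := by positivity
  obtain ⟨f, hf₀, hf₁⟩ := hm.table
  set g : ℕ → ZMod (B ^ (K + 1)) := fun x => (-1) ^ (maskSet K x).card *
    ∏ v ∈ Finset.range (d 1), subsetSum f K
      (maskOf (fun s => x.testBit s = true ∧ Allowed d (m aFixed) s v) K) with hg
  refine (Runs.store_seq (by simp)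
    (Runs.forLoop (τ := (d 1 * (K * 4 + 6) + 3) + 1) (N := 2 ^ K)
    (fun j m' => m' aSum 0 < B ^ (K + 1) ∧
      (m' aSum 0 : ZMod (B ^ (K + 1))) = ∑ x ∈ Finset.range j, g x)
    (by simp [Program.product, Program.mask]) ?_ hKL ⟨by simpa using hMpos, by simp⟩ ?_
    fun m' _ _ h => ?_)).mono (by ring_nf; omega)
  · intro m' hf
    simp [hf 2, hf 3, Program.product, Program.mask, hm.size, hm.pow]
  · intro j m' hj hf hb' hmj ⟨_, hI⟩
    have hm' : Tabulated d K B E m' := by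
      refine hm.of_agree (w := aSum :: iCode :: Program.product.writes) ?_
        (by simp [Program.product, Program.mask])
      intro a ha
      simp only [List.mem_cons, not_or] at ha
      rw [hf a (by simp [ha])]
      exact Memory.write_of_ne _ _ _ ha.1
    have e₂ : m' aFixed = m aFixed := by simp [hf 10, Program.product, Program.mask]
    have e₃ : m' aTable = m aTable := by simp [hf 8, Program.product, Program.mask]
    refine Runs.seq (product_spec hm'.toBased hBpos hb' hKL hML hnL (by rw [e₃]; exact hf₁))
      fun m₁ hf₁ _ hI₁ => ?_
    have hm₁ : Based d K B m₁ := hm'.toBased.of_agree hf₁ (by simp [Program.product, Program.mask])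
    rw [hmj, e₂, hm'.sign j hj] at hI₁
    have hS₁ : m₁ aSum 0 = m' aSum 0 := by rw [hf₁ 12 (by simp [Program.product, Program.mask])]
    refine Runs.store ?_ ?_
    · rw [Expr.eval_mod]
      refine lt_trans (Nat.mod_lt _ ?_) ?_ <;> simp only [Expr.eval_var, hm₁.modulus]
      exacts [hMpos, hML]
    · rw [Expr.eval_mod]
      simp only [Expr.eval, Expr.eval_var, hm₁.modulus, hS₁]
      rw [Memory.write_of_ne _ _ _ (by norm_num), Memory.write_same, Function.update_self,
        ZMod.natCast_mod, Nat.cast_add, hI, hI₁, Finset.sum_range_succ]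
      exact ⟨Nat.mod_lt _ hMpos, rfl⟩
  -- The stored sum is a reduced residue, so it is zero as a number iff it is zero modulo `B ^ (K +
  -- 1)`.
  · refine Iff.trans ?_ (signed_sum_ne_zero_iff E (Allowed d (m aFixed)) B hB f hf₀)
    rw [← h.2, Ne, Ne, ZMod.natCast_eq_zero_iff]
    exact not_congr ⟨fun h0 => by rw [h0]; exact dvd_zero _, fun hd => Nat.eq_zero_of_dvd_of_lt hd h.1⟩

/-! ### Finding a plan by fixing one step after the other -/

/-- Tries to assign the current step to the current user, unless it is assigned already. -/
def Program.tryUser : Program :=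
  .branch (.load aFixed (.var iFixStep)) .skip
    (.store aFixed (.var iFixStep) (.add (.var iFixUser) (.lit 1)) ;;
      .decide ;; .branch (.var aSum) .skip (.store aFixed (.var iFixStep) (.lit 0)))

def Program.fixSteps : Program :=
  .forLoop iFixStep .steps (.forLoop iFixUser .users .tryUser)

/-- The number of elementary steps of `Program.decide`. -/
def decideSteps (K n : ℕ) : ℕ := 2 ^ K * (n * (K * 4 + 6) + 6) + 3

/-- Extendability of the partial plan is invariant, because an assignment is kept only if
`Program.decide` confirms it. A refusal leaves the partial plan as it was and certifies that this
user is impossible. -/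
theorem tryUser_spec {L K B t u : ℕ} {d : ℕ → ℕ} {E : Finset (Fin K) → Prop} {m : Memory}
    (hm : Tabulated d K B E m) (hB : B = d 1 ^ K + 1)
    (hKL : 2 ^ K < 2 ^ L) (hML : B ^ (K + 1) < 2 ^ L) (hnL : d 1 < 2 ^ L)
    (ht : m iFixStep 0 = t) (hu : m iFixUser 0 = u) (hun : u < d 1)
    (hfeas : ∃ π, Extends d (m aFixed) E π) :
    Runs L .tryUser m (decideSteps K (d 1) + 4) fun m' =>
      (∃ π, Extends d (m' aFixed) E π) ∧ (∀ s ≠ t, m' aFixed s = m aFixed s) ∧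
      (m aFixed t ≠ 0 → m' aFixed = m aFixed) ∧
      (m' aFixed t = 0 → m' aFixed = m aFixed ∧
        ¬ ∃ π, Extends d (Function.update (m aFixed) t (u + 1)) E π) := by
  refine (Runs.branch (τ := 1 + (decideSteps K (d 1) + (1 + 1))) (fun h => ?_)
    fun h => ?_).mono (by omega)
  · refine (Runs.skip ⟨hfeas, fun _ _ => rfl, fun _ => rfl, fun h0 => ?_⟩).mono (by omega)
    exact absurd h0 (by simpa [ht] using h)
  · have h0 : m aFixed t = 0 := by simpa [ht] using h
    refine Runs.store_seq (by simp [hu]; omega) ?_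
    simp only [Expr.eval, Expr.eval_var, ht, hu]
    set m₁ := m.write aFixed t (u + 1) with hm₁
    have hp₁ : m₁ aFixed = Function.update (m aFixed) t (u + 1) := by simp [hm₁]
    have hT₁ : Tabulated d K B E m₁ :=
      hm.of_agree (w := [aFixed]) (fun a ha => Memory.write_of_ne _ _ _ (by simpa using ha)) (by simp)
    refine Runs.seq (decide_spec hT₁ hB hKL hML hnL) fun m₂ hf₂ _ hI₂ => ?_
    have hp₂ : m₂ aFixed = Function.update (m aFixed) t (u + 1) := by
      rw [hf₂ 10 (by simp [Program.decide, Program.product, Program.mask]), hp₁]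
    have ht₂ : m₂ iFixStep 0 = t := by
      rw [hf₂ 24 (by simp [Program.decide, Program.product, Program.mask])]
      simp [hm₁, ht]
    rw [hp₁] at hI₂
    refine Runs.branch (fun h => Runs.skip ?_) fun h => Runs.store (by simp) ?_
    · rw [hp₂]
      refine ⟨hI₂.1 h, fun s hs => by simp [hs], fun h' => absurd h0 h', fun h' => ?_⟩
      simp at h'
    -- Writing `0` restores the old partial plan, since the step was unassigned before.
    · have hp₃ : (m₂.write aFixed t 0) aFixed = m aFixed := by
        rw [Memory.write_same, hp₂, Function.update_idem, ← h0, Function.update_eq_self]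
      simp only [Expr.eval, Expr.eval_var, ht₂]
      rw [hp₃]
      exact ⟨hfeas, fun _ _ => rfl, fun _ => rfl, fun _ => ⟨rfl, fun h' => (hI₂.2 h') h⟩⟩

theorem fixSteps_spec {L K B : ℕ} {d : ℕ → ℕ} {E : Finset (Fin K) → Prop} {m : Memory}
    (hm : Tabulated d K B E m) (hB : B = d 1 ^ K + 1) (hk : d 0 ≤ K)
    (hKL : 2 ^ K < 2 ^ L) (hML : B ^ (K + 1) < 2 ^ L) (hnL : d 1 < 2 ^ L)
    (hfeas : ∃ π, Extends d (m aFixed) E π) :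
    Runs L .fixSteps m (d 0 * (d 1 * (decideSteps K (d 1) + 6) + 4) + 2) fun m' =>
      (∃ π, Extends d (m' aFixed) E π) ∧ ∀ s < d 0, m' aFixed s ≠ 0 := by
  have hwr : ∀ a ∈ [aIn, aSize, aPow, aBasePow, aModulus, aSign, aTable, iFixStep],
      a ∉ Program.tryUser.writes := by
    simp [Program.tryUser, Program.decide, Program.product, Program.mask]
  refine (Runs.forLoop (τ := d 1 * ((decideSteps K (d 1) + 4) + 2) + 2) (N := d 0)
    (fun t m' => (∃ π, Extends d (m' aFixed) E π) ∧ ∀ s < t, m' aFixed s ≠ 0)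
    (by simp [hwr]) ?_ ?_ (by simpa using hfeas) ?_ fun m' _ _ h => h).mono le_rfl
  · intro m' hf
    simp [Expr.steps, hf 0, hwr, hm.input]
  · exact lt_of_le_of_lt hk (Nat.lt_two_pow_self.trans hKL)
  · intro t m' ht hf _ hmt ⟨hI, hI'⟩
    have hm' : Tabulated d K B E m' := hm.of_agree hf (by simp [hwr])
    refine Runs.forLoop (τ := decideSteps K (d 1) + 4) (N := d 1)
      (fun u m'' => (∃ π, Extends d (m'' aFixed) E π) ∧ (∀ s < t, m'' aFixed s ≠ 0) ∧
        (m'' aFixed t = 0 → ∀ v < u, ¬ ∃ π, Extends d (Function.update (m'' aFixed) t (v + 1)) E π))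
      (by simp [Program.tryUser, Program.decide, Program.product, Program.mask]) ?_ hnL ?_ ?_
      fun m'' hf'' _ h => ?_
    · intro m'' hf''
      simp [Expr.users, hf'' 0, hwr, hm'.input]
    · simpa using ⟨hI, hI'⟩
    · intro u m'' hu hf'' _ hmu ⟨h₁, h₂, h₃⟩
      have hm'' : Tabulated d K B E m'' := hm'.of_agree hf'' (by simp [hwr])
      have hmt'' : m'' iFixStep 0 = t := by rw [hf'' 24 (by simp [hwr]), hmt]
      refine (tryUser_spec hm'' hB hKL hML hnL hmt'' hmu hu h₁).conseq le_rfl ?_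
      rintro m₃ - - ⟨g₁, g₂, g₃, g₄⟩
      simp only [Memory.write_of_ne m₃ (a := iFixUser) (b := aFixed) 0 _ (by norm_num)]
      refine ⟨g₁, fun s hs => by rw [g₂ s (by omega)]; exact h₂ s hs, fun h0 v hv => ?_⟩
      obtain ⟨e, hne⟩ := g₄ h0
      -- As long as the step is unassigned the partial plan does not change, so the earlier refusals
      -- remain valid.
      rw [e] at h0 ⊢
      rcases Nat.lt_succ_iff_lt_or_eq.1 hv with h | rfl
      · exact h₃ h0 v h
      · exact hne
    · simp only [Memory.write_of_ne m'' (a := iFixStep) (b := aFixed) 0 _ (by norm_num)]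
      refine ⟨h.1, fun s hs => ?_⟩
      rcases Nat.lt_succ_iff_lt_or_eq.1 hs with hlt | rfl
      · exact h.2.1 s hlt
      · intro h0
        -- If the step were still unassigned, all users would have been refused. But an extension
        -- `π` of the current partial plan exists, and the user it gives to this step cannot have
        -- been refused.
        obtain ⟨π, hπ₁, hπ₂⟩ := h.1
        refine h.2.2 h0 (π ⟨s, by omega⟩) (π _).2 ⟨π, fun s' => ⟨(hπ₁ s').1, ?_⟩, hπ₂⟩
        by_cases hs' : (s' : ℕ) = s
        · right
          subst hs'
          simp
        · simpa [hs'] using (hπ₁ s').2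

/-- Decides whether there is a valid plan, and if so, finds one and writes it to the output. -/
def Program.search : Program :=
  .decide ;; .branch (.var aSum)
    (.fixSteps ;; .store aOut (.lit 0) (.lit 1) ;;
      .forLoop iFixStep .steps (.store aOut (.add (.var iFixStep) (.lit 1))
        (.sub (.load aFixed (.var iFixStep)) (.lit 1)))) .skip

theorem search_spec {L K B : ℕ} {d : ℕ → ℕ} {E : Finset (Fin K) → Prop} {m : Memory}
    (hm : Tabulated d K B E m) (hB : B = d 1 ^ K + 1) (hk : d 0 ≤ K)
    (hKL : 2 ^ K < 2 ^ L) (hML : B ^ (K + 1) < 2 ^ L) (hnL : d 1 < 2 ^ L)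
    (hfix : m aFixed = 0) (hout : m aOut 0 = 0) :
    Runs L .search m (decideSteps K (d 1) + d 0 * (d 1 * (decideSteps K (d 1) + 6) + 7) + 6) fun m' =>
      (∃ π, Extends d 0 E π ∧ m' aOut 0 = 1 ∧
        ∀ (s : ℕ) (hs : s < d 0), m' aOut (s + 1) = π ⟨s, by omega⟩) ∨
      ((¬ ∃ π, Extends d 0 E π) ∧ m' aOut 0 = 0) := by
  have hk1 : d 0 < 2 ^ L := lt_of_le_of_lt hk (Nat.lt_two_pow_self.trans hKL)
  have h1L : 1 < 2 ^ L := lt_of_le_of_lt (Nat.one_le_two_pow (n := K)) hKL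
  have hw : ∀ a ∈ [aOut, aFixed], a ∉ Program.decide.writes := by
    simp [Program.decide, Program.product, Program.mask]
  have hw' : aIn ∉ Program.fixSteps.writes := by
    simp [Program.fixSteps, Program.tryUser, Program.decide, Program.product, Program.mask]
  refine (Runs.seq (decide_spec hm hB hKL hML hnL) fun m₁ hf₁ _ hI₁ => Runs.branch
    (τ := (d 0 * (d 1 * (decideSteps K (d 1) + 6) + 4) + 2) + (1 + (d 0 * (1 + 2) + 2)))
    (fun h => ?_) fun h => ?_).mono (by unfold decideSteps; ring_nf; omega)
  · have hm₁ : Tabulated d K B E m₁ := hm.of_agree hf₁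
      (by simp [Program.decide, Program.product, Program.mask])
    have hp₁ : m₁ aFixed = m aFixed := by rw [hf₁ 10 (by simp [hw])]
    refine Runs.seq (fixSteps_spec hm₁ hB hk hKL hML hnL (by rw [hp₁]; exact hI₁.1 h))
      fun m₂ hf₂ hb₂ ⟨⟨π, hπ₁, hπ₂⟩, hI₂⟩ => ?_
    have hin₂ : m₂ aIn = d := by rw [hf₂ 0 hw', hm₁.input]
    refine Runs.store_seq (by simpa using h1L) ?_
    refine Runs.forLoop (τ := 1) (N := d 0)
      (fun j m' => m' aOut 0 = 1 ∧ ∀ s < j, m' aOut (s + 1) = m₂ aFixed s - 1)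
      (by simp) ?_ hk1 (by simp) ?_ fun m' _ _ h' => ?_
    · intro m' hf
      simp [Expr.steps, hf 0, hin₂]
    · intro j m' hj hf _ hmj ⟨g₁, g₂⟩
      have hp' : m' aFixed = m₂ aFixed := by simp [hf 10]
      have hv : (Expr.sub (.load aFixed (.var iFixStep)) (.lit 1)).eval m' = m₂ aFixed j - 1 := by
        simp [hp', hmj]
      refine Runs.store ?_ ?_
      · rw [hv]
        exact lt_of_le_of_lt (Nat.sub_le _ _) (hb₂ _ _)
      · rw [hv]
        refine ⟨by simp [hmj, g₁], fun s hs => ?_⟩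
        rcases Nat.lt_succ_iff_lt_or_eq.1 hs with h3 | rfl
        · have hne : s ≠ j := by omega
          simp [hmj, hne, g₂ s h3]
        · simp [hmj]
    · left
      -- Every step is fixed now, so an arbitrary extension `π` of the final table agrees with the
      -- output; it also extends the empty partial plan.
      refine ⟨π, ⟨fun s => ⟨(hπ₁ s).1, Or.inl rfl⟩, hπ₂⟩, h'.1, fun s hs => ?_⟩
      rw [h'.2 s hs]
      have := (hπ₁ ⟨s, by omega⟩).2
      have h0 := hI₂ s hs
      simp only at this
      omega
  · refine (Runs.skip (Or.inr ⟨?_, ?_⟩)).mono (by omega)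
    · rw [hfix] at hI₁
      exact fun h' => (hI₁.2 h') h
    · rw [hf₁ 1 (by simp [hw]), hout]

/-! ### Reading the input -/

theorem getD_flatMap_of_length {α : Type*} (l : List α) (f : α → List ℕ) (w : ℕ)
    (hw : ∀ a ∈ l, (f a).length = w) (i j : ℕ) (hi : i < l.length) (hj : j < w) :
    (l.flatMap f).getD (i * w + j) 0 = (f l[i]).getD j 0 := by
  induction l generalizing i with
  | nil => simp at hi
  | cons a l ih =>
    have ha : (f a).length = w := hw a (by simp)
    rw [List.flatMap_cons]
    cases i with
    | zero =>
      rw [List.getD_append _ _ _ _ (by omega)]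
      simp
    | succ i =>
      rw [List.getD_append_right _ _ _ _ (by rw [ha]; nlinarith), ha]
      have e : (i + 1) * w + j - w = i * w + j := by
        rw [add_one_mul]
        omega
      rw [e, ih (fun b hb => hw b (by simp [hb])) i (by simpa using hi)]
      simp

theorem length_flatMap_of_length {α β : Type*} (l : List α) (f : α → List β) (w : ℕ)
    (hw : ∀ a ∈ l, (f a).length = w) : (l.flatMap f).length = l.length * w := by
  induction l with
  | nil => simp
  | cons a l ih =>
    rw [List.flatMap_cons, List.length_append, ih fun b hb => hw b (by simp [hb]), hw a (by simp),
      List.length_cons]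
    ring

theorem bit_le_one (p : Prop) : bit p ≤ 1 := by
  unfold bit
  split_ifs <;> norm_num

theorem bit_ne_zero_iff {p : Prop} : bit p ≠ 0 ↔ p := by
  unfold bit
  split_ifs with h <;> simp [h]

/-- The numbers `d` represent the workflow schema `W`. -/
structure Encodes (d : ℕ → ℕ) {k n : ℕ} (W : Schema (Fin k) (Fin n)) : Prop where
  steps : d 0 = k
  users : d 1 = n
  constraints : d 2 = W.constraints.length
  auth : ∀ (s : Fin k) (u : Fin n), inputAuth d s u = bit (W.auth s u)
  left : ∀ (g : ℕ) (hg : g < W.constraints.length) (s : Fin k),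
    inputLeft d g s = bit (s ∈ (W.constraints[g]).left)
  right : ∀ (g : ℕ) (hg : g < W.constraints.length) (s : Fin k),
    inputRight d g s = bit (s ∈ (W.constraints[g]).right)
  le : ∀ i, d i ≤ d 0 + d 1 + d 2 + 1

/-- Each table consists of blocks of constant width, so its entries are found by arithmetic, at the
offsets `3`, `3 + k²` and `3 + k² + k n`. -/
theorem Instance.encodes_initial (I : Instance) : Encodes (I.initial aIn) I.schema := by
  obtain ⟨k, n, W⟩ := I
  set X := (List.finRange k).flatMap
        (fun s => (List.finRange k).map fun t => bit (W.order.le s t)) with hX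
  set Y := (List.finRange k).flatMap
        (fun s => (List.finRange n).map fun u => bit (W.auth s u)) with hY
  set Z := W.constraints.flatMap
        (fun γ => (List.finRange k).map (fun s => bit (s ∈ γ.left))
          ++ (List.finRange k).map (fun s => bit (s ∈ γ.right))) with hZ
  have hXl : X.length = k * k := by
    rw [hX, length_flatMap_of_length _ _ k (by simp)]
    simp
  have hYl : Y.length = k * n := by
    rw [hY, length_flatMap_of_length _ _ n (by simp)]
    simp
  set d := (Instance.mk k n W).initial aIn with hd
  have hdi : ∀ i, d i = ([k, n, W.constraints.length] ++ X ++ Y ++ Z).getD i 0 := by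
    intro i
    simp [hd, initial, encode, hX, hY, hZ, c]
  have h0 : d 0 = k := by rw [hdi]; simp
  have h1 : d 1 = n := by rw [hdi]; simp
  have h2 : d 2 = W.constraints.length := by rw [hdi]; simp
  have hZget : ∀ j, d (3 + k * k + k * n + j) = Z.getD j 0 := by
    intro j
    rw [hdi, List.getD_append_right _ _ _ _ (by simp [hXl, hYl]; omega)]
    congr 1
    simp [hXl, hYl]
    omega
  refine ⟨h0, h1, h2, ?_, ?_, ?_, ?_⟩
  · intro s u
    have hlt : (s : ℕ) * n + u < k * n := by nlinarith [s.2, u.2]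
    rw [inputAuth, h0, h1, hdi, List.getD_append _ _ _ _ (by simp [hXl, hYl]; omega),
      List.getD_append_right _ _ _ _ (by simp [hXl]; omega)]
    have e : 3 + k * k + (s * n + u) - ([k, n, W.constraints.length] ++ X).length = s * n + u := by
      simp [hXl]
      omega
    rw [e, hY, getD_flatMap_of_length _ _ n (by simp) _ _ (by simp) u.2]
    simp
  · intro g hg s
    have hs : (s : ℕ) < k := s.2
    rw [inputLeft, h0, h1, hZget, hZ, getD_flatMap_of_length _ _ (2 * k) (by simp; omega) _ _ hg
      (by omega), List.getD_append _ _ _ _ (by simp)]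
    simp
  · intro g hg s
    have hs : (s : ℕ) < k := s.2
    rw [inputRight, h0, h1, hZget, hZ, add_assoc,
      getD_flatMap_of_length _ _ (2 * k) (by simp; omega) _ _ hg
      (by omega), List.getD_append_right _ _ _ _ (by simp)]
    simp
  · intro i
    have hmem : ∀ l : List ℕ, (∀ v ∈ l, v ≤ d 0 + d 1 + d 2 + 1) → l.getD i 0 ≤ d 0 + d 1 + d 2 + 1 := by
      intro l hl
      by_cases hi : i < l.length
      · rw [List.getD_eq_getElem _ _ hi]
        exact hl _ (List.getElem_mem hi)
      · rw [List.getD_eq_default _ _ (by omega)]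
        omega
    rw [hdi]
    refine hmem _ fun v hv => ?_
    have hbit : ∀ p, bit p ≤ d 0 + d 1 + d 2 + 1 := fun p => (bit_le_one p).trans (by omega)
    simp only [List.mem_append, List.mem_cons, List.not_mem_nil, or_false] at hv
    rcases hv with (((rfl | rfl | rfl) | hv) | hv) | hv
    · omega
    · omega
    · omega
    · rw [hX] at hv
      simp only [List.mem_flatMap, List.mem_map] at hv
      obtain ⟨_, _, _, _, rfl⟩ := hv
      exact hbit _
    · rw [hY] at hv
      simp only [List.mem_flatMap, List.mem_map] at hv
      obtain ⟨_, _, _, _, rfl⟩ := hv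
      exact hbit _
    · rw [hZ] at hv
      simp only [List.mem_flatMap, List.mem_append, List.mem_map] at hv
      obtain ⟨_, _, ⟨_, _, rfl⟩ | ⟨_, _, rfl⟩⟩ := hv <;> exact hbit _

theorem Instance.initial_of_ne (I : Instance) {a : ℕ} (ha : a ≠ aIn) : I.initial a = 0 := by
  funext i
  simp [initial, ha]

theorem Instance.bounded_initial (I : Instance) {L : ℕ} (h : I.k + I.n + I.c + 1 < 2 ^ L) :
    I.initial.Bounded L := by
  intro a i
  by_cases ha : a = aIn
  · subst ha
    have hE := I.encodes_initial
    have := hE.le i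
    rw [hE.steps, hE.users, hE.constraints] at this
    exact lt_of_le_of_lt this h
  · rw [I.initial_of_ne ha]
    exact Nat.pos_of_ne_zero (by positivity)

section Counts

variable {d : ℕ → ℕ} {k n : ℕ} {W : Schema (Fin k) (Fin n)}

theorem Encodes.left_le_one (h : Encodes d W) : ∀ g < d 2, ∀ s < d 0, inputLeft d g s ≤ 1 := by
  intro g hg s hs
  rw [h.constraints] at hg
  rw [h.steps] at hs
  rw [h.left g hg ⟨s, hs⟩]
  exact bit_le_one _

theorem Encodes.right_le_one (h : Encodes d W) : ∀ g < d 2, ∀ s < d 0, inputRight d g s ≤ 1 := by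
  intro g hg s hs
  rw [h.constraints] at hg
  rw [h.steps] at hs
  rw [h.right g hg ⟨s, hs⟩]
  exact bit_le_one _

theorem Encodes.leftCount_ne_zero_iff (h : Encodes d W) (x g : ℕ) (hg : g < W.constraints.length) :
    leftCount d x g ≠ 0 ↔ ∃ s ∈ (W.constraints[g]).left, x.testBit s = true := by
  rw [leftCount, h.steps, Finset.sum_range, Ne, Finset.sum_eq_zero_iff]
  push Not
  simp only [Finset.mem_univ, true_and, h.left g hg, mul_ne_zero_iff, bit_ne_zero_iff,
    Nat.testBit_eq_decide_div_mod_eq, decide_eq_true_eq, Nat.mod_two_ne_zero]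
  exact exists_congr fun s => and_comm

theorem Encodes.rightCount_ne_zero_iff (h : Encodes d W) (x g : ℕ) (hg : g < W.constraints.length) :
    rightCount d x g ≠ 0 ↔ ∃ s ∈ (W.constraints[g]).right, x.testBit s = true := by
  rw [rightCount, h.steps, Finset.sum_range, Ne, Finset.sum_eq_zero_iff]
  push Not
  simp only [Finset.mem_univ, true_and, h.right g hg, mul_ne_zero_iff, bit_ne_zero_iff,
    Nat.testBit_eq_decide_div_mod_eq, decide_eq_true_eq, Nat.mod_two_ne_zero]
  exact exists_congr fun s => and_comm

theorem Encodes.leftSize_eq (h : Encodes d W) (g : ℕ) (hg : g < W.constraints.length) :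
    leftSize d g = (W.constraints[g]).left.card := by
  rw [leftSize, h.steps, Finset.sum_range, Finset.sum_congr rfl fun s _ => h.left g hg s]
  have := Finset.card_filter (fun s => s ∈ (W.constraints[g]).left) Finset.univ
  rw [Finset.filter_univ_mem] at this
  rw [this]
  refine Finset.sum_congr rfl fun s _ => ?_
  unfold bit
  split_ifs <;> rfl

end Counts

/-! ### The complete program -/

/-- Solves the problem on a ground set of the given size, with the given test for constraints. -/
def Program.solve (size test : Expr) : Program :=
  .store aSize (.lit 0) size ;;
  .powers iStep aPow (.lit 2) (.var aSize) ;;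
  .powers iStep aUserPow .users (.var aSize) ;;
  .powers iStep aBasePow (.add (.load aUserPow (.var aSize)) (.lit 1))
    (.add (.var aSize) (.lit 1)) ;;
  .store aModulus (.lit 0) (.load aBasePow (.add (.var aSize) (.lit 1))) ;;
  .weights test ;; .subsetSums ;; .search

/-- Nested like the sequence in `Program.solve`, so that the sequencing rule produces exactly this
term. -/
def solveSteps (k n c K : ℕ) : ℕ :=
  1 + ((K * 3 + 3) + ((K * 3 + 3) + (((K + 1) * 3 + 3) + (1 +
    ((2 ^ K * (c * (k * 5 + 9) + K * 3 + 10) + 2) + ((K * (2 ^ K * 3 + 4) + 2) +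
    (decideSteps K n + k * (n * (decideSteps K n + 6) + 7) + 6)))))))

theorem solve_spec {L K B : ℕ} {d : ℕ → ℕ} {m : Memory} {size test : Expr}
    {T : ℕ → ℕ → ℕ → ℕ → ℕ → Prop} {E : Finset (Fin K) → Prop}
    (htest : ∀ m, Ready d K m → m iConstraint 0 < d 2 → (test.eval m ≠ 0 ↔
      T (m iCode 0) (m iConstraint 0) (m aLeft 0) (m aRight 0) (m aLeftSize 0)))
    (hE : ∀ x < 2 ^ K, E (maskSet K x) ↔ ∀ g < d 2, ¬ T x g
      (leftCount d x g) (rightCount d x g) (leftSize d g))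
    (hin : m aIn = d) (hsize : size.eval m = K) (hfix : m aFixed = 0) (hout : m aOut 0 = 0)
    (hB : B = d 1 ^ K + 1) (hk : d 0 ≤ K) (hKL : 2 ^ K < 2 ^ L) (hML : B ^ (K + 1) < 2 ^ L)
    (hnL : d 1 < 2 ^ L) (hcL : d 2 < 2 ^ L)
    (hl : ∀ g < d 2, ∀ s < d 0, inputLeft d g s ≤ 1)
    (hr : ∀ g < d 2, ∀ s < d 0, inputRight d g s ≤ 1) :
    Runs L (.solve size test) m (solveSteps (d 0) (d 1) (d 2) K) fun m' =>
      (∃ π, Extends d 0 E π ∧ m' aOut 0 = 1 ∧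
        ∀ (s : ℕ) (hs : s < d 0), m' aOut (s + 1) = π ⟨s, by omega⟩) ∨
      ((¬ ∃ π, Extends d 0 E π) ∧ m' aOut 0 = 0) := by
  have hK1 : K + 1 ≤ 2 ^ K := Nat.lt_two_pow_self
  have hBpos : 0 < B := by omega
  have hBM : ∀ j ≤ K + 1, B ^ j < 2 ^ L := fun j hj =>
    (Nat.pow_le_pow_right hBpos hj).trans_lt hML
  have hBL : B < 2 ^ L := by simpa using hBM 1 (by omega)
  refine Runs.store_seq (by omega) ?_
  rw [hsize]
  simp only [Expr.eval]
  set m₀ := m.write aSize 0 K with hm₀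
  have hs₀ : m₀ aSize 0 = K := by simp [hm₀]
  have hi₀ : m₀ aIn = d := by simp [hm₀, hin]
  have ho₀ : m₀ aOut 0 = 0 := by simp [hm₀, hout]
  have hf₀ : m₀ aFixed = 0 := by simp [hm₀, hfix]
  refine Runs.seq (powers_spec (b := 2) (N := K) (by norm_num) (by simp) ?_ ?_ (by omega))
    fun m₁ hf₁ _ hI₁ => ?_
  · intro m' hf
    simp [hf 2, hs₀]
  · exact fun j hj => (Nat.pow_le_pow_right (by norm_num) hj).trans_lt hKL
  have hm₁ : Ready d K m₁ := by
    refine ⟨?_, ?_, hI₁⟩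
    · rw [hf₁ 0 (by simp [Program.powers]), hi₀]
    · rw [hf₁ 2 (by simp [Program.powers]), hs₀]
  refine Runs.seq (powers_spec (b := d 1) (N := K) (by norm_num) ?_ ?_ ?_ (by omega))
    fun m₂ hf₂ _ hI₂ => ?_
  · intro m' hf
    simp [Expr.users, hf 0, hm₁.input]
  · intro m' hf
    simp [hf 2, hm₁.size]
  · intro j hj
    refine lt_of_le_of_lt ?_ hBL
    -- Without users the powers are not monotone in the exponent, as `0 ^ 0 = 1`; but `B` is still
    -- large enough.
    rcases Nat.eq_zero_or_pos (d 1) with h0 | h0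
    · rw [h0, hB]
      exact (pow_le_one₀ le_rfl (Nat.zero_le 1)).trans (by omega)
    · have := Nat.pow_le_pow_right h0 hj
      omega
  have hm₂ : Ready d K m₂ := hm₁.of_agree hf₂ (by simp [Program.powers])
  -- The exponents go up to `K + 1` because the last power is the modulus.
  refine Runs.seq (powers_spec (b := B) (N := K + 1) (by norm_num) ?_ ?_ hBM (by omega))
    fun m₃ hf₃ _ hI₃ => ?_
  · intro m' hf
    simp [hf 2, hf 4, hm₂.size, hI₂ K le_rfl, hB]
  · intro m' hf
    simp [hf 2, hm₂.size]
  have hm₃ : Ready d K m₃ := hm₂.of_agree hf₃ (by simp [Program.powers])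
  have hv : (Expr.load aBasePow (.add (.var aSize) (.lit 1))).eval m₃ = B ^ (K + 1) := by
    simp [hm₃.size, hI₃ (K + 1) le_rfl]
  refine Runs.store_seq (by rw [hv]; exact hML) ?_
  rw [hv]
  simp only [Expr.eval]
  set m₄ := m₃.write aModulus 0 (B ^ (K + 1)) with hm₄'
  have hm₄ : Based d K B m₄ :=
    ⟨⟨by simp [hm₄', hm₃.input], by simp [hm₄', hm₃.size], by simpa [hm₄'] using hm₃.pow⟩,
      by simpa [hm₄'] using fun i hi => hI₃ i (by omega), by simp [hm₄']⟩
  have hof₄ : m₄ aOut = m₀ aOut ∧ m₄ aFixed = m₀ aFixed := by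
    simp [hm₄', hf₃ 1, hf₂ 1, hf₁ 1, hf₃ 10, hf₂ 10, hf₁ 10, Program.powers]
  refine Runs.seq (weights_spec htest hE hm₄ hBpos hk hKL hcL hML hl hr) fun m₅ hf₅ _ hI₅ => ?_
  have hw₅ : ∀ a ∈ [aIn, aSize, aPow, aBasePow, aModulus, aOut, aFixed],
      a ∉ (Program.weights test).writes := by
    simp [Program.weights, Program.eligible, Program.cardinality, Program.counts]
  have hm₅ : Based d K B m₅ := hm₄.of_agree hf₅ (by simp [hw₅])
  refine Runs.seq (subsetSums_spec hm₅ hBpos hKL hML) fun m₆ hf₆ _ hI₆ => ?_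
  have hw₆ : ∀ a ∈ [aIn, aSize, aPow, aBasePow, aModulus, aOut, aFixed, aSign],
      a ∉ Program.subsetSums.writes := by
    simp [Program.subsetSums]
  have hm₆ : Tabulated d K B E m₆ := by
    refine ⟨hm₅.of_agree hf₆ (by simp [hw₆]), ?_, _, ?_, hI₆⟩
    · rw [hf₆ 9 (by simp [hw₆])]
      exact fun x hx => (hI₅ x hx).2.2
    · intro x hx
      refine ⟨fun h => ?_, fun h => ?_⟩
      · simp [(hI₅ x hx).1 h]
      · simp [(hI₅ x hx).2.1 h]
  refine search_spec hm₆ hB hk hKL hML hnL ?_ ?_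
  · rw [hf₆ 10 (by simp [hw₆]), hf₅ 10 (by simp [hw₅]), hof₄.2, hf₀]
  · rw [hf₆ 1 (by simp [hw₆]), hf₅ 1 (by simp [hw₅]), hof₄.1, ho₀]

/-! ### Running time -/

/-- The number of bits that suffice for all cells, if the running time has logarithm `l`. -/
def wordSize (l : ℕ) : ℕ := ((l + 1) * l + 1) * (l + 1) + l + 4

theorem wordSize_le {l : ℕ} (hl : 1 ≤ l) : wordSize l + 1 ≤ 18 * l ^ 3 := by
  have h2 : l ≤ l ^ 2 := by nlinarith
  have h3 : l ^ 2 ≤ l ^ 3 := by nlinarith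
  unfold wordSize
  ring_nf
  omega

/-- `h0` covers the degenerate case in which the factor of `2 ^ K` is zero. It will hold because
without users there are no steps, and without constraints there are no further elements. -/
theorem size_le_log {K c n : ℕ} (h0 : c + n ^ 2 = 0 → K = 0) :
    K ≤ Nat.log 2 (2 ^ K * (c + n ^ 2) + 2) := by
  rcases Nat.eq_zero_or_pos (c + n ^ 2) with h | h
  · simp [h0 h]
  · refine Nat.le_log_of_pow_le (by norm_num) ?_
    nlinarith [Nat.one_le_two_pow (n := K)]

theorem one_le_log_add_two (x : ℕ) : 1 ≤ Nat.log 2 (x + 2) :=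
  Nat.le_log_of_pow_le (by norm_num) (by omega)

/-- The modulus is the critical number: `K ≤ l` and `n < 2 ^ (l + 1)` bound it by `2` to the power
`((l + 1) * l + 1) * (l + 1)`, so `wordSize` is cubic in `l`. -/
theorem bounds_of_wordSize {k n c K l : ℕ} (hk : k ≤ K) (h0 : c + n ^ 2 = 0 → K = 0)
    (hl : l = Nat.log 2 (2 ^ K * (c + n ^ 2) + 2)) :
    2 ^ K < 2 ^ wordSize l ∧ (n ^ K + 1) ^ (K + 1) < 2 ^ wordSize l ∧
      k + n + c + 1 < 2 ^ wordSize l := by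
  have hKl : K ≤ l := hl ▸ size_le_log h0
  have hT : 2 ^ K * (c + n ^ 2) + 2 < 2 ^ (l + 1) := by
    rw [hl]
    exact Nat.lt_pow_succ_log_self (by norm_num) _
  have hP := Nat.one_le_two_pow (n := K)
  have hcn : c + n ^ 2 + 2 < 2 ^ (l + 1) := lt_of_le_of_lt (by nlinarith) hT
  have hn : n < 2 ^ (l + 1) := by nlinarith
  refine ⟨Nat.pow_lt_pow_right (by norm_num) (by unfold wordSize; omega), ?_, ?_⟩
  · have h1 : n ^ K + 1 ≤ 2 ^ ((l + 1) * l + 1) := by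
      have : n ^ K ≤ 2 ^ ((l + 1) * l) :=
        calc n ^ K ≤ (2 ^ (l + 1)) ^ K := Nat.pow_le_pow_left hn.le _
          _ ≤ (2 ^ (l + 1)) ^ l := Nat.pow_le_pow_right (by positivity) hKl
          _ = _ := by rw [← pow_mul]
      have := Nat.one_le_two_pow (n := (l + 1) * l)
      rw [pow_succ]
      omega
    calc (n ^ K + 1) ^ (K + 1) ≤ (2 ^ ((l + 1) * l + 1)) ^ (l + 1) :=
          (Nat.pow_le_pow_left h1 _).trans (Nat.pow_le_pow_right (by positivity) (by omega))
      _ = 2 ^ (((l + 1) * l + 1) * (l + 1)) := by rw [← pow_mul]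
      _ < _ := Nat.pow_lt_pow_right (by norm_num) (by unfold wordSize; omega)
  · have h1 : k < 2 ^ (l + 1) :=
      lt_of_le_of_lt (hk.trans hKl) (Nat.lt_two_pow_self.trans (Nat.pow_lt_pow_right (by norm_num)
        (by omega)))
    calc k + n + c + 1 < 2 ^ (l + 1) * 4 := by nlinarith
      _ = 2 ^ (l + 3) := by ring
      _ ≤ _ := Nat.pow_le_pow_right (by norm_num) (by unfold wordSize; omega)

theorem solveSteps_le {k n c K l : ℕ} (hk : k ≤ K) (h0 : c + n ^ 2 = 0 → K = 0)
    (hl : l = Nat.log 2 (2 ^ K * (c + n ^ 2) + 2)) :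
    solveSteps k n c K ≤ 300 * (2 ^ K * (c + n ^ 2) + 1) * l ^ 2 := by
  have hKl : K ≤ l := hl ▸ size_le_log h0
  have hl1 : 1 ≤ l := hl ▸ one_le_log_add_two _
  have hkl := hk.trans hKl
  -- Replacing `Q` by `Q + 1` allows uniform estimates below and costs only a factor `2`.
  have hPQ : 2 ^ K * (c + n ^ 2 + 1) ≤ 2 * (2 ^ K * (c + n ^ 2) + 1) := by
    rcases Nat.eq_zero_or_pos (c + n ^ 2) with h | h
    · simp [h0 h, h]
    · nlinarith [Nat.one_le_two_pow (n := K)]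
  have hP := Nat.one_le_two_pow (n := K)
  set P := 2 ^ K with hPdef
  set Q := c + n ^ 2 with hQ
  have hn2 : (n + 1) ^ 2 ≤ 2 * (Q + 1) := by nlinarith [sq_nonneg ((n : ℤ) - 1), two_mul_le_add_sq n 1]
  have hn1 : n + 1 ≤ 2 * (Q + 1) := by nlinarith
  have hc : c ≤ Q := by omega
  have hl2 : l ≤ l ^ 2 := by nlinarith
  have hl2' : 1 ≤ l ^ 2 := hl1.trans hl2
  have hX : l ^ 2 ≤ P * (Q + 1) * l ^ 2 := Nat.le_mul_of_pos_left _ (by positivity)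
  have hXl : l ≤ P * (Q + 1) * l ^ 2 := hl2.trans hX
  have hX1 : 1 ≤ P * (Q + 1) * l ^ 2 := hl1.trans hXl
  have hD : decideSteps K n ≤ 10 * l * (n + 1) * P := by
    unfold decideSteps
    rw [← hPdef]
    have : n * (K * 4 + 6) + 9 ≤ 10 * l * (n + 1) := by nlinarith
    nlinarith
  have hD' : decideSteps K n ≤ 20 * (P * (Q + 1) * l ^ 2) := by
    calc _ ≤ 10 * l * (n + 1) * P := hD
      _ ≤ 10 * l ^ 2 * (2 * (Q + 1)) * P := by gcongr
      _ = _ := by ring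
  -- The search for the plan: at most `k n` decisions of about `2 ^ K n K` steps each. This term
  -- produces `n ^ 2` and `l ^ 2`.
  have hS : k * (n * (decideSteps K n + 6) + 7) ≤ 39 * (P * (Q + 1) * l ^ 2) := by
    have h1 : n * (decideSteps K n + 6) + 7 ≤ 17 * l * (n + 1) ^ 2 * P := by
      have h2 : n * decideSteps K n ≤ n * (10 * l * (n + 1) * P) := Nat.mul_le_mul_left _ hD
      have h3 : n + 1 ≤ l * (n + 1) ^ 2 * P := by
        calc n + 1 = 1 * (n + 1) * 1 := by ring
          _ ≤ l * (n + 1) ^ 2 * P := by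
            gcongr
            nlinarith
      have h4 : n * (10 * l * (n + 1) * P) ≤ 10 * (l * (n + 1) ^ 2 * P) := by
        calc n * (10 * l * (n + 1) * P) ≤ (n + 1) * (10 * l * (n + 1) * P) := by gcongr; omega
          _ = _ := by ring
      nlinarith
    calc k * (n * (decideSteps K n + 6) + 7) ≤ l * (17 * l * (n + 1) ^ 2 * P) := by gcongr
      _ ≤ l * (17 * l * (2 * (Q + 1)) * P) := by gcongr
      _ = 34 * (P * (Q + 1) * l ^ 2) := by ring
      _ ≤ _ := by omega
  have hW : P * (c * (k * 5 + 9) + K * 3 + 10) ≤ 27 * (P * (Q + 1) * l ^ 2) := by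
    calc P * (c * (k * 5 + 9) + K * 3 + 10) ≤ P * (Q * (l * 5 + 9 * l) + l * 3 + 10 * l) := by
          gcongr <;> omega
      _ ≤ P * (27 * ((Q + 1) * l)) := by gcongr; nlinarith
      _ ≤ P * (27 * ((Q + 1) * l ^ 2)) := by gcongr
      _ = _ := by ring
  have hZ : K * (P * 3 + 4) ≤ 7 * (P * (Q + 1) * l ^ 2) := by
    calc K * (P * 3 + 4) ≤ l ^ 2 * (P * 3 + 4 * P) := by gcongr <;> omega
      _ = 7 * (P * 1 * l ^ 2) := by ring
      _ ≤ _ := by gcongr; omega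
  have htot : solveSteps k n c K ≤ 150 * (P * (Q + 1) * l ^ 2) := by
    unfold solveSteps
    rw [← hPdef]
    omega
  calc solveSteps k n c K ≤ 150 * (P * (Q + 1) * l ^ 2) := htot
    _ = 150 * (P * (Q + 1)) * l ^ 2 := by ring
    _ ≤ 150 * (2 * (P * Q + 1)) * l ^ 2 := by gcongr
    _ = _ := by ring

theorem allowed_zero_iff {d : ℕ → ℕ} {W : Schema (Fin (d 0)) (Fin (d 1))} (h : Encodes d W)
    (s : Fin (d 0)) (u : Fin (d 1)) : Allowed d 0 s u ↔ W.auth s u := by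
  simp [Allowed, h.auth, bit_ne_zero_iff]

/-- The general scheme: if validity amounts to the existence of a map with eligible fibers on a
ground set of size `K`, then the program solves the problem in the required time. -/
theorem exists_exec_solve (size test : Expr) :
    ∃ C : ℕ, ∀ (d : ℕ → ℕ) (W : Schema (Fin (d 0)) (Fin (d 1))) (m : Memory) (K : ℕ)
      (T : ℕ → ℕ → ℕ → ℕ → ℕ → Prop) (E : Finset (Fin K) → Prop),
    Encodes d W → m aIn = d → (∀ a, a ≠ aIn → m a = 0) → size.eval m = K →
    (hk : d 0 ≤ K) → (d 2 + d 1 ^ 2 = 0 → K = 0) →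
    (∀ m, Ready d K m → m iConstraint 0 < d 2 → (test.eval m ≠ 0 ↔
      T (m iCode 0) (m iConstraint 0) (m aLeft 0) (m aRight 0) (m aLeftSize 0))) →
    (∀ x < 2 ^ K, E (maskSet K x) ↔ ∀ g < d 2, ¬ T x g
      (leftCount d x g) (rightCount d x g) (leftSize d g)) →
    (∀ π, Extends d 0 E π → W.Valid fun s => π (Fin.castLE hk s)) →
    (∀ π, W.Valid π → ∃ π', Extends d 0 E π') →
    ∃ m' t, Exec (.solve size test) m m' t ∧
      ((∃ π, W.Valid π ∧ m' aOut 0 = 1 ∧ ∀ s : Fin (d 0), m' aOut (s + 1) = π s) ∨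
        ((¬ ∃ π, W.Valid π) ∧ m' aOut 0 = 0)) ∧
      t ≤ C * (2 ^ K * (d 2 + d 1 ^ 2) + 1) *
        Nat.log 2 (2 ^ K * (d 2 + d 1 ^ 2) + 2) ^ 5 := by
  -- `5400 = 18 * 300`, from the bounds `18 l³` on the word length and `300 (T + 1) l²` on the
  -- number of steps.
  refine ⟨(Program.solve size test).weight * 5400, ?_⟩
  intro d W m K T E hE hin hz hsize hk h0 htest hET hval hext
  set l := Nat.log 2 (2 ^ K * (d 2 + d 1 ^ 2) + 2) with hl
  obtain ⟨b₁, b₂, b₃⟩ := bounds_of_wordSize hk h0 hl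
  have hb : m.Bounded (wordSize l) := by
    intro a i
    by_cases ha : a = aIn
    · rw [ha, hin]
      exact lt_of_le_of_lt (hE.le i) b₃
    · rw [hz a ha]
      exact Nat.pos_of_ne_zero (by positivity)
  obtain ⟨m', t, he, ht, -, hQ⟩ := solve_spec (L := wordSize l) htest hET hin hsize
    (hz 10 (by norm_num)) (by rw [hz 1 (by norm_num)]; rfl) rfl hk b₁ b₂ (by omega) (by omega)
    hE.left_le_one hE.right_le_one hb
  refine ⟨m', t, he, ?_, ht.trans ?_⟩
  · rcases hQ with ⟨π, h₁, h₂, h₃⟩ | ⟨h₁, h₂⟩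
    · exact Or.inl ⟨_, hval π h₁, h₂, fun s => h₃ s s.2⟩
    · exact Or.inr ⟨fun ⟨π, hπ⟩ => h₁ (hext π hπ), h₂⟩
  · calc (Program.solve size test).weight * (wordSize l + 1) * solveSteps (d 0) (d 1) (d 2) K
        ≤ (Program.solve size test).weight * (18 * l ^ 3) *
          (300 * (2 ^ K * (d 2 + d 1 ^ 2) + 1) * l ^ 2) := by
          gcongr
          · exact wordSize_le (hl ▸ one_le_log_add_two _)
          · exact solveSteps_le hk h0 hl
      _ = _ := by ring

/-! ### Constraints with a singleton -/

/-- No constraint has a singleton side that meets the set while the other side does not. -/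
def BlockEligible {k n : ℕ} (W : Schema (Fin k) (Fin n)) (V : Finset (Fin k)) : Prop :=
  ∀ (g : ℕ) (hg : g < W.constraints.length),
    ¬ ((W.constraints[g].left.card = 1 ∧ (∃ s ∈ W.constraints[g].left, s ∈ V) ∧
        ¬ ∃ s ∈ W.constraints[g].right, s ∈ V) ∨
      (W.constraints[g].left.card ≠ 1 ∧ (∃ s ∈ W.constraints[g].right, s ∈ V) ∧
        ¬ ∃ s ∈ W.constraints[g].left, s ∈ V))

def blockTest : Expr :=
  .add (.mul (.eq (.var aLeftSize) (.lit 1)) (.mul (.var aLeft) (.sub (.lit 1) (.var aRight))))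
    (.mul (.sub (.lit 1) (.eq (.var aLeftSize) (.lit 1)))
      (.mul (.var aRight) (.sub (.lit 1) (.var aLeft))))

theorem eval_blockTest (m : Memory) : blockTest.eval m ≠ 0 ↔
    (m aLeftSize 0 = 1 ∧ m aLeft 0 ≠ 0 ∧ ¬ m aRight 0 ≠ 0) ∨
    (m aLeftSize 0 ≠ 1 ∧ m aRight 0 ≠ 0 ∧ ¬ m aLeft 0 ≠ 0) := by
  have h1 : (Expr.eq (.var aLeftSize) (.lit 1)).eval m = if m aLeftSize 0 = 1 then 1 else 0 :=
    Expr.eval_eq m (.var aLeftSize) (.lit 1)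
  have h2 : ∀ a b : ℕ, a * (1 - b) ≠ 0 ↔ a ≠ 0 ∧ b = 0 := fun a b => by
    rw [mul_ne_zero_iff]
    omega
  simp only [blockTest, Expr.eval, h1, Expr.eval_var]
  split_ifs with h
  · simpa [h] using h2 (m aLeft 0) (m aRight 0)
  · simpa [h] using h2 (m aRight 0) (m aLeft 0)

theorem satisfied_iff_of_eq {S U : Type} {γ : EntailmentConstraint S U} (h : γ.rel = Eq) (π : S → U) :
    γ.Satisfied π ↔ ∃ s ∈ γ.left, ∃ t ∈ γ.right, π s = π t := by
  simp [EntailmentConstraint.Satisfied, h]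

/-- If one side is `{s}`, the constraint concerns a single fiber, the one containing `s`: it must
meet the other side. `IsType2` ensures that the right side is a singleton whenever the left one is
not. -/
theorem forall_blockEligible_iff {k n : ℕ} {W : Schema (Fin k) (Fin n)}
    (hrel : ∀ γ ∈ W.constraints, γ.rel = Eq) (htype : ∀ γ ∈ W.constraints, γ.IsType2)
    (π : Fin k → Fin n) :
    (∀ u, BlockEligible W (Finset.univ.filter fun s => π s = u)) ↔
      ∀ γ ∈ W.constraints, γ.Satisfied π := by
  simp only [List.forall_mem_iff_getElem]
  unfold BlockEligible
  rw [forall_comm]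
  refine forall_congr' fun g => ?_
  rw [forall_comm]
  refine forall_congr' fun hg => ?_
  have hmem := List.getElem_mem hg
  rw [satisfied_iff_of_eq (hrel _ hmem)]
  have ht := htype _ hmem
  generalize W.constraints[g] = γ at ht
  simp only [Finset.mem_filter, Finset.mem_univ, true_and]
  constructor
  · intro h
    by_cases h1 : γ.left.card = 1
    · obtain ⟨s, hs⟩ := Finset.card_eq_one.1 h1
      have hsl : s ∈ γ.left := by simp [hs]
      by_contra hno
      refine h (π s) (Or.inl ⟨h1, ⟨s, hsl, rfl⟩, ?_⟩)
      rintro ⟨t, ht, hts⟩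
      exact hno ⟨s, hsl, t, ht, hts.symm⟩
    · obtain ⟨t, ht⟩ := Finset.card_eq_one.1 (ht.resolve_left h1)
      have htr : t ∈ γ.right := by simp [ht]
      by_contra hno
      refine h (π t) (Or.inr ⟨h1, ⟨t, htr, rfl⟩, ?_⟩)
      rintro ⟨s, hs, hst⟩
      exact hno ⟨s, hs, t, htr, hst⟩
  · rintro ⟨s, hs, t, ht', hst⟩ u (⟨h1, ⟨s', hs', rfl⟩, hno⟩ | ⟨h1, ⟨t', ht'', rfl⟩, hno⟩)
    · obtain ⟨a, ha⟩ := Finset.card_eq_one.1 h1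
      rw [ha, Finset.mem_singleton] at hs hs'
      exact hno ⟨t, ht', by rw [← hst, hs, hs']⟩
    · obtain ⟨a, ha⟩ := Finset.card_eq_one.1 (ht.resolve_left h1)
      rw [ha, Finset.mem_singleton] at ht' ht''
      exact hno ⟨s, hs, by rw [hst, ht', ht'']⟩

theorem solvable_wsp2Eq :
    SolvableInSoftO WSP2Eq (fun I => 2 ^ I.k * (I.c + I.n ^ 2)) := by
  obtain ⟨C, hC⟩ := exists_exec_solve .steps blockTest
  refine ⟨C, 5, .solve .steps blockTest, ?_⟩
  rintro I ⟨hrel, htype⟩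
  have hE := I.encodes_initial
  have hz : ∀ a, a ≠ aIn → I.initial a = 0 := fun a => I.initial_of_ne
  unfold Instance.CorrectOutput
  simp only [Instance.c]
  -- Once the origin of the memory is forgotten, `k` and `n` can be replaced by the cells `d 0` and
  -- `d 1`, which avoids transport between types `Fin`.
  generalize I.initial = m at hE hz ⊢
  obtain ⟨k, n, W⟩ := I
  simp only at hE hrel htype ⊢
  generalize hd : m aIn = d at hE
  obtain rfl := hE.steps
  obtain rfl := hE.users
  rw [← hE.constraints]
  refine hC d W m (d 0) (fun _ _ a b z => (z = 1 ∧ a ≠ 0 ∧ ¬ b ≠ 0) ∨ (z ≠ 1 ∧ b ≠ 0 ∧ ¬ a ≠ 0))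
    (BlockEligible W) hE hd hz (by simp [Expr.steps, hd]) le_rfl ?_ (fun m _ _ => eval_blockTest m)
    ?_ ?_ ?_
  · intro h
    by_contra hk
    -- A step has an authorized user, so `n = 0` forces `k = 0`.
    obtain ⟨u, -⟩ := W.exists_auth ⟨0, Nat.pos_of_ne_zero hk⟩
    have := u.2
    nlinarith
  · intro x _
    rw [hE.constraints]
    refine forall_congr' fun g => forall_congr' fun hg => ?_
    rw [hE.leftSize_eq g hg, hE.leftCount_ne_zero_iff x g hg, hE.rightCount_ne_zero_iff x g hg]
    simp only [mem_maskSet]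
  · rintro π ⟨h₁, h₂⟩
    exact ⟨fun s => (allowed_zero_iff hE s _).1 (h₁ s),
      (forall_blockEligible_iff hrel htype π).1 h₂⟩
  · rintro π ⟨h₁, h₂⟩
    exact ⟨π, fun s => (allowed_zero_iff hE s _).2 (h₁ s),
      (forall_blockEligible_iff hrel htype π).2 h₂⟩

/-! ### Arbitrary constraints -/

/-- The set meets both sides of every constraint that it contains. -/
def WitnessEligible {k n K : ℕ} (W : Schema (Fin k) (Fin n)) (V : Finset (Fin K)) : Prop :=
  ∀ (g : ℕ) (hg : g < W.constraints.length), ¬ ((∃ i ∈ V, (i : ℕ) = k + g) ∧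
    ¬ ((∃ s ∈ W.constraints[g].left, ∃ i ∈ V, (i : ℕ) = s) ∧
      ∃ s ∈ W.constraints[g].right, ∃ i ∈ V, (i : ℕ) = s))

def witnessTest : Expr :=
  .mul (.digit (.var iCode) (.add .steps (.var iConstraint)))
    (.add (.sub (.lit 1) (.var aLeft)) (.sub (.lit 1) (.var aRight)))

theorem Ready.eval_witnessTest {d : ℕ → ℕ} {m : Memory} (hm : Ready d (d 0 + d 2) m)
    (hg : m iConstraint 0 < d 2) : witnessTest.eval m ≠ 0 ↔
      (m iCode 0).testBit (d 0 + m iConstraint 0) = true ∧ ¬ (m aLeft 0 ≠ 0 ∧ m aRight 0 ≠ 0) := by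
  have he : (Expr.add .steps (.var iConstraint)).eval m = d 0 + m iConstraint 0 := by
    simp [hm.eval_steps]
  rw [witnessTest, Expr.eval, mul_ne_zero_iff, hm.eval_digit _ _ (by rw [he]; omega), he]
  refine and_congr ?_ ?_
  · simp [Nat.testBit_eq_decide_div_mod_eq]
  · simp only [Expr.eval, Expr.eval_var]
    omega

theorem exists_mem_maskSet_iff {K x j : ℕ} (hx : x < 2 ^ K) :
    (∃ i ∈ maskSet K x, (i : ℕ) = j) ↔ x.testBit j = true := by
  constructor
  · rintro ⟨i, hi, rfl⟩
    exact mem_maskSet.1 hi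
  · exact fun h => ⟨⟨j, lt_of_testBit hx h⟩, mem_maskSet.2 h, rfl⟩

theorem solvable_wspEq :
    SolvableInSoftO WSPEq (fun I => 2 ^ (I.k + I.c) * (I.c + I.n ^ 2)) := by
  obtain ⟨C, hC⟩ := exists_exec_solve (.add .steps .constraints) witnessTest
  refine ⟨C, 5, .solve (.add .steps .constraints) witnessTest, ?_⟩
  intro I hrel
  have hE := I.encodes_initial
  have hz : ∀ a, a ≠ aIn → I.initial a = 0 := fun a => I.initial_of_ne
  unfold Instance.CorrectOutput
  simp only [Instance.c]
  generalize I.initial = m at hE hz ⊢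
  obtain ⟨k, n, W⟩ := I
  simp only [WSPEq] at hE hrel ⊢
  generalize hd : m aIn = d at hE
  obtain rfl := hE.steps
  obtain rfl := hE.users
  rw [← hE.constraints]
  refine hC d W m (d 0 + d 2) (fun x g a b _ => x.testBit (d 0 + g) = true ∧ ¬ (a ≠ 0 ∧ b ≠ 0))
    (WitnessEligible W) hE hd hz (by simp [Expr.steps, Expr.constraints, hd]) (Nat.le_add_right _ _)
    ?_ (fun m hm hg => hm.eval_witnessTest hg) ?_ ?_ ?_
  · intro h
    have h2 : d 2 = 0 := by omega
    rw [h2, add_zero]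
    by_contra hk
    obtain ⟨u, -⟩ := W.exists_auth ⟨0, Nat.pos_of_ne_zero hk⟩
    have := u.2
    nlinarith
  · intro x hx
    unfold WitnessEligible
    rw [hE.constraints] at hx ⊢
    refine forall_congr' fun g => forall_congr' fun hg => ?_
    simp only [hE.leftCount_ne_zero_iff x g hg, hE.rightCount_ne_zero_iff x g hg,
      exists_mem_maskSet_iff hx]
  · rintro π ⟨h₁, h₂⟩
    refine ⟨fun s => (allowed_zero_iff hE s _).1 (h₁ (Fin.castLE (Nat.le_add_right _ _) s)),
      List.forall_mem_iff_getElem.2 fun g hg => ?_⟩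
    rw [satisfied_iff_of_eq (hrel _ (List.getElem_mem hg))]
    have hg' : g < d 2 := hE.constraints ▸ hg
    -- The fiber containing the element of constraint `g` meets both sides, so a left and a right
    -- step share its user.
    have := h₂ (π ⟨d 0 + g, by omega⟩) g hg
    rw [not_and_not_right] at this
    obtain ⟨⟨s, hs, i, hi, his⟩, t, ht, j, hj, hjt⟩ := this ⟨⟨d 0 + g, by omega⟩, by simp, rfl⟩
    simp only [Finset.mem_filter, Finset.mem_univ, true_and] at hi hj
    obtain rfl : i = Fin.castLE (Nat.le_add_right _ _) s := Fin.ext his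
    obtain rfl : j = Fin.castLE (Nat.le_add_right _ _) t := Fin.ext hjt
    exact ⟨s, hs, t, ht, hi.trans hj.symm⟩
  · rintro π ⟨h₁, h₂⟩
    have hw : ∀ g : Fin (d 2), ∃ u, ∃ s ∈ (W.constraints[g]'(hE.constraints ▸ g.2)).left,
        ∃ t ∈ (W.constraints[g]'(hE.constraints ▸ g.2)).right, π s = u ∧ π t = u := by
      intro g
      have hmem := List.getElem_mem (l := W.constraints) (n := g) (hE.constraints ▸ g.2)
      obtain ⟨s, hs, t, ht, hst⟩ := (satisfied_iff_of_eq (hrel _ hmem) π).1 (h₂ _ hmem)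
      exact ⟨π s, s, hs, t, ht, rfl, hst.symm⟩
    choose w hw using hw
    -- The extra element of a constraint goes to the user shared by its two witnesses; authorization
    -- does not restrict it.
    refine ⟨Fin.append π w, fun i => ?_, fun u g hg => ?_⟩
    · refine Fin.addCases (fun s => ?_) (fun g => ?_) i
      · simpa using (allowed_zero_iff hE s _).2 (h₁ s)
      · exact ⟨fun h => by simp at h, Or.inl rfl⟩
    · rw [not_and_not_right]
      rintro ⟨i, hi, hig⟩
      have hg' : g < d 2 := hE.constraints ▸ hg
      obtain rfl : i = Fin.natAdd (d 0) ⟨g, hg'⟩ := Fin.ext hig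
      simp only [Finset.mem_filter, Finset.mem_univ, true_and, Fin.append_right] at hi ⊢
      obtain ⟨s, hs, t, ht, hsu, htu⟩ := hw ⟨g, hg'⟩
      refine ⟨⟨s, hs, Fin.castAdd _ s, ?_, rfl⟩, t, ht, Fin.castAdd _ t, ?_, rfl⟩
      · rw [Fin.append_left, hsu, hi]
      · rw [Fin.append_left, htu, hi]

/-! ### Reducing the number of constraints -/

/-- A step on both sides makes a constraint true for every plan, so only those with disjoint sides
matter. Without repetitions these inject into the maps from steps to `Fin 3`, since all relations
are equality. -/
theorem exists_sublist_constraints (I : Instance) (hI : WSPEq I) :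
    ∃ C : List (EntailmentConstraint (Fin I.k) (Fin I.n)),
      C.Sublist I.schema.constraints ∧ C.length ≤ 3 ^ I.k ∧
      ∀ π : Fin I.k → Fin I.n,
        I.schema.Valid π ↔ (I.schema.withConstraints C).Valid π := by
  classical
  set C := (I.schema.constraints.filter fun γ => Disjoint γ.left γ.right).dedup with hC
  have hsub : C.Sublist I.schema.constraints :=
    (List.dedup_sublist _).trans List.filter_sublist
  refine ⟨C, hsub, ?_, fun π => ?_⟩
  · let side : EntailmentConstraint (Fin I.k) (Fin I.n) → Fin I.k → Fin 3 := fun γ s =>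
      if s ∈ γ.left then 1 else if s ∈ γ.right then 2 else 0
    have hleft : ∀ γ s, s ∈ γ.left ↔ side γ s = 1 := by
      intro γ s
      simp only [side]
      split_ifs with h1 h2 <;> simp [h1]
    have hright : ∀ γ, Disjoint γ.left γ.right → ∀ s, s ∈ γ.right ↔ side γ s = 2 := by
      intro γ hγ s
      simp only [side]
      split_ifs with h1 h2
      · simpa using Finset.disjoint_left.1 hγ h1
      · simp [h2]
      · simp [h2]
    have hinj : Set.InjOn side {γ | γ ∈ C} := by
      intro γ hγ γ' hγ' h
      have h1 : γ.left = γ'.left := by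
        ext s
        rw [hleft, hleft, h]
      have hd : ∀ γ ∈ C, Disjoint γ.left γ.right := by
        intro γ hγ
        simpa using (List.mem_filter.1 (List.mem_dedup.1 hγ)).2
      have h2 : γ.right = γ'.right := by
        ext s
        rw [hright γ (hd γ hγ), hright γ' (hd γ' hγ'), h]
      have h3 : γ.rel = γ'.rel := by rw [hI γ (hsub.subset hγ), hI γ' (hsub.subset hγ')]
      cases γ
      cases γ'
      simp_all
    calc C.length = C.toFinset.card := (List.toFinset_card_of_nodup (List.nodup_dedup _)).symm
      _ ≤ Fintype.card (Fin I.k → Fin 3) :=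
        Finset.card_le_card_of_injOn side (by simp) (by simpa using hinj)
      _ = 3 ^ I.k := by simp
  · refine and_congr_right fun _ => ⟨fun h γ hγ => h γ (hsub.subset hγ), fun h γ hγ => ?_⟩
    by_cases hd : Disjoint γ.left γ.right
    · exact h γ (List.mem_dedup.2 (List.mem_filter.2 ⟨hγ, by simpa using hd⟩))
    · obtain ⟨s, hs, hs'⟩ := Finset.not_disjoint_iff.1 hd
      exact (satisfied_iff_of_eq (hI γ hγ) π).2 ⟨s, hs, s, hs', rfl⟩

/-! ### Enumerating the partitions of the set of steps -/

/-- A search for some `j` with `P j`, which sets the flag to `v` upon success. The conclusion has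
the same shape as the hypothesis on the body, so nested searches compose. -/
theorem Runs.forLoop_flag {L τ i N f v : ℕ} {e : Expr} {p : Program} {m : Memory} (P : ℕ → Prop)
    (hif : i ≠ f) (hi : i ∉ p.writes)
    (hN : ∀ m', AgreeOff (p.writes ++ [i]) m m' → e.eval m' = N) (hNL : N < 2 ^ L)
    (hstep : ∀ j m', j < N → AgreeOff (p.writes ++ [i]) m m' → m' i 0 = j →
      Runs L p m' τ fun m'' => (P j → m'' f 0 = v) ∧ (¬ P j → m'' f 0 = m' f 0)) :
    Runs L (.forLoop i e p) m (N * (τ + 2) + 2) fun m' =>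
      ((∃ j < N, P j) → m' f 0 = v) ∧ ((¬ ∃ j < N, P j) → m' f 0 = m f 0) := by
  refine Runs.forLoop (fun j m' => ((∃ x < j, P x) → m' f 0 = v) ∧ ((¬ ∃ x < j, P x) → m' f 0 = m f 0))
    hi hN hNL ?_ ?_ fun m' _ _ h => h
  · simp [hif.symm]
  · rintro j m' hj hf - hmj ⟨h₁, h₂⟩
    refine (hstep j m' hj hf hmj).conseq le_rfl ?_
    rintro m'' - - ⟨g₁, g₂⟩
    rw [Memory.write_of_ne _ _ _ hif.symm]
    by_cases hP : P j
    · exact ⟨fun _ => g₁ hP, fun h => absurd ⟨j, by omega, hP⟩ h⟩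
    · rw [g₂ hP]
      constructor
      · rintro ⟨x, hx, hPx⟩
        rcases Nat.lt_succ_iff_lt_or_eq.1 hx with h | rfl
        · exact h₁ ⟨x, h, hPx⟩
        · exact absurd hPx hP
      · exact fun h => h₂ fun ⟨x, hx, hPx⟩ => h ⟨x, by omega, hPx⟩

/-- The block of the step `s` in the partition coded by `q`. -/
def blockOf (k q s : ℕ) : ℕ := q / k ^ s % k

/-- Some step in the left set of constraint `g` shares its block with a step in the right set. -/
def BlockSatisfied (d : ℕ → ℕ) (q g : ℕ) : Prop :=
  ∃ s < d 0, ∃ t < d 0, inputLeft d g s ≠ 0 ∧ inputRight d g t ≠ 0 ∧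
    blockOf (d 0) q s = blockOf (d 0) q t

/-- The user `u` may perform all steps in the block `b`. -/
def BlockAllowed (d : ℕ → ℕ) (q b u : ℕ) : Prop :=
  ∀ s < d 0, blockOf (d 0) q s = b → inputAuth d s u ≠ 0

/-- Empty blocks are included: they accept any user, but a user has to exist. Different blocks may
have the same user. -/
def BlockFeasible (d : ℕ → ℕ) (q : ℕ) : Prop :=
  (∀ g < d 2, BlockSatisfied d q g) ∧ ∀ b < d 0, ∃ u < d 1, BlockAllowed d q b u

/-- Extracts the digits in base `k`. Here `aBasePow` holds powers of the number of steps, not of the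
counting base used in (1) and (2). -/
def Program.blocks : Program :=
  .forLoop iStep .steps (.store aAssign (.var iStep)
    (.mod (.div (.var iPlan) (.load aBasePow (.var iStep))) .steps))

/-- The input is in place, and the partition `q` is stored. -/
structure Partitioned (d : ℕ → ℕ) (q : ℕ) (m : Memory) : Prop where
  input : m aIn = d
  assign : ∀ s < d 0, m aAssign s = blockOf (d 0) q s

theorem Partitioned.of_agree {d : ℕ → ℕ} {q : ℕ} {m m' : Memory} {w : List ℕ}
    (h : Partitioned d q m) (hf : AgreeOff w m m') (hw : aIn ∉ w ∧ aAssign ∉ w) :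
    Partitioned d q m' where
  input := by rw [hf _ hw.1, h.input]
  assign := by rw [hf _ hw.2]; exact h.assign

theorem blocks_spec {L : ℕ} {d : ℕ → ℕ} {m : Memory} (hin : m aIn = d)
    (hpow : ∀ j ≤ d 0, m aBasePow j = d 0 ^ j) (hkL : d 0 < 2 ^ L) :
    Runs L .blocks m (d 0 * 3 + 2) (Partitioned d (m iPlan 0)) := by
  refine Runs.forLoop (τ := 1) (N := d 0)
    (fun j m' => ∀ s < j, m' aAssign s = blockOf (d 0) (m iPlan 0) s)
    (by simp) ?_ hkL (by simp) ?_ fun m' hf _ h => ⟨by rw [hf 0 (by simp), hin], h⟩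
  · exact fun m' hf => Expr.eval_steps (by rw [hf 0 (by simp), hin])
  · intro j m' hj hf _ hmj hI
    have hin' : m' aIn = d := by rw [hf 0 (by simp), hin]
    have hv : (Expr.mod (.div (.var iPlan) (.load aBasePow (.var iStep))) .steps).eval m' =
        blockOf (d 0) (m iPlan 0) j := by
      rw [Expr.eval_mod, Expr.eval_steps hin']
      simp [hmj, hf 5, hf 32, hpow j hj.le, blockOf]
    refine Runs.store ?_ ?_
    · rw [hv]
      exact (Nat.mod_lt _ (by omega)).trans hkL
    · rw [hv]
      intro s hs
      rcases Nat.lt_succ_iff_lt_or_eq.1 hs with h | rfl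
      · have hne : s ≠ j := by omega
        simp [hmj, hne, hI s h]
      · simp [hmj]

/-- Clears the flag if some constraint is violated by the partition. -/
def Program.checkConstraints : Program :=
  .forLoop iConstraint .constraints (
    .store aMeets (.lit 0) (.lit 0) ;;
    .forLoop iStep .steps (.forLoop iOther .steps
      (.branch (.mul (.leftSet (.var iConstraint) (.var iStep))
          (.mul (.rightSet (.var iConstraint) (.var iOther))
            (.eq (.load aAssign (.var iStep)) (.load aAssign (.var iOther)))))
        (.store aMeets (.lit 0) (.lit 1)) .skip)) ;;
    .branch (.var aMeets) .skip (.store aFlag (.lit 0) (.lit 0)))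

theorem checkConstraints_spec {L q : ℕ} {d : ℕ → ℕ} {m : Memory} (hm : Partitioned d q m)
    (hL : 1 < 2 ^ L) (hkL : d 0 < 2 ^ L) (hcL : d 2 < 2 ^ L) :
    Runs L .checkConstraints m (d 2 * (d 0 * (d 0 * 4 + 4) + 7) + 2) fun m' =>
      ((∃ g < d 2, ¬ BlockSatisfied d q g) → m' aFlag 0 = 0) ∧
      ((¬ ∃ g < d 2, ¬ BlockSatisfied d q g) → m' aFlag 0 = m aFlag 0) := by
  refine (Runs.forLoop_flag (τ := 1 + ((d 0 * ((d 0 * ((1 + 1) + 2) + 2) + 2) + 2) + (1 + 1)))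
    (fun g => ¬ BlockSatisfied d q g) (by norm_num) (by simp) ?_ hcL ?_).mono (by ring_nf; omega)
  · exact fun m' hf => Expr.eval_constraints (by rw [hf 0 (by simp), hm.input])
  · intro g m' hg hf hmg
    refine Runs.store_seq (by simp) ?_
    simp only [Expr.eval]
    set m₁ := m'.write aMeets 0 0 with hm₁'
    have hm₁ : Partitioned d q m₁ := by
      refine (hm.of_agree hf (by simp)).of_agree (w := [aMeets]) (fun a ha => ?_) (by simp)
      exact Memory.write_of_ne _ _ _ (by simpa using ha)
    refine Runs.seq (Runs.forLoop_flag (f := aMeets) (v := 1) (fun s => ∃ t < d 0, inputLeft d g s ≠ 0 ∧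
      inputRight d g t ≠ 0 ∧ blockOf (d 0) q s = blockOf (d 0) q t)
      (by norm_num) (by simp) ?_ hkL ?_) fun m₂ hf₂ _ hI₂ => ?_
    · exact fun m' hf => Expr.eval_steps (by rw [hf 0 (by simp), hm₁.input])
    · intro s m₂ hs hf₂ hms
      have hm₂ : Partitioned d q m₂ := hm₁.of_agree hf₂ (by simp)
      refine Runs.forLoop_flag (fun t => inputLeft d g s ≠ 0 ∧
        inputRight d g t ≠ 0 ∧ blockOf (d 0) q s = blockOf (d 0) q t)
        (by norm_num) (by simp) ?_ hkL ?_
      · exact fun m' hf => Expr.eval_steps (by rw [hf 0 (by simp), hm₂.input])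
      · intro t m₃ ht hf₃ hmt
        have hm₃ : Partitioned d q m₃ := hm₂.of_agree hf₃ (by simp)
        have hms₃ : m₃ iStep 0 = s := by rw [hf₃ 20 (by simp), hms]
        have hmg₃ : m₃ iConstraint 0 = g := by
          rw [hf₃ 23 (by simp), hf₂ 23 (by simp), hm₁', Memory.write_of_ne _ _ _ (by norm_num), hmg]
        have htest : (Expr.mul (.leftSet (.var iConstraint) (.var iStep))
            (.mul (.rightSet (.var iConstraint) (.var iOther))
              (.eq (.load aAssign (.var iStep)) (.load aAssign (.var iOther))))).eval m₃ ≠ 0 ↔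
            inputLeft d g s ≠ 0 ∧ inputRight d g t ≠ 0 ∧ blockOf (d 0) q s = blockOf (d 0) q t := by
          rw [Expr.eval, Expr.eval, mul_ne_zero_iff, mul_ne_zero_iff, Expr.eval_leftSet hm₃.input,
            Expr.eval_rightSet hm₃.input, Expr.eval_eq]
          simp [hms₃, hmg₃, hmt, hm₃.assign s hs, hm₃.assign t ht]
        refine Runs.branch (fun h => Runs.store (by simpa using hL) ?_) fun h => Runs.skip ?_
        · exact ⟨fun _ => by simp, fun h' => absurd (htest.1 h) h'⟩
        · exact ⟨fun h' => absurd h (htest.2 h'), fun _ => rfl⟩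
    · have hF₂ : m₂ aFlag 0 = m' aFlag 0 := by
        rw [hf₂ 7 (by simp), hm₁', Memory.write_of_ne _ _ _ (by norm_num)]
      have hM₁ : m₁ aMeets 0 = 0 := by simp [hm₁']
      rw [hM₁] at hI₂
      refine Runs.branch (fun h => Runs.skip ⟨fun h' => ?_, fun _ => hF₂⟩) fun h =>
        Runs.store (by simp) ⟨fun _ => by simp, fun h' => ?_⟩
      · exact absurd (hI₂.2 h') h
      · have := hI₂.1 (not_not.1 h')
        simp [this] at h

/-- Finds a common user for every block, and clears the flag if there is none. -/
def Program.findUsers : Program :=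
  .forLoop iBlock .steps (
    .store aFound (.lit 0) (.lit 0) ;;
    .forLoop iUser .users (
      .store aCommon (.lit 0) (.lit 1) ;;
      .forLoop iStep .steps
        (.branch (.mul (.eq (.load aAssign (.var iStep)) (.var iBlock))
            (.sub (.lit 1) (.auth (.var iStep) (.var iUser))))
          (.store aCommon (.lit 0) (.lit 0)) .skip) ;;
      .branch (.var aCommon) (.store aFound (.lit 0) (.add (.var iUser) (.lit 1))) .skip) ;;
    .store aBlockUser (.var iBlock) (.sub (.var aFound) (.lit 1)) ;;
    .branch (.var aFound) .skip (.store aFlag (.lit 0) (.lit 0)))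

/-- The flag may have been cleared before, so both implications are relative to its old value; a
flag that survives certifies the table of block users. -/
theorem findUsers_spec {L q : ℕ} {d : ℕ → ℕ} {m : Memory} (hm : Partitioned d q m)
    (hL : 1 < 2 ^ L) (hkL : d 0 < 2 ^ L) (hnL : d 1 < 2 ^ L) :
    Runs L .findUsers m (d 0 * (d 1 * (d 0 * 4 + 7) + 8) + 2) fun m' =>
      ((∀ b < d 0, ∃ u < d 1, BlockAllowed d q b u) → m' aFlag 0 = m aFlag 0) ∧
      (m' aFlag 0 ≠ 0 → m aFlag 0 ≠ 0 ∧
        ∀ b < d 0, m' aBlockUser b < d 1 ∧ BlockAllowed d q b (m' aBlockUser b)) := by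
  refine (Runs.forLoop (τ := 1 + ((d 1 * ((1 + ((d 0 * ((1 + 1) + 2) + 2) + (1 + 1))) + 2) + 2)
      + (1 + (1 + 1)))) (N := d 0)
    (fun j m' => ((∀ b < j, ∃ u < d 1, BlockAllowed d q b u) → m' aFlag 0 = m aFlag 0) ∧
      (m' aFlag 0 ≠ 0 → m aFlag 0 ≠ 0 ∧
        ∀ b < j, m' aBlockUser b < d 1 ∧ BlockAllowed d q b (m' aBlockUser b)))
    (by simp) ?_ hkL (by simp) ?_ fun m' _ _ h => h).mono (by ring_nf; omega)
  · exact fun m' hf => Expr.eval_steps (by rw [hf 0 (by simp), hm.input])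
  · intro b m' hb hf _ hmb hI
    refine Runs.store_seq (by simp) ?_
    simp only [Expr.eval]
    set m₁ := m'.write aFound 0 0 with hm₁'
    have hm₁ : Partitioned d q m₁ := by
      refine (hm.of_agree hf (by simp)).of_agree (w := [aFound]) (fun a ha => ?_) (by simp)
      exact Memory.write_of_ne _ _ _ (by simpa using ha)
    -- `aFound` holds the number of the user plus one, so that `0` means that none was found; a
    -- later success replaces an earlier one.
    refine Runs.seq (R := fun m₂ => (m₂ aFound 0 = 0 ∧ ∀ u < d 1, ¬ BlockAllowed d q b u) ∨
      ∃ u < d 1, BlockAllowed d q b u ∧ m₂ aFound 0 = u + 1)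
      (Runs.forLoop (N := d 1) (fun j m₂ => (m₂ aFound 0 = 0 ∧ ∀ u < j, ¬ BlockAllowed d q b u) ∨
        ∃ u < d 1, BlockAllowed d q b u ∧ m₂ aFound 0 = u + 1)
        (by simp) ?_ hnL (by simp [hm₁']) ?_ fun m' _ _ h => h) fun m₂ hf₂ hb₂ hI₂ => ?_
    · exact fun m' hf => Expr.eval_users (by rw [hf 0 (by simp), hm₁.input])
    · intro u m₂ hu hf₂ _ hmu hI₂
      refine Runs.store_seq (by simpa using hL) ?_
      simp only [Expr.eval]
      set m₃ := m₂.write aCommon 0 1 with hm₃'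
      have hm₃ : Partitioned d q m₃ := by
        refine (hm₁.of_agree hf₂ (by simp)).of_agree (w := [aCommon]) (fun a ha => ?_) (by simp)
        exact Memory.write_of_ne _ _ _ (by simpa using ha)
      have hb₃ : m₃ iBlock 0 = b := by
        rw [hm₃', Memory.write_of_ne _ _ _ (by norm_num), hf₂ 34 (by simp), hm₁',
          Memory.write_of_ne _ _ _ (by norm_num), hmb]
      have hu₃ : m₃ iUser 0 = u := by rw [hm₃', Memory.write_of_ne _ _ _ (by norm_num), hmu]
      refine Runs.seq (Runs.forLoop_flag (f := aCommon) (v := 0)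
        (fun s => blockOf (d 0) q s = b ∧ ¬ inputAuth d s u ≠ 0)
        (by norm_num) (by simp) ?_ hkL ?_) fun m₄ hf₄ _ hI₄ => ?_
      · exact fun m' hf => Expr.eval_steps (by rw [hf 0 (by simp), hm₃.input])
      · intro s m₄ hs hf₄ hms
        have hm₄ : Partitioned d q m₄ := hm₃.of_agree hf₄ (by simp)
        have htest : (Expr.mul (.eq (.load aAssign (.var iStep)) (.var iBlock))
            (.sub (.lit 1) (.auth (.var iStep) (.var iUser)))).eval m₄ ≠ 0 ↔
            blockOf (d 0) q s = b ∧ ¬ inputAuth d s u ≠ 0 := by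
          have ha := Expr.eval_auth hm₄.input (.var iStep) (.var iUser)
          rw [Expr.eval, mul_ne_zero_iff, Expr.eval_eq]
          have h34 : m₄ iBlock 0 = b := by rw [hf₄ 34 (by simp), hb₃]
          have h22 : m₄ iUser 0 = u := by rw [hf₄ 22 (by simp), hu₃]
          simp only [Expr.eval, ha, Expr.eval_var, hms, h34, h22, hm₄.assign s hs]
          refine and_congr (by simp) (by omega)
        refine Runs.branch (fun h => Runs.store (by simp) ?_) fun h => Runs.skip ?_
        · exact ⟨fun _ => by simp, fun h' => absurd (htest.1 h) h'⟩
        · exact ⟨fun h' => absurd h (htest.2 h'), fun _ => rfl⟩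
      · have hu₄ : m₄ iUser 0 = u := by rw [hf₄ 22 (by simp), hu₃]
        have hF₄ : m₄ aFound 0 = m₂ aFound 0 := by
          rw [hf₄ 30 (by simp), hm₃', Memory.write_of_ne _ _ _ (by norm_num)]
        have hC₃ : m₃ aCommon 0 = 1 := by simp [hm₃']
        rw [hC₃] at hI₄
        have hall : BlockAllowed d q b u ↔
            ¬ ∃ s < d 0, blockOf (d 0) q s = b ∧ ¬ inputAuth d s u ≠ 0 := by
          unfold BlockAllowed
          push Not
          rfl
        refine Runs.branch (fun h => Runs.store (by simp [hu₄]; omega) ?_) fun h => Runs.skip ?_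
        · refine Or.inr ⟨u, hu, hall.2 fun h' => h (hI₄.1 h'), ?_⟩
          simp [hu₄]
        · have hno : ¬ BlockAllowed d q b u := fun h' => by
            have := hI₄.2 (hall.1 h')
            simp [this] at h
          rw [Memory.write_of_ne _ _ _ (by norm_num), hF₄]
          rcases hI₂ with ⟨h₁, h₂⟩ | h₁
          · refine Or.inl ⟨h₁, fun v hv => ?_⟩
            rcases Nat.lt_succ_iff_lt_or_eq.1 hv with h3 | rfl
            · exact h₂ v h3
            · exact hno
          · exact Or.inr h₁
    · have hb' : m₂ iBlock 0 = b := by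
        rw [hf₂ 34 (by simp), hm₁', Memory.write_of_ne _ _ _ (by norm_num), hmb]
      have hF' : m₂ aFlag 0 = m' aFlag 0 := by
        rw [hf₂ 7 (by simp), hm₁', Memory.write_of_ne _ _ _ (by norm_num)]
      have hU' : m₂ aBlockUser = m' aBlockUser := by
        rw [hf₂ 28 (by simp), hm₁', Memory.write_of_ne _ _ _ (by norm_num)]
      -- If no user was found, truncation stores `0` as the block user; this is harmless, as the
      -- flag is then cleared.
      refine Runs.store_seq ?_ ?_
      · simp only [Expr.eval, Expr.eval_var]
        exact lt_of_le_of_lt (Nat.sub_le _ _) (hb₂ _ _)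
      simp only [Expr.eval, Expr.eval_var, hb']
      refine Runs.branch (fun h => Runs.skip ?_) fun h => Runs.store (by simp) ?_
      · have hne : m₂ aFound 0 ≠ 0 := by simpa using h
        obtain ⟨u, hu, hall, hv⟩ := hI₂.resolve_left fun h' => hne h'.1
        simp only [Memory.write_of_ne _ _ _ (show aFlag ≠ iBlock by norm_num),
          Memory.write_of_ne _ _ _ (show aFlag ≠ aBlockUser by norm_num),
          Memory.write_of_ne _ _ _ (show aBlockUser ≠ iBlock by norm_num), Memory.write_same,
          hF', hU', hv, Nat.add_sub_cancel]
        refine ⟨fun h' => hI.1 fun b' hb' => h' b' (by omega), fun h' => ⟨(hI.2 h').1, ?_⟩⟩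
        intro b' hb'
        rcases Nat.lt_succ_iff_lt_or_eq.1 hb' with h3 | rfl
        · have hne' : b' ≠ b := by omega
          simpa [hne'] using (hI.2 h').2 b' h3
        · simpa using ⟨hu, hall⟩
      · have h0 : m₂ aFound 0 = 0 := by simpa using h
        have hno : ∀ u < d 1, ¬ BlockAllowed d q b u := by
          rcases hI₂ with h' | ⟨u, -, -, h'⟩
          · exact h'.2
          · omega
        constructor
        · intro h'
          obtain ⟨u, hu, hu'⟩ := h' b (by omega)
          exact absurd hu' (hno u hu)
        · simp

/-! ### Fixed-parameter tractability -/

/-- Writes the plan given by the users of the blocks to the output. -/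
def Program.writePlan : Program :=
  .store aOut (.lit 0) (.lit 1) ;;
  .forLoop iStep .steps (.store aOut (.add (.var iStep) (.lit 1))
    (.load aBlockUser (.load aAssign (.var iStep))))

theorem writePlan_spec {L q : ℕ} {d : ℕ → ℕ} {m : Memory} (hm : Partitioned d q m)
    (hb : m.Bounded L) (hL : 1 < 2 ^ L) (hkL : d 0 < 2 ^ L) :
    Runs L .writePlan m (d 0 * 3 + 3) fun m' => m' aOut 0 = 1 ∧
      ∀ s < d 0, m' aOut (s + 1) = m aBlockUser (blockOf (d 0) q s) := by
  refine (Runs.store_seq (by simpa using hL) (Runs.forLoop (τ := 1) (N := d 0)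
    (fun j m' => m' aOut 0 = 1 ∧ ∀ s < j, m' aOut (s + 1) = m aBlockUser (blockOf (d 0) q s))
    (by simp) ?_ hkL (by simp) ?_ fun m' _ _ h => h)).mono (by ring_nf; omega)
  · exact fun m' hf => Expr.eval_steps (by rw [hf 0 (by simp)]; simp [hm.input])
  · intro j m' hj hf _ hmj ⟨h₁, h₂⟩
    have hv : (Expr.load aBlockUser (.load aAssign (.var iStep))).eval m' =
        m aBlockUser (blockOf (d 0) q j) := by
      simp [hmj, hf 28, hf 27, hm.assign j hj]
    refine Runs.store (by rw [hv]; exact hb _ _) ?_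
    rw [hv]
    refine ⟨by simp [hmj, h₁], fun s hs => ?_⟩
    rcases Nat.lt_succ_iff_lt_or_eq.1 hs with h3 | rfl
    · have hne : s ≠ j := by omega
      simp [hmj, hne, h₂ s h3]
    · simp [hmj]

/-- Tests the current partition, and writes a plan if the test succeeds. -/
def Program.tryPartition : Program :=
  .blocks ;; .store aFlag (.lit 0) (.lit 1) ;; .checkConstraints ;; .findUsers ;;
    .branch (.var aFlag) .writePlan .skip

def tryPartitionSteps (k n c : ℕ) : ℕ :=
  (k * 3 + 2) + (1 + ((c * (k * (k * 4 + 4) + 7) + 2) + ((k * (n * (k * 4 + 7) + 8) + 2) +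
    (1 + (k * 3 + 3)))))

theorem tryPartition_spec {L : ℕ} {d : ℕ → ℕ} {m : Memory} (hin : m aIn = d)
    (hpow : ∀ j ≤ d 0, m aBasePow j = d 0 ^ j)
    (hL : 1 < 2 ^ L) (hkL : d 0 < 2 ^ L) (hnL : d 1 < 2 ^ L) (hcL : d 2 < 2 ^ L) :
    Runs L .tryPartition m (tryPartitionSteps (d 0) (d 1) (d 2)) fun m' =>
      (m' aOut 0 = m aOut 0 ∧ (∀ s, m' aOut (s + 1) = m aOut (s + 1)) ∧
        ¬ BlockFeasible d (m iPlan 0)) ∨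
      (m' aOut 0 = 1 ∧ (∀ g < d 2, BlockSatisfied d (m iPlan 0) g) ∧ ∃ w : ℕ → ℕ,
        (∀ b < d 0, w b < d 1 ∧ BlockAllowed d (m iPlan 0) b (w b)) ∧
        ∀ s < d 0, m' aOut (s + 1) = w (blockOf (d 0) (m iPlan 0) s)) := by
  refine Runs.seq (blocks_spec hin hpow hkL) fun m₁ hf₁ _ hm₁ => ?_
  refine Runs.store_seq (by simpa using hL) ?_
  simp only [Expr.eval]
  set m₂ := m₁.write aFlag 0 1 with hm₂'
  have hm₂ : Partitioned d (m iPlan 0) m₂ :=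
    hm₁.of_agree (w := [aFlag]) (fun a ha => Memory.write_of_ne _ _ _ (by simpa using ha)) (by simp)
  refine Runs.seq (checkConstraints_spec hm₂ hL hkL hcL) fun m₃ hf₃ _ hI₃ => ?_
  have hm₃ := hm₂.of_agree hf₃ (by simp [Program.checkConstraints])
  refine Runs.seq (findUsers_spec hm₃ hL hkL hnL) fun m₄ hf₄ hb₄ hI₄ => ?_
  have hm₄ := hm₃.of_agree hf₄ (by simp [Program.findUsers])
  have hF₂ : m₂ aFlag 0 = 1 := by simp [hm₂']
  have hO : m₄ aOut = m aOut := by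
    rw [hf₄ 1 (by simp [Program.findUsers]), hf₃ 1 (by simp [Program.checkConstraints]), hm₂',
      Memory.write_of_ne _ _ _ (by norm_num), hf₁ 1 (by simp [Program.blocks])]
  rw [hF₂] at hI₃
  refine Runs.branch (fun h => ?_) fun h => ?_
  · have hne : m₄ aFlag 0 ≠ 0 := h
    obtain ⟨h₃, hw⟩ := hI₄.2 hne
    have hsat : ∀ g < d 2, BlockSatisfied d (m iPlan 0) g := by
      by_contra hno
      push Not at hno
      exact h₃ (hI₃.1 hno)
    refine (writePlan_spec hm₄ hb₄ hL hkL).conseq le_rfl ?_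
    rintro m₅ - - ⟨g₁, g₂⟩
    exact Or.inr ⟨g₁, hsat, m₄ aBlockUser, hw, g₂⟩
  · refine (Runs.skip (Or.inl ⟨by rw [hO], fun s => by rw [hO], ?_⟩)).mono (by omega)
    rintro ⟨g₁, g₂⟩
    have e₁ := hI₃.2 (by push Not; exact g₁)
    have e₂ := hI₄.1 g₂
    simp only [Expr.eval_var] at h
    omega

/-- Tries all partitions of the set of steps. -/
def Program.tryAll : Program :=
  .powers iStep aBasePow .steps .steps ;;
    .forLoop iPlan (.load aBasePow .steps) .tryPartition

/-- There is no early exit. A later success overwrites the whole plan and a failure leaves the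
output alone, so the output always belongs to a single partition. -/
theorem tryAll_spec {L : ℕ} {d : ℕ → ℕ} {m : Memory} (hin : m aIn = d) (hk : 0 < d 0)
    (hkL : d 0 ^ d 0 < 2 ^ L) (hL : 1 < 2 ^ L) (hnL : d 1 < 2 ^ L) (hcL : d 2 < 2 ^ L)
    (hout : m aOut 0 = 0) :
    Runs L .tryAll m
      ((d 0 * 3 + 3) + (d 0 ^ d 0 * (tryPartitionSteps (d 0) (d 1) (d 2) + 2) + 2)) fun m' =>
      (m' aOut 0 = 0 ∧ ∀ q < d 0 ^ d 0, ¬ BlockFeasible d q) ∨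
      (m' aOut 0 = 1 ∧ ∃ q, (∀ g < d 2, BlockSatisfied d q g) ∧ ∃ w : ℕ → ℕ,
        (∀ b < d 0, w b < d 1 ∧ BlockAllowed d q b (w b)) ∧
        ∀ s < d 0, m' aOut (s + 1) = w (blockOf (d 0) q s)) := by
  have hkL' : d 0 < 2 ^ L := by
    refine lt_of_le_of_lt ?_ hkL
    calc d 0 = d 0 ^ 1 := (pow_one _).symm
      _ ≤ _ := Nat.pow_le_pow_right hk hk
  refine Runs.seq (powers_spec (b := d 0) (N := d 0) (by norm_num) ?_ ?_ ?_ hkL')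
    fun m₁ hf₁ _ hI₁ => ?_
  · exact fun m' hf => Expr.eval_steps (by rw [hf 0 (by simp), hin])
  · exact fun m' hf => Expr.eval_steps (by rw [hf 0 (by simp), hin])
  · exact fun j hj => (Nat.pow_le_pow_right hk hj).trans_lt hkL
  have hw : ∀ a ∈ [aIn, aBasePow, iPlan], a ∉ Program.tryPartition.writes := by
    simp [Program.tryPartition, Program.blocks, Program.checkConstraints, Program.findUsers,
      Program.writePlan]
  have hin₁ : m₁ aIn = d := by rw [hf₁ 0 (by simp [Program.powers]), hin]
  have hout₁ : m₁ aOut 0 = 0 := by rw [hf₁ 1 (by simp [Program.powers]), hout]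
  refine Runs.forLoop (fun j m' =>
      (m' aOut 0 = 0 ∧ ∀ q < j, ¬ BlockFeasible d q) ∨
      (m' aOut 0 = 1 ∧ ∃ q, (∀ g < d 2, BlockSatisfied d q g) ∧ ∃ w : ℕ → ℕ,
        (∀ b < d 0, w b < d 1 ∧ BlockAllowed d q b (w b)) ∧
        ∀ s < d 0, m' aOut (s + 1) = w (blockOf (d 0) q s)))
    (hw _ (by simp)) ?_ hkL ?_ ?_ fun m' _ _ h => h
  · intro m' hf
    have hin' : m' aIn = d := by rw [hf 0 (by simp [hw]), hin₁]
    simp [Expr.eval_steps hin', hf 5 (by simp [hw]), hI₁ (d 0) le_rfl]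
  · rw [Memory.write_of_ne _ _ _ (by norm_num)]
    exact Or.inl ⟨hout₁, by simp⟩
  · intro j m' hj hf _ hmj hI
    have hin' : m' aIn = d := by rw [hf 0 (by simp [hw]), hin₁]
    refine (tryPartition_spec hin' (by rw [hf 5 (by simp [hw])]; exact hI₁) hL hkL' hnL hcL).conseq
      le_rfl ?_
    rintro m'' - - h
    rw [Memory.write_of_ne _ _ _ (by norm_num)]
    rw [hmj] at h
    rcases h with ⟨g₁, g₂, g₃⟩ | ⟨g₁, g₂⟩
    · rw [g₁]
      rcases hI with ⟨h₁, h₂⟩ | ⟨h₁, q, h₂, w, h₃, h₄⟩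
      · refine Or.inl ⟨h₁, fun q hq => ?_⟩
        rcases Nat.lt_succ_iff_lt_or_eq.1 hq with h3 | rfl
        · exact h₂ q h3
        · exact g₃
      · exact Or.inr ⟨h₁, q, h₂, w, h₃, fun s hs => by rw [g₂, h₄ s hs]⟩
    · exact Or.inr ⟨g₁, j, g₂⟩

/-! ### Feasible partitions and valid plans -/

/-- Each step is labeled by a representative of the steps with the same user. A label `b` is thus
itself a step, and `π b` is a common user for block `b`; the same choice serves the empty blocks. -/
theorem exists_blockFeasible_of_valid {d : ℕ → ℕ} {W : Schema (Fin (d 0)) (Fin (d 1))}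
    (hE : Encodes d W) (hrel : ∀ γ ∈ W.constraints, γ.rel = Eq)
    {π : Fin (d 0) → Fin (d 1)} (hπ : W.Valid π) : ∃ q < d 0 ^ d 0, BlockFeasible d q := by
  classical
  have hex : ∀ s, ∃ t, π t = π s := fun s => ⟨s, rfl⟩
  let rep : Fin (d 0) → Fin (d 0) := fun s => (hex s).choose
  have hrep : ∀ s, π (rep s) = π s := fun s => (hex s).choose_spec
  have hrep' : ∀ s t, π s = π t → rep s = rep t := by
    -- The choice of a representative depends on `s` only through `π s`.
    intro s t h
    simp only [rep, h]
  -- `finFunctionFinEquiv` codes a function by its values as base `k` digits, which is how `blockOf`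
  -- decodes.
  have hq : ∀ s : Fin (d 0), blockOf (d 0) (finFunctionFinEquiv rep) s = rep s := by
    intro s
    have h1 := congrFun (finFunctionFinEquiv.symm_apply_apply rep) s
    have h2 := congrArg Fin.val h1
    rw [← h2, finFunctionFinEquiv_symm_apply_val]
    rfl
  refine ⟨finFunctionFinEquiv rep, (finFunctionFinEquiv rep).2, fun g hg => ?_, fun b hb => ?_⟩
  · rw [hE.constraints] at hg
    have hmem := List.getElem_mem hg
    obtain ⟨s, hs, t, ht, hst⟩ := (satisfied_iff_of_eq (hrel _ hmem) π).1 (hπ.2 _ hmem)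
    refine ⟨s, s.2, t, t.2, ?_, ?_, ?_⟩
    · rw [hE.left g hg s]
      exact bit_ne_zero_iff.2 hs
    · rw [hE.right g hg t]
      exact bit_ne_zero_iff.2 ht
    · rw [hq, hq, hrep' s t hst]
  · refine ⟨π ⟨b, hb⟩, (π ⟨b, hb⟩).2, fun s hs hsb => ?_⟩
    have h1 := hq ⟨s, hs⟩
    simp only at h1
    have h2 : rep ⟨s, hs⟩ = ⟨b, hb⟩ := Fin.ext (by rw [← h1, hsb])
    have h3 := hE.auth ⟨s, hs⟩ (π ⟨b, hb⟩)
    simp only at h3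
    rw [h3, ← h2, hrep]
    exact bit_ne_zero_iff.2 (hπ.1 _)

theorem blockOf_lt {k : ℕ} (hk : 0 < k) (q s : ℕ) : blockOf k q s < k := Nat.mod_lt _ hk

/-- Giving several blocks the same user only creates further equalities, and these cannot violate an
equality constraint. -/
theorem valid_of_blocks {d : ℕ → ℕ} {W : Schema (Fin (d 0)) (Fin (d 1))}
    (hE : Encodes d W) (hk : 0 < d 0) (hrel : ∀ γ ∈ W.constraints, γ.rel = Eq) {q : ℕ}
    (hsat : ∀ g < d 2, BlockSatisfied d q g) {w : ℕ → ℕ}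
    (hw : ∀ b < d 0, w b < d 1 ∧ BlockAllowed d q b (w b)) :
    W.Valid fun s => ⟨w (blockOf (d 0) q s), (hw _ (blockOf_lt hk _ _)).1⟩ := by
  refine ⟨fun s => ?_, List.forall_mem_iff_getElem.2 fun g hg => ?_⟩
  · refine bit_ne_zero_iff.1 ?_
    rw [← hE.auth]
    exact (hw _ (blockOf_lt hk _ _)).2 s s.2 rfl
  · rw [satisfied_iff_of_eq (hrel _ (List.getElem_mem hg))]
    obtain ⟨s, hs, t, ht, h₁, h₂, h₃⟩ := hsat g (hE.constraints ▸ hg)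
    have e₁ := hE.left g hg ⟨s, hs⟩
    have e₂ := hE.right g hg ⟨t, ht⟩
    simp only at e₁ e₂
    rw [e₁, bit_ne_zero_iff] at h₁
    rw [e₂, bit_ne_zero_iff] at h₂
    exact ⟨_, h₁, _, h₂, Fin.ext (by simp [h₃])⟩

/-- Without steps, the plan is empty, and it is valid if and only if there are no constraints. -/
def Program.fpt : Program :=
  .branch .steps .tryAll
    (.branch .constraints .skip (.store aOut (.lit 0) (.lit 1)))

/-! ### Input size and running time -/

theorem sum_size_add_one_ge (l : List ℕ) : l.length ≤ (l.map fun v => v.size + 1).sum := by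
  induction l with
  | nil => simp
  | cons a l ih =>
    simp only [List.length_cons, List.map_cons, List.sum_cons]
    omega

theorem length_encode (I : Instance) :
    I.encode.length = 3 + I.k * I.k + I.k * I.n + I.c * (2 * I.k) := by
  unfold Instance.encode
  simp only [List.length_append]
  rw [length_flatMap_of_length _ _ I.k (by simp), length_flatMap_of_length _ _ I.n (by simp),
    length_flatMap_of_length _ _ (2 * I.k) (by simp; omega)]
  simp [Instance.c]

/-- With at least one step, the tables have at least `k`, `n` and `c` entries, and each entry counts
in the input size. For `k = 0` the tables are empty and only the binary lengths of `n` and `c` are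
bounded, as in `size_le_inputSize`. -/
theorem le_inputSize_of_pos (I : Instance) (hk : 0 < I.k) : I.k + I.n + I.c + 3 ≤ I.inputSize := by
  have h1 := sum_size_add_one_ge I.encode
  rw [length_encode] at h1
  have h2 : I.k ≤ I.k * I.k := Nat.le_mul_of_pos_left _ hk
  have h3 : I.n ≤ I.k * I.n := Nat.le_mul_of_pos_left _ hk
  have h4 : I.c ≤ I.c * (2 * I.k) := Nat.le_mul_of_pos_right _ (by omega)
  unfold Instance.inputSize
  omega

theorem size_le_inputSize (I : Instance) : I.n.size + I.c.size + 3 ≤ I.inputSize := by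
  unfold Instance.inputSize Instance.encode
  simp only [List.map_append, List.sum_append, List.map_cons, List.sum_cons, List.map_nil,
    List.sum_nil]
  omega

theorem computable_pow_self : Computable fun k : ℕ => k ^ k := by
  have h : Primrec₂ fun (k m : ℕ) => k ^ m := by
    refine (Primrec.nat_rec (f := fun _ : ℕ => 1) (g := fun (k : ℕ) (p : ℕ × ℕ) => p.2 * k)
      (Primrec.const 1) (Primrec.nat_mul.comp (Primrec.snd.comp Primrec.snd) Primrec.fst)).of_eq ?_
    intro k m
    induction m with
    | zero => rfl
    | succ m ih => simp only [pow_succ, ← ih]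
  exact (h.comp Primrec.id Primrec.id).to_comp

theorem tryAllSteps_le {k n c N : ℕ} (h : k + n + c + 3 ≤ N) :
    1 + ((k * 3 + 3) + (k ^ k * (tryPartitionSteps k n c + 2) + 2)) ≤
      40 * ((k ^ k + 1) * ((k + 1) * (k + 1)) * N) := by
  have h1 : tryPartitionSteps k n c + 2 ≤ 30 * ((k + 1) * (k + 1) * N) := by
    unfold tryPartitionSteps
    obtain ⟨e, rfl⟩ := Nat.exists_eq_add_of_le h
    ring_nf
    nlinarith [Nat.zero_le (k * k * e), Nat.zero_le (k * e), Nat.zero_le (k * k * n),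
      Nat.zero_le (k * k * c), Nat.zero_le (k * n), Nat.zero_le (k * c), Nat.zero_le (k * k * k)]
  have h2 : k * 3 + 6 ≤ 3 * ((k + 1) * (k + 1) * N) := by
    have : N ≤ (k + 1) * (k + 1) * N := Nat.le_mul_of_pos_left _ (by positivity)
    omega
  calc 1 + ((k * 3 + 3) + (k ^ k * (tryPartitionSteps k n c + 2) + 2))
      = (k * 3 + 6) + k ^ k * (tryPartitionSteps k n c + 2) := by ring
    _ ≤ 3 * ((k + 1) * (k + 1) * N) + k ^ k * (30 * ((k + 1) * (k + 1) * N)) := by gcongr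
    _ ≤ 40 * ((k + 1) * (k + 1) * N) + k ^ k * (40 * ((k + 1) * (k + 1) * N)) := by
      gcongr <;> norm_num
    _ = _ := by ring

theorem isFPT_wspEq : IsFPT WSPEq := by
  set w := Program.fpt.weight with hw
  -- The exponent is `2`: the word length and the number of steps each contribute one factor `N` and
  -- one factor `k ^ k + 1`.
  refine ⟨fun k => 40 * w * (((k ^ k + 1) * (k ^ k + 1)) * ((k + 1) * (k + 1))), ?_, 2,
    Program.fpt, ?_⟩
  · have h1 : Computable fun k : ℕ => k ^ k + 1 :=
      Primrec.nat_add.to_comp.comp computable_pow_self (Computable.const 1)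
    have h2 : Computable fun k : ℕ => k + 1 := Computable.succ
    exact Primrec.nat_mul.to_comp.comp (Computable.const _)
      (Primrec.nat_mul.to_comp.comp (Primrec.nat_mul.to_comp.comp h1 h1)
        (Primrec.nat_mul.to_comp.comp h2 h2))
  intro I hrel
  have hE := I.encodes_initial
  have hout : I.initial aOut 0 = 0 := by rw [I.initial_of_ne (by norm_num)]; rfl
  have hN := size_le_inputSize I
  have hN' := le_inputSize_of_pos I
  have hbd := fun L => I.bounded_initial (L := L)
  beta_reduce
  generalize I.inputSize = N at hN hN' ⊢
  unfold Instance.CorrectOutput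
  simp only [Instance.c] at hN hN' hbd ⊢
  generalize I.initial = m at hE hout hbd ⊢
  obtain ⟨k, n, W⟩ := I
  simp only [WSPEq] at hE hrel hN hN' hbd ⊢
  generalize hd : m aIn = d at hE
  obtain rfl := hE.steps
  obtain rfl := hE.users
  rw [← hE.constraints] at hN hN' hbd
  rcases Nat.eq_zero_or_pos (d 0) with hk | hk
  -- Without steps `n` and `c` may be exponential in `N`, so the word length must be taken from
  -- their binary lengths.
  · set L := (d 1).size + (d 2).size + 1 with hL
    have hb : d 0 + d 1 + d 2 + 1 < 2 ^ L := by
      have h1 := Nat.lt_size_self (d 1)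
      have h2 := Nat.lt_size_self (d 2)
      have h3 : 2 ^ (d 1).size ≤ 2 ^ ((d 1).size + (d 2).size) :=
        Nat.pow_le_pow_right (by norm_num) (by omega)
      have h4 : 2 ^ (d 2).size ≤ 2 ^ ((d 1).size + (d 2).size) :=
        Nat.pow_le_pow_right (by norm_num) (by omega)
      rw [hL, pow_succ]
      omega
    have hrun : Runs L .fpt m (1 + (1 + 1)) fun m' =>
        (d 2 = 0 ∧ m' aOut 0 = 1) ∨ (d 2 ≠ 0 ∧ m' aOut 0 = 0) := by
      refine Runs.branch (fun h => ?_) fun _ => Runs.branch (fun h => Runs.skip ?_) fun h =>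
        Runs.store (by simp [hL]) ?_
      · rw [Expr.eval_steps hd] at h
        exact absurd hk h
      · rw [Expr.eval_constraints hd] at h
        exact Or.inr ⟨h, hout⟩
      · rw [Expr.eval_constraints hd] at h
        exact Or.inl ⟨h, by simp⟩
    obtain ⟨m', t, he, ht, -, hQ⟩ := hrun (hbd L hb)
    refine ⟨m', t, he, ?_, ht.trans ?_⟩
    · rcases hQ with ⟨h₁, h₂⟩ | ⟨h₁, h₂⟩
      · refine Or.inl ⟨fun s => absurd s.2 (by omega), ⟨fun s => absurd s.2 (by omega), ?_⟩, h₂,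
          fun s => absurd s.2 (by omega)⟩
        rw [hE.constraints, List.length_eq_zero_iff] at h₁
        simp [h₁]
      · refine Or.inr ⟨?_, h₂⟩
        rintro ⟨π, -, hπ⟩
        rw [hE.constraints] at h₁
        obtain ⟨s, -⟩ := hπ _ (List.getElem_mem (Nat.pos_of_ne_zero h₁))
        exact absurd s.2 (by omega)
    · rw [hk, ← hw]
      -- As `0 ^ 0 = 1`, the value of the parameter function at `0` is `160 * w`.
      have h3 : w * ((L + 1) * 3) ≤ w * (160 * N ^ 2) := Nat.mul_le_mul_left _ (by nlinarith)
      calc w * (L + 1) * (1 + (1 + 1)) = w * ((L + 1) * 3) := by ring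
        _ ≤ w * (160 * N ^ 2) := h3
        _ = _ := by norm_num; ring
  · have hNk := hN' hk
    -- A crude choice suffices: all numbers involved are at most `L < 2 ^ L`, and a word length
    -- linear in `N` is affordable.
    set L := d 0 ^ d 0 + d 0 + d 1 + d 2 + 1 with hL
    have hLL : L < 2 ^ L := Nat.lt_two_pow_self
    have hrun : Runs L .fpt m (1 + ((d 0 * 3 + 3) +
        (d 0 ^ d 0 * (tryPartitionSteps (d 0) (d 1) (d 2) + 2) + 2))) _ :=
      Runs.branch (fun _ => tryAll_spec hd hk (by omega) (by omega) (by omega) (by omega) hout)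
        fun h => absurd h (by rw [Expr.eval_steps hd]; omega)
    obtain ⟨m', t, he, ht, -, hQ⟩ := hrun (hbd L (by omega))
    refine ⟨m', t, he, ?_, ht.trans ?_⟩
    · rcases hQ with ⟨h₁, h₂⟩ | ⟨h₁, q, h₂, u, h₃, h₄⟩
      · refine Or.inr ⟨?_, h₁⟩
        rintro ⟨π, hπ⟩
        obtain ⟨q, hq, hq'⟩ := exists_blockFeasible_of_valid hE hrel hπ
        exact h₂ q hq hq'
      · exact Or.inl ⟨_, valid_of_blocks hE hk hrel h₂ h₃, h₁, fun s => h₄ s s.2⟩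
    · rw [← hw]
      have hL' : L + 1 ≤ (d 0 ^ d 0 + 1) * N := by nlinarith [Nat.zero_le (d 0 ^ d 0)]
      calc w * (L + 1) * (1 + ((d 0 * 3 + 3) +
            (d 0 ^ d 0 * (tryPartitionSteps (d 0) (d 1) (d 2) + 2) + 2)))
          ≤ w * ((d 0 ^ d 0 + 1) * N) *
            (40 * ((d 0 ^ d 0 + 1) * ((d 0 + 1) * (d 0 + 1)) * N)) := by
            gcongr
            exact tryAllSteps_le hNk
        _ = _ := by ring

end WSP

theorem theorem5 :
    WSP.SolvableInSoftO WSP.WSP2Eq (fun I => 2 ^ I.k * (I.c + I.n ^ 2)) ∧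
    WSP.SolvableInSoftO WSP.WSPEq (fun I => 2 ^ (I.k + I.c) * (I.c + I.n ^ 2)) ∧
    (∀ I : WSP.Instance, WSP.WSPEq I →
      ∃ C : List (WSP.EntailmentConstraint (Fin I.k) (Fin I.n)),
        C.Sublist I.schema.constraints ∧ C.length ≤ 3 ^ I.k ∧
        ∀ π : Fin I.k → Fin I.n,
          I.schema.Valid π ↔ (I.schema.withConstraints C).Valid π) ∧
    WSP.IsFPT WSP.WSPEq :=
  ⟨WSP.solvable_wsp2Eq, WSP.solvable_wspEq, WSP.exists_sublist_constraints, WSP.isFPT_wspEq⟩
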